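/- Let $\pi:Y\to X$ be a smooth fibered manifold (a surjective submersion), $\dim X=n\ge 1$, $\dim Y=n+m$, let $W\subset Y$ be open and $W^r=(\pi^{r,0})^{-1}(W)\subset J^rY$, where $\pi^{r,s}:J^rY\to J^sY$ are the jet projections. A fibered chart $(V,\psi)$, $\psi=(x^i,y^\sigma)$, has associated jet coordinates $(x^i,y^\sigma,y^\sigma_{j_1},\dots,y^\sigma_{j_1\dots j_r})$ on $V^r$. Put $$d_i=\frac{\partial}{\partial x^i}+\sum_{j_1\le\dots\le j_k}y^\sigma_{j_1\dots j_k i}\frac{\partial}{\partial y^\sigma_{j_1\dots j_k}},\qquad \omega^\sigma_{j_1\dots j_k}=dy^\sigma_{j_1\dots j_k}-y^\sigma_{j_1\dots j_k s}dx^s,$$ $\omega_0=dx^1\wedge\dots\wedge dx^n$ and $\omega_j=i_{\partial/\partial x^j}\omega_0$. The formal derivative $d_i$ acting on $r$-jets is regarded as a vector field along $\pi^{r+1,r}$. The horizontalization $h$ is the morphism of exterior algebras, from forms on $W^r$ to forms on $W^{r+1}$, with $hf=f\circ\pi^{r+1,r}$ and $h\,df=(d_if)\,dx^i$. Repeated indices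 are summed over all values, and $\partial/\partial y^\sigma_{ij}$ is the derivative with respect to the symmetric array $(y^\sigma_{ij})$, normalized by $\partial y^\sigma_{kl}/\partial y^\sigma_{ij}=\tfrac12(\delta_{ik}\delta_{jl}+\delta_{il}\delta_{jk})$ (for the same $\sigma$). An $n$-form $\rho$ on $W^s$ is a Lepage equivalent of an $n$-form $\lambda$ on $W^r$ if (i) $h\rho=\lambda$ after pull-back to a common jet prolongation, and (ii) $h\,i_\xi d\rho=0$ for all $\pi^{s,0}$-vertical vector fields $\xi$ (on $W^s$, or equivalently on the sets $V^s$ with $V\subset W$). Let $\lambda$ be a smooth nowhere-vanishing second-order Lagrangian, i.e. a $\pi^2$-horizontal $n$-form on $W^2$ (where $\pi^2:J^2Y\to X$ is the canonical projection), with chart expression $\lambda=\mathscr L\,\omega_0$, and let $$\Theta_\lambda=\mathscr L\,\omega_0+\Big(\frac{\partial\mathscr L}{\partial y^\sigma_j}-d_p\frac{\partial\mathscr L}{\partial y^\sigma_{pj}}\Big)\omega^\sigma\wedge\omega_j+\frac{\partial\mathscr L}{\partial y^\sigma_{ij}}\,\omega^\sigma_i\wedge\omega_j$$ be its principal Lepage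 form. Then: (a) The chart expressions $$\Lambda_\lambda=\frac1{\mathscr L^{n-1}}\bigwedge_{j=1}^n(-1)^{n-j}\,i_{d_n}\dots i_{d_{j+1}}i_{d_{j-1}}\dots i_{d_1}\Theta_\lambda,$$ for the fibered charts with $V\subset W$, define one smooth $n$-form $\Lambda_\lambda$ on $W^3\subset J^3Y$. (b) In every fibered chart with $V\subset W$, $$\Lambda_\lambda=\frac1{\mathscr L^{n-1}}\bigwedge_{j=1}^n\Big(\mathscr L\,dx^j+\Big(\frac{\partial\mathscr L}{\partial y^\sigma_j}-d_i\frac{\partial\mathscr L}{\partial y^\sigma_{ij}}\Big)\omega^\sigma+\frac{\partial\mathscr L}{\partial y^\sigma_{ij}}\,\omega^\sigma_i\Big).$$ (c) $\Lambda_\lambda$ is a Lepage equivalent of $\lambda$. It is decomposable (over each $V^3$ with $V\subset W$, it is an exterior product of $n$ smooth $1$-forms) and $\pi^{3,1}$-horizontal (it vanishes whenever one of its arguments is $\pi^{3,1}$-vertical). -/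

import Mathlib

open scoped Manifold ContDiff Topology

noncomputable section

namespace JetVar

/-! ### The coordinate jet spaces

Points of the coordinate space `JetModel n m r` are tuples `(x^i, y^σ_J)`, where `J` runs over the
unordered multi-indices `J = {j₁, …, j_k}` with `k ≤ r` (equivalently `j₁ ≤ … ≤ j_k`).  The
coordinate `y^σ` itself is the one with the empty multi-index. -/

/-- Unordered multi-indices of length at most `r` with entries in `{0, …, n - 1}`. -/
abbrev MultiIdx (n r : ℕ) : Type := {J : Multiset (Fin n) // J.card ≤ r}

instance multiIdxFinite (n r : ℕ) : Finite (MultiIdx n r) := by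
  refine Set.Finite.to_subtype (Set.Finite.subset
    (Set.finite_range (fun f : Fin n → Fin (r + 1) =>
      (∑ i, (f i : ℕ) • ({i} : Multiset (Fin n))))) ?_)
  intro J hJ
  refine ⟨fun i => ⟨J.count i, Nat.lt_succ_of_le ((Multiset.count_le_card i J).trans hJ)⟩, ?_⟩
  ext a
  simp [Multiset.count_sum', Multiset.count_singleton]

instance multiIdxFintype (n r : ℕ) : Fintype (MultiIdx n r) := Fintype.ofFinite _

abbrev JetModel (n m r : ℕ) : Type := (Fin n → ℝ) × (MultiIdx n r → Fin m → ℝ)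

/-- The multi-index `J`, regarded as a multi-index of larger length bound. -/
def MultiIdx.incl {n s r : ℕ} (h : s ≤ r) (J : MultiIdx n s) : MultiIdx n r := ⟨J.1, J.2.trans h⟩

/-- The multi-index `J i`, obtained by adjoining the index `i` to `J`. -/
def MultiIdx.adjoin {n r : ℕ} (J : MultiIdx n r) (i : Fin n) : MultiIdx n (r + 1) :=
  ⟨i ::ₘ J.1, by simpa using J.2⟩

section Coordinates

variable {n m : ℕ}

/-- The jet projection `π^{r,s}` in coordinates; it forgets the `y^σ_J` with `|J| > s`. -/
def proj {r s : ℕ} (h : s ≤ r) : JetModel n m r →L[ℝ] JetModel n m s :=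
  (ContinuousLinearMap.fst ℝ _ _).prod
    ((ContinuousLinearMap.pi fun J : MultiIdx n s =>
      ContinuousLinearMap.proj (R := ℝ) (φ := fun _ : MultiIdx n r => Fin m → ℝ) (J.incl h)).comp
      (ContinuousLinearMap.snd ℝ _ _))

/-- The coordinate `1`-form `dx^i`. -/
def dx {r : ℕ} (i : Fin n) : JetModel n m r →L[ℝ] ℝ :=
  (ContinuousLinearMap.proj (R := ℝ) (φ := fun _ : Fin n => ℝ) i).comp
    (ContinuousLinearMap.fst ℝ _ _)

/-- The coordinate `1`-form `dy^σ_J`. -/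
def dy {r : ℕ} (J : MultiIdx n r) (σ : Fin m) : JetModel n m r →L[ℝ] ℝ :=
  (ContinuousLinearMap.proj (R := ℝ) (φ := fun _ : Fin m => ℝ) σ).comp
    ((ContinuousLinearMap.proj (R := ℝ) (φ := fun _ : MultiIdx n r => Fin m → ℝ) J).comp
      (ContinuousLinearMap.snd ℝ _ _))

/-- The coordinate vector `∂/∂x^i`. -/
def ddx {r : ℕ} (i : Fin n) : JetModel n m r := (Pi.single i 1, 0)

/-- The coordinate vector `∂/∂y^σ_J`. -/
def ddy {r : ℕ} (J : MultiIdx n r) (σ : Fin m) : JetModel n m r :=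
  (0, Pi.single J (Pi.single σ 1))

/-- The formal derivative `d_i = ∂/∂x^i + ∑_J y^σ_{Ji} ∂/∂y^σ_J`, as a vector field along the
projection `π^{r+1,r}`: the `(r+1)`-jet `z` gives a tangent vector at the `r`-jet below it. -/
def formalVec {r : ℕ} (i : Fin n) (z : JetModel n m (r + 1)) : JetModel n m r :=
  (Pi.single i 1, fun J => z.2 (J.adjoin i))

/-- The formal derivative `d_i f` of a function `f` of `r`-jets, a function of `(r+1)`-jets. -/
def formalDeriv {r : ℕ} (i : Fin n) (f : JetModel n m r → ℝ) (z : JetModel n m (r + 1)) : ℝ :=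
  fderiv ℝ f (proj (Nat.le_succ r) z) (formalVec i z)

/-- The contact `1`-form `ω^σ_J = dy^σ_J - y^σ_{Js} dx^s`, for `|J| ≤ r`, at an `(r+1)`-jet. -/
def contactForm {r : ℕ} (J : MultiIdx n r) (σ : Fin m) (z : JetModel n m (r + 1)) :
    JetModel n m (r + 1) →L[ℝ] ℝ :=
  dy (J.incl (Nat.le_succ r)) σ - ∑ s : Fin n, z.2 (J.adjoin s) σ • dx s

/-- The linear map `v ↦ ∑_i dx^i(v) d_i` at the `(r+1)`-jet `z`. -/
def horVec {r : ℕ} (z : JetModel n m (r + 1)) : JetModel n m (r + 1) →L[ℝ] JetModel n m r :=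
  ∑ i : Fin n, (dx i).smulRight (formalVec i z)

/-- The horizontalization `h`: the morphism of exterior algebras, from forms of order `r` to forms
of order `r + 1`, with `h f = f ∘ π^{r+1,r}` and `h df = (d_i f) dx^i`. -/
def hor {r q : ℕ} (ρ : JetModel n m r → JetModel n m r [⋀^Fin q]→L[ℝ] ℝ) :
    JetModel n m (r + 1) → JetModel n m (r + 1) [⋀^Fin q]→L[ℝ] ℝ :=
  fun z => (ρ (proj (Nat.le_succ r) z)).compContinuousLinearMap (horVec z)

end Coordinates

/-! ### Exterior algebra -/

section Exterior

variable {E : Type*} [NormedAddCommGroup E] [NormedSpace ℝ E]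

/-- The exterior product `α ∧ β` of a `1`-form and a `q`-form, that is
`(α ∧ β)(v₀, …, v_q) = ∑ᵢ (-1)^i α(vᵢ) β(v₀, …, v̂ᵢ, …, v_q)`. -/
def wedge {q : ℕ} (α : E →L[ℝ] ℝ) (β : E [⋀^Fin q]→L[ℝ] ℝ) : E [⋀^Fin (q + 1)]→L[ℝ] ℝ :=
  ContinuousAlternatingMap.alternatizeUncurryFin (α.smulRight β)

/-- The exterior product `θ₁ ∧ … ∧ θ_k` of `1`-forms. -/
def bigWedge : (k : ℕ) → (Fin k → (E →L[ℝ] ℝ)) → E [⋀^Fin k]→L[ℝ] ℝ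
  | 0, _ => ContinuousAlternatingMap.constOfIsEmpty ℝ E (Fin 0) 1
  | k + 1, θ => wedge (θ 0) (bigWedge k (Fin.tail θ))

/-- The `1`-form `i_{v_k} … i_{v_1} ρ` obtained from a `(k+1)`-form by `k` contractions. -/
def contractToOne : (k : ℕ) → (Fin k → E) → E [⋀^Fin (k + 1)]→L[ℝ] ℝ → (E →L[ℝ] ℝ)
  | 0, _, ρ => (ContinuousAlternatingMap.ofSubsingleton ℝ E ℝ (0 : Fin 1)).symm ρ
  | k + 1, v, ρ => contractToOne k (Fin.tail v) (ρ.curryLeft (v 0))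

end Exterior

/-! ### Fibered charts, jets and differential forms on jet prolongations -/

section Geometry

variable (n m : ℕ) {X Y : Type*}
  [TopologicalSpace X] [ChartedSpace (Fin n → ℝ) X]
  [TopologicalSpace Y] [ChartedSpace ((Fin n → ℝ) × (Fin m → ℝ)) Y]

/-- A fibered manifold: a smooth surjective submersion. -/
structure IsFiberedManifold (π : Y → X) : Prop where
  surjective : Function.Surjective π
  submersion : Manifold.IsSubmersion 𝓘(ℝ, (Fin n → ℝ) × (Fin m → ℝ)) 𝓘(ℝ, Fin n → ℝ) ∞ π

/-- A fibered chart `(V, ψ)`, `ψ = (x^i, y^σ)`, on `Y`, together with the chart `(π(V), φ)`,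
`φ = (x^i)`, on `X` associated with it. -/
structure FiberedChart (π : Y → X) where
  ψ : OpenPartialHomeomorph Y ((Fin n → ℝ) × (Fin m → ℝ))
  φ : OpenPartialHomeomorph X (Fin n → ℝ)
  ψ_mem : ψ ∈ IsManifold.maximalAtlas 𝓘(ℝ, (Fin n → ℝ) × (Fin m → ℝ)) ∞ Y
  φ_mem : φ ∈ IsManifold.maximalAtlas 𝓘(ℝ, Fin n → ℝ) ∞ X
  source_eq : φ.source = π '' ψ.source
  fst_eq : ∀ y ∈ ψ.source, (ψ y).1 = φ (π y)

/-- A smooth section of `π`, defined around the point `pt` of `X`. -/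
structure PointedSection (π : Y → X) where
  pt : X
  sec : X → Y
  isSection : ∀ᶠ x in 𝓝 pt,
    ContMDiffAt 𝓘(ℝ, Fin n → ℝ) 𝓘(ℝ, (Fin n → ℝ) × (Fin m → ℝ)) ∞ sec x ∧ π (sec x) = x

variable {n m} {π : Y → X}

/-- The iterated partial derivative `∂^k f / ∂x^{j₁} … ∂x^{j_k}`, `J = {j₁ ≤ … ≤ j_k}`. -/
def iterPartial (J : Multiset (Fin n)) (f : (Fin n → ℝ) → (Fin m → ℝ)) :
    (Fin n → ℝ) → (Fin m → ℝ) :=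
  (J.sort (· ≤ ·)).foldr (fun j g u => fderiv ℝ g u (Pi.single j 1)) f

/-- The components `y^σ ∘ γ ∘ φ⁻¹` of a section `γ` in a fibered chart. -/
def FiberedChart.components (c : FiberedChart n m π) (γ : X → Y) : (Fin n → ℝ) → (Fin m → ℝ) :=
  fun u => (c.ψ (γ (c.φ.symm u))).2

/-- The coordinates of the `r`-jet of a section `γ` at a point `x`, with respect to a fibered chart
around `γ x`: `x^i = φ^i(x)` and `y^σ_J = ∂_J (y^σ ∘ γ ∘ φ⁻¹)(φ(x))`. -/
def FiberedChart.sectionCoord (c : FiberedChart n m π) (r : ℕ) (p : PointedSection n m π) :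
    JetModel n m r :=
  (c.φ p.pt, fun J => iterPartial J.1 (c.components p.sec) (c.φ p.pt))

variable (n m π) in
/-- Two sections have the same `r`-jet (at the same point of `X`) if they have the same value there
and the same derivatives up to order `r` in fibered charts around that value. -/
def jetSetoid (r : ℕ) : Setoid (PointedSection n m π) where
  r p q := p.pt = q.pt ∧ p.sec p.pt = q.sec q.pt ∧
    ∀ c : FiberedChart n m π, p.sec p.pt ∈ c.ψ.source → c.sectionCoord r p = c.sectionCoord r q
  iseqv :=
    { refl := fun _ => ⟨rfl, rfl, fun _ _ => rfl⟩
      symm := fun h => ⟨h.1.symm, h.2.1.symm, fun c hc => (h.2.2 c (h.2.1 ▸ hc)).symm⟩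
      trans := fun h k => ⟨h.1.trans k.1, h.2.1.trans k.2.1,
        fun c hc => (h.2.2 c hc).trans (k.2.2 c (h.2.1 ▸ hc))⟩ }

variable (n m π) in
/-- The `r`-th jet prolongation `J^r Y` (its points). -/
def Jet (r : ℕ) : Type _ := Quotient (jetSetoid n m π r)

/-- The projection `π^{r,0} : J^r Y → Y`. -/
def Jet.target {r : ℕ} : Jet n m π r → Y :=
  Quotient.lift (fun p : PointedSection n m π => p.sec p.pt) (fun _ _ h => h.2.1)

/-- The domain `V^r = (π^{r,0})⁻¹(V)` of the chart on `J^r Y` associated with `(V, ψ)`. -/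
def FiberedChart.jetDomain (c : FiberedChart n m π) (r : ℕ) : Set (Jet n m π r) :=
  {p | p.target ∈ c.ψ.source}

open Classical in
/-- The chart `ψ^r = (x^i, y^σ_J)` on `V^r ⊆ J^r Y` associated with `(V, ψ)` (zero off `V^r`). -/
def FiberedChart.jetCoord (c : FiberedChart n m π) (r : ℕ) : Jet n m π r → JetModel n m r :=
  Quotient.lift
    (fun p : PointedSection n m π => if p.sec p.pt ∈ c.ψ.source then c.sectionCoord r p else 0)
    (by
      intro p q h
      have h2 : p.sec p.pt = q.sec q.pt := h.2.1
      by_cases hc : p.sec p.pt ∈ c.ψ.source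
      · have hq : q.sec q.pt ∈ c.ψ.source := h2 ▸ hc
        simp only [hc, hq, if_true]
        exact h.2.2 c hc
      · have hq : q.sec q.pt ∉ c.ψ.source := h2 ▸ hc
        simp only [hc, hq, if_false])

/-- The coordinate domain `ψ^r(V^r)`, a subset of the coordinate jet space. -/
def FiberedChart.jetRange (c : FiberedChart n m π) (r : ℕ) : Set (JetModel n m r) :=
  c.jetCoord r '' c.jetDomain r

open Classical in
/-- The transition map `ψ̄^r ∘ (ψ^r)⁻¹` between two charts on `J^r Y`; it is meant on
`ψ^r(V^r ∩ V̄^r)`. -/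
def FiberedChart.jetTransition (c c' : FiberedChart n m π) (r : ℕ) (z : JetModel n m r) :
    JetModel n m r :=
  if h : ∃ p ∈ c.jetDomain r, c.jetCoord r p = z then c'.jetCoord r h.choose else 0

variable (n m π) in
/-- A smooth differential `q`-form on `W^r = (π^{r,0})⁻¹(W) ⊆ J^r Y`, for `W ⊆ Y` open: a family of
smooth `q`-forms on the coordinate domains `ψ^r(V^r)`, one for every fibered chart with `V ⊆ W`,
which are carried into each other by the pull-backs along the transition maps.  Only the values on
the coordinate domains are meaningful. -/
structure JetForm (W : TopologicalSpace.Opens Y) (r q : ℕ) where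
  rep : FiberedChart n m π → JetModel n m r → JetModel n m r [⋀^Fin q]→L[ℝ] ℝ
  smooth : ∀ c : FiberedChart n m π, c.ψ.source ⊆ W → ContDiffOn ℝ ∞ (rep c) (c.jetRange r)
  compatible : ∀ c c' : FiberedChart n m π, c.ψ.source ⊆ W → c'.ψ.source ⊆ W →
    ∀ z ∈ c.jetCoord r '' (c.jetDomain r ∩ c'.jetDomain r),
      rep c z = (rep c' (c.jetTransition c' r z)).compContinuousLinearMap
        (fderiv ℝ (c.jetTransition c' r) z)

variable {W : TopologicalSpace.Opens Y}

/-- The form is `π^r`-horizontal: it vanishes as soon as one of its arguments is `π^r`-vertical. -/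
def JetForm.IsBaseHorizontal {r q : ℕ} (ρ : JetForm n m π W r q) : Prop :=
  ∀ c : FiberedChart n m π, c.ψ.source ⊆ W → ∀ z ∈ c.jetRange r,
    ∀ v : Fin q → JetModel n m r, (∃ i, (v i).1 = 0) → ρ.rep c z v = 0

/-- The form is `π^{r,s}`-horizontal: it vanishes as soon as one of its arguments is
`π^{r,s}`-vertical. -/
def JetForm.IsHorizontal {r q : ℕ} (ρ : JetForm n m π W r q) (s : ℕ) (h : s ≤ r) : Prop :=
  ∀ c : FiberedChart n m π, c.ψ.source ⊆ W → ∀ z ∈ c.jetRange r,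
    ∀ v : Fin q → JetModel n m r, (∃ i, proj h (v i) = 0) → ρ.rep c z v = 0

/-- The form vanishes at no point of `W^r`. -/
def JetForm.NowhereVanishing {r q : ℕ} (ρ : JetForm n m π W r q) : Prop :=
  ∀ c : FiberedChart n m π, c.ψ.source ⊆ W → ∀ z ∈ c.jetRange r, ρ.rep c z ≠ 0

/-- The form is (locally) decomposable: an exterior product of `1`-forms. -/
def JetForm.IsDecomposable {r q : ℕ} (ρ : JetForm n m π W r q) : Prop :=
  ∀ c : FiberedChart n m π, c.ψ.source ⊆ W →
    ∃ θ : Fin q → JetModel n m r → (JetModel n m r →L[ℝ] ℝ),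
      (∀ j, ContDiffOn ℝ ∞ (θ j) (c.jetRange r)) ∧
      ∀ z ∈ c.jetRange r, ρ.rep c z = bigWedge q (fun j => θ j z)

/-- `ρ` is a Lepage equivalent of the `n`-form `lam` of order `r`: `h ρ = lam` up to pull-back to a
common jet prolongation, and `h i_ξ dρ = 0` for the `π^{s,0}`-vertical vector fields `ξ`.  The fields
`ξ` range over the smooth vertical vector fields on the domains `V^s`, `V ⊆ W`, which include the
restrictions of those defined on all of `W^s`. -/
structure JetForm.IsLepageEquivalent {r s : ℕ} (ρ : JetForm n m π W s n)
    (lam : JetForm n m π W r n) : Prop where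
  equivalent : ∀ c : FiberedChart n m π, c.ψ.source ⊆ W →
    ∀ (q : ℕ) (hs : s + 1 ≤ q) (hr : r ≤ q), ∀ z ∈ c.jetRange q,
      (hor (ρ.rep c) (proj hs z)).compContinuousLinearMap (proj hs) =
        (lam.rep c (proj hr z)).compContinuousLinearMap (proj hr)
  lepage : ∀ c : FiberedChart n m π, c.ψ.source ⊆ W →
    ∀ ξ : JetModel n m s → JetModel n m s, ContDiffOn ℝ ∞ ξ (c.jetRange s) →
      (∀ w ∈ c.jetRange s, proj (Nat.zero_le s) (ξ w) = 0) →
      ∀ z ∈ c.jetRange (s + 1),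
        hor (fun w => (extDeriv (ρ.rep c) w).curryLeft (ξ w)) z = 0

/-- The Lagrange function `L` of a horizontal `n`-form `lam` in a fibered chart: the coefficient in
`lam = L dx^1 ∧ … ∧ dx^n`, that is, `L = lam(∂/∂x^1, …, ∂/∂x^n)`. -/
def JetForm.lagrange {r : ℕ} (lam : JetForm n m π W r n) (c : FiberedChart n m π)
    (z : JetModel n m r) : ℝ :=
  lam.rep c z (fun i => ddx i)

end Geometry

/-! ### The principal Lepage form and the Carathéodory form of a second-order Lagrangian

Here `dim X = n + 1`, and `L` is the Lagrange function in a fibered chart. -/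

section Second

variable {n m : ℕ}

/-- The empty multi-index. -/
def idx0 {r : ℕ} : MultiIdx n r := ⟨0, by simp⟩

/-- The multi-index `i`. -/
def idx1 {r : ℕ} (i : Fin n) : MultiIdx n (r + 1) := idx0.adjoin i

/-- The multi-index `ij`. -/
def idx2 {r : ℕ} (i j : Fin n) : MultiIdx n (r + 2) := (idx1 j).adjoin i

/-- The derivative `∂L/∂y^σ_j`. -/
def partial1 (L : JetModel n m 2 → ℝ) (σ : Fin m) (j : Fin n) (w : JetModel n m 2) : ℝ :=
  fderiv ℝ L w (ddy (idx1 j) σ)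

/-- The derivative `∂L/∂y^σ_{ij}` with respect to the symmetric array `(y^σ_{ij})`, normalized, as
usual when one sums over all `i` and `j`, by `∂y^σ_{kl}/∂y^σ_{ij} = (δ_{ik}δ_{jl} + δ_{il}δ_{jk})/2`.
For `i ≠ j` this is half of the derivative along the independent coordinate `y^σ_{ij}`. -/
def partial2 (L : JetModel n m 2 → ℝ) (σ : Fin m) (i j : Fin n) (w : JetModel n m 2) : ℝ :=
  (if i = j then 1 else 1 / 2) * fderiv ℝ L w (ddy (idx2 i j) σ)

/-- The coefficient `∂L/∂y^σ_j - d_i ∂L/∂y^σ_{ij}`, a function of `3`-jets. -/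
def momentum (L : JetModel n m 2 → ℝ) (σ : Fin m) (j : Fin n) (z : JetModel n m 3) : ℝ :=
  partial1 L σ j (proj (by norm_num) z) - ∑ i : Fin n, formalDeriv i (partial2 L σ i j) z

/-- The volume form `ω₀ = dx^1 ∧ … ∧ dx^n`. -/
def vol {r : ℕ} : JetModel n m r [⋀^Fin n]→L[ℝ] ℝ := bigWedge n (fun i => dx i)

/-- The form `ω_j = i_{∂/∂x^j} ω₀`. -/
def volContract {r : ℕ} (j : Fin (n + 1)) : JetModel (n + 1) m r [⋀^Fin n]→L[ℝ] ℝ :=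
  (vol (n := n + 1)).curryLeft (ddx j)

/-- The principal Lepage form
`Θ = L ω₀ + (∂L/∂y^σ_j - d_p ∂L/∂y^σ_{pj}) ω^σ ∧ ω_j + ∂L/∂y^σ_{ij} ω^σ_i ∧ ω_j` at a `3`-jet. -/
def principalLepage (L : JetModel (n + 1) m 2 → ℝ) (z : JetModel (n + 1) m 3) :
    JetModel (n + 1) m 3 [⋀^Fin (n + 1)]→L[ℝ] ℝ :=
  L (proj (by norm_num) z) • vol
    + ∑ σ : Fin m, ∑ j : Fin (n + 1),
        momentum L σ j z • wedge (contactForm idx0 σ z) (volContract j)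
    + ∑ σ : Fin m, ∑ i : Fin (n + 1), ∑ j : Fin (n + 1),
        partial2 L σ i j (proj (by norm_num) z) •
          wedge (contactForm (idx1 i) σ z) (volContract j)

/-- The expression `L^{1-N} ⋀_{j=1}^N (-1)^{N-j} i_{d_N} … î_{d_j} … i_{d_1} Θ`, `N = n + 1`, with the
formal derivatives `d_i` taken at the `4`-jet `z` and `Θ` at the `3`-jet below it.  (The index `j`
counts from `0` in the code, so that `N - j` becomes `n - j`.) -/
def caratheodoryContraction (L : JetModel (n + 1) m 2 → ℝ) (z : JetModel (n + 1) m 4) :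
    JetModel (n + 1) m 3 [⋀^Fin (n + 1)]→L[ℝ] ℝ :=
  (1 / L (proj (by norm_num) z) ^ n) •
    bigWedge (n + 1) (fun j : Fin (n + 1) =>
      (-1 : ℝ) ^ (n - (j : ℕ)) •
        contractToOne n (fun i : Fin n => formalVec (j.succAbove i) z)
          (principalLepage L (proj (by norm_num) z)))

/-- The `1`-form `L dx^j + (∂L/∂y^σ_j - d_i ∂L/∂y^σ_{ij}) ω^σ + ∂L/∂y^σ_{ij} ω^σ_i` at a `3`-jet. -/
def caratheodoryFactor (L : JetModel n m 2 → ℝ) (j : Fin n) (z : JetModel n m 3) :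
    JetModel n m 3 →L[ℝ] ℝ :=
  L (proj (by norm_num) z) • dx j
    + ∑ σ : Fin m, momentum L σ j z • contactForm idx0 σ z
    + ∑ σ : Fin m, ∑ i : Fin n,
        partial2 L σ i j (proj (by norm_num) z) • contactForm (idx1 i) σ z

/-- The expression
`L^{1-N} ⋀_{j=1}^N (L dx^j + (∂L/∂y^σ_j - d_i ∂L/∂y^σ_{ij}) ω^σ + ∂L/∂y^σ_{ij} ω^σ_i)`, `N = n + 1`. -/
def caratheodoryProduct (L : JetModel (n + 1) m 2 → ℝ) (z : JetModel (n + 1) m 3) :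
    JetModel (n + 1) m 3 [⋀^Fin (n + 1)]→L[ℝ] ℝ :=
  (1 / L (proj (by norm_num) z) ^ n) •
    bigWedge (n + 1) (fun j : Fin (n + 1) => caratheodoryFactor L j z)

end Second

end JetVar

end

open JetVar

/-! Let N = n + 1 be the dimension of the base and θ^j the 1-forms `caratheodoryFactor`. In a single
chart everything rests on one duality: contact forms vanish on every lift of a formal derivative, so
θ^i(d_k) = L δ_ik, and contracting Θ with all d_k except d_j leaves θ^j, up to the sign placed in
the definition. Hence the contraction formula is the product formula (`caratheodoryContraction_eq`),
and the fourth-order coordinates drop out. Since the horizontal part of θ^j is L dx^j, that of Λ =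
L^{1-N} θ^1 ∧ … ∧ θ^N is L ω₀.

For the Lepage property only the number dΛ(ξ, d_1, …, d_N) matters. The vectors are extended to
fields that commute at the given jet, so the invariant formula for dΛ has no bracket terms. By
duality Λ(d_1, …, d_N) = L, and Λ(V, d_1, …, d_N) with d_i omitted is ± θ^i(V). What remains is ξ(L)
- ∑ d_i(θ^i(V)), and for ξ without y^σ-component this vanishes precisely because the momenta are
∂L/∂y^σ_j - d_p ∂L/∂y^σ_{pj} (`extDeriv_caratheodoryProduct`).

Under a change of fibered charts T with base Jacobian J and K = J⁻¹, the Lagrange functions satisfy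
L = det J · (L̄ ∘ T), and the factors transform linearly: θ^q = ∑_j det J · K_qj · T*θ̄^j
(`caratheodoryFactor_transform`). The determinant of det J · K is (det J)^{N-1}, which cancels
against L^{1-N}, so the local products fit together. The delicate point is the momentum. The
derivatives of det J · K disappear by the Piola identity; the derivatives of ∂ȳ^σ_l/∂y^ν_p coming
from d_i ∂L/∂y^ν_{iq} cancel against those in ∂L/∂y^ν_q; the one inhomogeneous term left is matched
by the one in the pull-back of ω̄^σ_i.

The facts needed about T (smoothness, compatibility with projections, d_i ↦ ∑_k J_ki d̄_k) come from
differentiating T ∘ j^rγ = j^rγ̄ ∘ G along sections, where G is the base transition; Taylor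
polynomials provide a section through every coordinate jet (`exists_jetFun_eq`,
`jetsDetermined_and_contDiffOn`). -/

noncomputable section

namespace JetVar

/-! ### Products of 1-forms as determinants, and signs of contractions. -/

section ExteriorLemmas

variable {E : Type*} [NormedAddCommGroup E] [NormedSpace ℝ E]

theorem wedge_apply {q : ℕ} (α : E →L[ℝ] ℝ) (β : E [⋀^Fin q]→L[ℝ] ℝ) (v : Fin (q + 1) → E) :
    wedge α β v = ∑ i : Fin (q + 1), (-1 : ℝ) ^ (i : ℕ) * (α (v i) * β (i.removeNth v)) := by
  simp [wedge, ContinuousAlternatingMap.alternatizeUncurryFin_apply]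

/-- The recursive definition is Laplace expansion along the first row. All later identities for
products of 1-forms become identities for determinants. -/
theorem bigWedge_apply : ∀ (k : ℕ) (θ : Fin k → (E →L[ℝ] ℝ)) (v : Fin k → E),
    bigWedge k θ v = Matrix.det (Matrix.of fun i j => θ i (v j))
  | 0, _, _ => by simp [bigWedge]
  | k + 1, θ, v => by
    rw [bigWedge, wedge_apply, Matrix.det_succ_row_zero]
    refine Finset.sum_congr rfl fun i _ => ?_
    rw [bigWedge_apply k, mul_assoc]
    rfl

theorem bigWedge_smul {k : ℕ} (a : ℝ) (θ : Fin k → (E →L[ℝ] ℝ)) :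
    bigWedge k (fun j => a • θ j) = a ^ k • bigWedge k θ := by
  ext v
  have h : (Matrix.of fun i j => (a • θ i) (v j)) = a • Matrix.of fun i j => θ i (v j) := by
    ext i j; simp
  rw [ContinuousAlternatingMap.smul_apply, bigWedge_apply, bigWedge_apply, h, Matrix.det_smul]
  simp

/-- Multiplicativity of the determinant; this converts the linear transformation law of the factors
into a scalar factor of the product. -/
theorem bigWedge_sum_smul {k : ℕ} (A : Matrix (Fin k) (Fin k) ℝ) (θ : Fin k → (E →L[ℝ] ℝ)) :
    bigWedge k (fun j => ∑ i, A j i • θ i) = A.det • bigWedge k θ := by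
  ext v
  have h : (Matrix.of fun i j => (∑ l, A i l • θ l) (v j)) = A * Matrix.of fun i j => θ i (v j) := by
    ext i j; simp [Matrix.mul_apply]
  rw [ContinuousAlternatingMap.smul_apply, bigWedge_apply, bigWedge_apply, h, Matrix.det_mul]
  simp

/-- Puts the prefactor L^{1-N} into one factor, so that the form is literally a product of 1-forms.
-/
theorem bigWedge_smul_zero {k : ℕ} (a : ℝ) (θ : Fin (k + 1) → (E →L[ℝ] ℝ)) :
    bigWedge (k + 1) (fun j => if j = 0 then a • θ j else θ j) = a • bigWedge (k + 1) θ := by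
  have h : (fun j : Fin (k + 1) => if j = 0 then a • θ j else θ j)
      = fun j => ∑ i, Matrix.diagonal (fun i : Fin (k + 1) => if i = 0 then a else 1) j i • θ i := by
    funext j
    simp only [Matrix.diagonal_apply, ite_smul, zero_smul, Finset.sum_ite_eq, Finset.mem_univ,
      if_true, one_smul]
  rw [h, bigWedge_sum_smul, Matrix.det_diagonal]
  simp

theorem bigWedge_comp {F : Type*} [NormedAddCommGroup F] [NormedSpace ℝ F] {k : ℕ}
    (θ : Fin k → (F →L[ℝ] ℝ)) (A : E →L[ℝ] F) :
    (bigWedge k θ).compContinuousLinearMap A = bigWedge k (fun j => (θ j).comp A) := by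
  ext v
  simp [bigWedge_apply]

/-- A wedge product evaluated on a family of vectors, all but one of which are dual to it. -/
theorem bigWedge_update {k : ℕ} (a : ℝ) (θ : Fin (k + 1) → (E →L[ℝ] ℝ)) (d : Fin (k + 1) → E)
    (h : ∀ i j, θ i (d j) = if i = j then a else 0) (j : Fin (k + 1)) (v : E) :
    bigWedge (k + 1) θ (Function.update d j v) = a ^ k * θ j v := by
  have h1 : (Matrix.of fun i l => θ i (Function.update d j v l))
      = (a • (1 : Matrix (Fin (k + 1)) (Fin (k + 1)) ℝ)).updateCol j (fun i => θ i v) := by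
    ext i l
    by_cases hl : l = j
    · subst hl; simp
    · simp [hl, h, Matrix.one_apply]
  -- Cramer's rule: the adjugate of a • 1 is a^k • 1, so no division by a is needed.
  rw [bigWedge_apply, h1, ← Matrix.cramer_apply, Matrix.cramer_eq_adjugate_mulVec,
    Matrix.adjugate_smul]
  simp [Matrix.smul_mulVec]

theorem bigWedge_dual {k : ℕ} (a : ℝ) (θ : Fin k → (E →L[ℝ] ℝ)) (d : Fin k → E)
    (h : ∀ i j, θ i (d j) = if i = j then a else 0) :
    bigWedge k θ d = a ^ k := by
  have h1 : (Matrix.of fun i l => θ i (d l)) = a • (1 : Matrix (Fin k) (Fin k) ℝ) := by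
    ext i l
    simp [h, Matrix.one_apply]
  rw [bigWedge_apply, h1]
  simp

theorem map_cons_removeNth {k : ℕ} (β : E [⋀^Fin (k + 1)]→L[ℝ] ℝ) (d : Fin (k + 1) → E)
    (j : Fin (k + 1)) (v : E) :
    β (Matrix.vecCons v (j.removeNth d)) = (-1 : ℝ) ^ (j : ℕ) * β (Function.update d j v) := by
  have h := β.map_insertNth j v (j.removeNth d)
  rw [Fin.insertNth_removeNth] at h
  rw [h, zsmul_eq_mul, ← mul_assoc]
  push_cast
  rw [← mul_pow]
  simp

/-- Each contraction fills the first free slot, so the remaining argument lands in the last one. -/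
theorem contractToOne_apply : ∀ (k : ℕ) (v : Fin k → E) (ρ : E [⋀^Fin (k + 1)]→L[ℝ] ℝ) (w : E),
    contractToOne k v ρ w = ρ (Fin.snoc (α := fun _ => E) v w)
  | 0, v, ρ, w => by
    change ρ (fun _ => w) = _
    congr 1
  | k + 1, v, ρ, w => by
    rw [contractToOne, contractToOne_apply k]
    change ρ (Matrix.vecCons (v 0) (Fin.snoc (α := fun _ => E) (Fin.tail v) w)) = _
    congr 1
    change (Fin.cons (v 0) (Fin.snoc (α := fun _ => E) (Fin.tail v) w) : Fin (k + 2) → E) = _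
    rw [Fin.cons_snoc_eq_snoc_cons, Fin.cons_self_tail]

/-- Moving v from the last slot to slot j passes k - j vectors; this is the sign in the definition
of the contraction form. -/
theorem map_snoc_removeNth {k : ℕ} (β : E [⋀^Fin (k + 1)]→L[ℝ] ℝ) (d : Fin (k + 1) → E)
    (j : Fin (k + 1)) (v : E) :
    (-1 : ℝ) ^ (k - (j : ℕ)) * β (Fin.snoc (α := fun _ => E) (fun i => d (j.succAbove i)) v) =
      β (Function.update d j v) := by
  have h1 := β.map_insertNth (Fin.last k) v (j.removeNth d)
  have h2 := map_cons_removeNth β d j v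
  have hj : (j : ℕ) ≤ k := Nat.lt_succ_iff.1 j.2
  rw [Fin.insertNth_last', h2, zsmul_eq_mul, ← mul_assoc] at h1
  change (-1 : ℝ) ^ (k - (j : ℕ)) * β (Fin.snoc (α := fun _ => E) (j.removeNth d) v) = _
  rw [h1, ← mul_assoc]
  push_cast
  rw [← mul_assoc, ← pow_add, ← pow_add, Even.neg_one_pow ⟨k, by omega⟩, one_mul]

theorem contDiffOn_bigWedge {F : Type*} [NormedAddCommGroup F] [NormedSpace ℝ F] {s : Set F} :
    ∀ (k : ℕ) (θ : Fin k → F → (E →L[ℝ] ℝ)), (∀ j, ContDiffOn ℝ ∞ (θ j) s) →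
      ContDiffOn ℝ ∞ (fun z => bigWedge k (fun j => θ j z)) s
  | 0, _, _ => contDiffOn_const
  | k + 1, θ, h => by
    have h1 := contDiffOn_bigWedge k (fun j => θ j.succ) (fun j => h _)
    have h2 : ContDiffOn ℝ ∞ (fun z => (θ 0 z).smulRight (bigWedge k (fun j => θ j.succ z))) s :=
      (h 0).smulRight h1
    exact (ContinuousAlternatingMap.alternatizeUncurryFinCLM ℝ E ℝ).contDiff.comp_contDiffOn h2

end ExteriorLemmas

end JetVar

namespace JetVar

/-! ### Coordinates, contact forms and derivatives along symmetric second-order coordinates. -/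

section CoordinateLemmas

variable {n m : ℕ}

@[simp] theorem proj_fst {r s : ℕ} (h : s ≤ r) (z : JetModel n m r) : (proj h z).1 = z.1 := rfl

@[simp] theorem proj_snd {r s : ℕ} (h : s ≤ r) (z : JetModel n m r) (J : MultiIdx n s) :
    (proj h z).2 J = z.2 (J.incl h) := rfl

@[simp] theorem dx_apply {r : ℕ} (i : Fin n) (v : JetModel n m r) : dx i v = v.1 i := rfl

@[simp] theorem dy_apply {r : ℕ} (J : MultiIdx n r) (σ : Fin m) (v : JetModel n m r) :
    dy J σ v = v.2 J σ := rfl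

theorem proj_proj {r s t : ℕ} (h : s ≤ r) (h' : t ≤ s) (z : JetModel n m r) :
    proj h' (proj h z) = proj (h'.trans h) z := rfl

theorem contactForm_apply {r : ℕ} (J : MultiIdx n r) (σ : Fin m) (z v : JetModel n m (r + 1)) :
    contactForm J σ z v =
      v.2 (J.incl (Nat.le_succ r)) σ - ∑ s : Fin n, z.2 (J.adjoin s) σ * v.1 s := by
  simp [contactForm]

theorem horVec_apply {r : ℕ} (z v : JetModel n m (r + 1)) :
    horVec z v = ∑ i : Fin n, v.1 i • formalVec i z := by
  simp [horVec]

@[simp] theorem formalVec_fst {r : ℕ} (i : Fin n) (z : JetModel n m (r + 1)) :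
    (formalVec i z).1 = Pi.single i 1 := rfl

@[simp] theorem formalVec_snd {r : ℕ} (i : Fin n) (z : JetModel n m (r + 1)) (J : MultiIdx n r) :
    (formalVec i z).2 J = z.2 (J.adjoin i) := rfl

@[simp] theorem ddy_fst {r : ℕ} (J : MultiIdx n r) (σ : Fin m) :
    (ddy J σ : JetModel n m r).1 = 0 := rfl

theorem ddy_snd {r : ℕ} (J K : MultiIdx n r) (σ τ : Fin m) :
    (ddy J σ : JetModel n m r).2 K τ = if K = J then (if τ = σ then 1 else 0) else 0 := by
  simp only [ddy, Pi.single_apply]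
  split_ifs <;> simp_all

theorem horVec_fst {r : ℕ} (z v : JetModel n m (r + 1)) : (horVec z v).1 = v.1 := by
  rw [horVec_apply]
  ext i
  simp [Pi.single_apply, Prod.fst_sum]

/-- The contact forms read off the vertical part of a vector. -/
theorem contactForm_eq_vertical {r : ℕ} (J : MultiIdx n r) (σ : Fin m)
    (z v : JetModel n m (r + 1)) :
    contactForm J σ z v = (proj (Nat.le_succ r) v - horVec z v).2 J σ := by
  rw [contactForm_apply, horVec_apply]
  simp [Prod.snd_sum, mul_comm]

theorem MultiIdx.cases_two {p : MultiIdx n 2 → Prop} (h0 : p idx0) (h1 : ∀ j, p (idx1 j))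
    (h2 : ∀ i j, p (idx2 i j)) (J : MultiIdx n 2) : p J := by
  obtain ⟨J, hJ⟩ := J
  obtain h | h | h : J.card = 0 ∨ J.card = 1 ∨ J.card = 2 := by omega
  · obtain rfl := Multiset.card_eq_zero.1 h
    exact h0
  · obtain ⟨a, rfl⟩ := Multiset.card_eq_one.1 h
    exact h1 a
  · obtain ⟨a, b, rfl⟩ := Multiset.card_eq_two.1 h
    exact h2 a b

theorem MultiIdx.eq_idx0 (J : MultiIdx n 0) : J = idx0 :=
  Subtype.ext (Multiset.card_eq_zero.1 (Nat.le_zero.1 J.2))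

theorem idx1_inj {r : ℕ} {i j : Fin n} : (idx1 i : MultiIdx n (r + 1)) = idx1 j ↔ i = j := by
  simp [idx1, idx0, MultiIdx.adjoin]

theorem idx1_ne_idx0 {r : ℕ} (i : Fin n) : (idx1 i : MultiIdx n (r + 1)) ≠ idx0 := by
  simp [idx1, idx0, MultiIdx.adjoin, Subtype.ext_iff]

theorem idx2_ne_idx0 {r : ℕ} (i j : Fin n) : (idx2 i j : MultiIdx n (r + 2)) ≠ idx0 := by
  simp [idx2, idx1, idx0, MultiIdx.adjoin, Subtype.ext_iff]

theorem idx2_ne_idx1 {r : ℕ} (i j k : Fin n) : (idx2 i j : MultiIdx n (r + 2)) ≠ idx1 k := by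
  intro h
  have := congrArg (fun J : MultiIdx n (r + 2) => J.1.card) h
  simp [idx2, idx1, idx0, MultiIdx.adjoin] at this

theorem idx2_eq_iff {r : ℕ} {i j p q : Fin n} : (idx2 i j : MultiIdx n (r + 2)) = idx2 p q ↔
    (i = p ∧ j = q) ∨ (i = q ∧ j = p) := by
  simp only [idx2, idx1, idx0, MultiIdx.adjoin, Subtype.mk.injEq]
  rw [Multiset.cons_eq_cons]
  simp only [Multiset.cons_zero, Multiset.singleton_eq_cons_iff, Multiset.singleton_inj]
  grind

theorem idx2_comm {r : ℕ} (i j : Fin n) : (idx2 i j : MultiIdx n (r + 2)) = idx2 j i :=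
  idx2_eq_iff.2 (Or.inr ⟨rfl, rfl⟩)

/-- The weight in `partial2` is exactly what turns the derivative along an independent coordinate
into the symmetric normalization of ∂y_{pq}/∂y_{ij}. -/
theorem weight_eq {i j p q : Fin n} :
    (if i = j then (1 : ℝ) else 1 / 2) * (if (idx2 p q : MultiIdx n 2) = idx2 i j then 1 else 0)
      = 1 / 2 * ((if p = i then 1 else 0) * (if q = j then 1 else 0)
        + (if p = j then 1 else 0) * (if q = i then 1 else 0)) := by
  simp only [idx2_eq_iff]
  split_ifs <;> (simp_all; try norm_num)

/-- A sum over ordered pairs meets every off-diagonal coordinate twice; the weight 1/2 compensates.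
-/
theorem vertical_expansion (v : JetModel n m 2) (hv : v.1 = 0) :
    v = ∑ σ : Fin m, (v.2 idx0 σ • ddy idx0 σ + ∑ j : Fin n, v.2 (idx1 j) σ • ddy (idx1 j) σ
      + ∑ i : Fin n, ∑ j : Fin n,
          (v.2 (idx2 i j) σ * (if i = j then 1 else 1 / 2)) • ddy (idx2 i j) σ) := by
  refine Prod.ext ?_ ?_
  · simp only [Prod.fst_sum, Prod.fst_add, Prod.smul_fst, ddy_fst, smul_zero,
      Finset.sum_const_zero, add_zero, hv]
  · funext J τ
    simp only [Prod.snd_sum, Prod.snd_add, Prod.smul_snd, Finset.sum_apply, Pi.add_apply,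
      Pi.smul_apply, ddy_snd, smul_eq_mul]
    rw [Finset.sum_eq_single τ (fun σ _ h => by simp [Ne.symm h]) (by simp)]
    revert J
    refine MultiIdx.cases_two ?_ (fun k => ?_) (fun p q => ?_)
    · simp [(idx1_ne_idx0 _).symm, (idx2_ne_idx0 _ _).symm]
    · simp [idx1_ne_idx0, (idx2_ne_idx1 _ _ _).symm, idx1_inj]
    · simp only [idx2_ne_idx0, idx2_ne_idx1, if_true, if_false, mul_zero, zero_add,
        Finset.sum_const_zero, mul_assoc, weight_eq]
      simp only [mul_add, Finset.sum_add_distrib, mul_ite, mul_one, mul_zero,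
        Finset.sum_ite_eq, Finset.sum_ite_irrel, Finset.sum_const_zero, Finset.mem_univ, if_true]
      rw [idx2_comm q p]
      ring

/-- The vertical part of dL, with unrestricted sums thanks to the normalization of `partial2`. Used
both for the Lepage condition and for the change of charts. -/
theorem fderiv_vertical (L : JetModel n m 2 → ℝ) (w v : JetModel n m 2) (hv : v.1 = 0) :
    fderiv ℝ L w v = ∑ σ : Fin m, (fderiv ℝ L w (ddy idx0 σ) * v.2 idx0 σ
      + ∑ j : Fin n, partial1 L σ j w * v.2 (idx1 j) σ
      + ∑ i : Fin n, ∑ j : Fin n, partial2 L σ i j w * v.2 (idx2 i j) σ) := by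
  conv_lhs => rw [vertical_expansion v hv]
  simp only [map_sum, map_add, map_smul, partial1, partial2, smul_eq_mul]
  refine Finset.sum_congr rfl fun σ _ => ?_
  congr 1
  · congr 1
    · ring
    · exact Finset.sum_congr rfl fun _ _ => by ring
  · exact Finset.sum_congr rfl fun _ _ => Finset.sum_congr rfl fun _ _ => by ring

theorem partial2_comm (L : JetModel n m 2 → ℝ) (σ : Fin m) (i j : Fin n) (w : JetModel n m 2) :
    partial2 L σ i j w = partial2 L σ j i w := by
  simp only [partial2, idx2_comm i j, eq_comm (a := i)]

theorem caratheodoryFactor_apply (L : JetModel n m 2 → ℝ) (j : Fin n) (z v : JetModel n m 3) :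
    caratheodoryFactor L j z v = L (proj (by norm_num) z) * v.1 j
      + ∑ σ : Fin m, momentum L σ j z * contactForm idx0 σ z v
      + ∑ σ : Fin m, ∑ i : Fin n,
          partial2 L σ i j (proj (by norm_num) z) * contactForm (idx1 i) σ z v := by
  simp [caratheodoryFactor]

theorem contactForm_of_formal {r : ℕ} (J : MultiIdx n r) (σ : Fin m) (z v : JetModel n m (r + 1))
    (k : Fin n) (h1 : v.1 = Pi.single k 1) (h2 : v.2 (J.incl (Nat.le_succ r)) σ = z.2 (J.adjoin k) σ) :
    contactForm J σ z v = 0 := by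
  rw [contactForm_apply, h1, h2]
  simp [Pi.single_apply]

end CoordinateLemmas

end JetVar

namespace JetVar

/-! ### Smoothness of the coefficients and of the factors. -/

section Smoothness

variable {n m : ℕ}

theorem contDiff_formalVec {r : ℕ} (i : Fin n) :
    ContDiff ℝ ∞ (formalVec i : JetModel n m (r + 1) → JetModel n m r) := by
  unfold formalVec
  fun_prop

theorem contDiff_contactForm {r : ℕ} (J : MultiIdx n r) (σ : Fin m) :
    ContDiff ℝ ∞ (contactForm J σ : JetModel n m (r + 1) → _) := by
  unfold contactForm
  fun_prop

theorem contDiffOn_fderiv_apply {E F : Type*} [NormedAddCommGroup E] [NormedSpace ℝ E]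
    [NormedAddCommGroup F] [NormedSpace ℝ F] {f : E → F} {U : Set E} (hU : IsOpen U)
    (hf : ContDiffOn ℝ ∞ f U) (v : E) : ContDiffOn ℝ ∞ (fun w => fderiv ℝ f w v) U :=
  (hf.fderiv_of_isOpen hU (by simp)).clm_apply contDiffOn_const

variable {L : JetModel n m 2 → ℝ} {U : Set (JetModel n m 2)}

theorem contDiffOn_partial1 (hU : IsOpen U) (hL : ContDiffOn ℝ ∞ L U) (σ : Fin m) (j : Fin n) :
    ContDiffOn ℝ ∞ (partial1 L σ j) U :=
  contDiffOn_fderiv_apply hU hL _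

theorem contDiffOn_partial2 (hU : IsOpen U) (hL : ContDiffOn ℝ ∞ L U) (σ : Fin m) (i j : Fin n) :
    ContDiffOn ℝ ∞ (partial2 L σ i j) U :=
  contDiffOn_const.mul (contDiffOn_fderiv_apply hU hL _)

theorem contDiffOn_comp_proj {r s : ℕ} (h : s ≤ r) {F : Type*} [NormedAddCommGroup F]
    [NormedSpace ℝ F] {f : JetModel n m s → F} {U : Set (JetModel n m s)}
    (hf : ContDiffOn ℝ ∞ f U) :
    ContDiffOn ℝ ∞ (fun z => f (proj h z)) (proj (r := r) h ⁻¹' U) :=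
  hf.comp (proj h).contDiff.contDiffOn fun _ hz => hz

theorem contDiffOn_formalDeriv {r : ℕ} {f : JetModel n m r → ℝ} {U : Set (JetModel n m r)}
    (hU : IsOpen U) (hf : ContDiffOn ℝ ∞ f U) (i : Fin n) :
    ContDiffOn ℝ ∞ (formalDeriv i f) (proj (Nat.le_succ r) ⁻¹' U) :=
  (contDiffOn_comp_proj (Nat.le_succ r) (hf.fderiv_of_isOpen (m := ∞) hU (by simp))).clm_apply
    (contDiff_formalVec i).contDiffOn

theorem contDiffOn_momentum (hU : IsOpen U) (hL : ContDiffOn ℝ ∞ L U) (σ : Fin m) (j : Fin n) :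
    ContDiffOn ℝ ∞ (momentum L σ j) (proj (by norm_num) ⁻¹' U) :=
  (contDiffOn_comp_proj _ (contDiffOn_partial1 hU hL σ j)).sub
    (ContDiffOn.sum fun i _ => contDiffOn_formalDeriv hU (contDiffOn_partial2 hU hL σ i j) i)

theorem contDiffOn_caratheodoryFactor (hU : IsOpen U) (hL : ContDiffOn ℝ ∞ L U) (j : Fin n) :
    ContDiffOn ℝ ∞ (caratheodoryFactor L j) (proj (by norm_num) ⁻¹' U) := by
  refine ContDiffOn.add (ContDiffOn.add ?_ ?_) ?_
  · exact (contDiffOn_comp_proj _ hL).smul contDiffOn_const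
  · exact ContDiffOn.sum fun σ _ =>
      (contDiffOn_momentum hU hL σ j).smul (contDiff_contactForm _ _).contDiffOn
  · exact ContDiffOn.sum fun σ _ => ContDiffOn.sum fun i _ =>
      (contDiffOn_comp_proj _ (contDiffOn_partial2 hU hL σ i j)).smul
        (contDiff_contactForm _ _).contDiffOn

theorem contDiffOn_one_div_pow {E : Type*} [NormedAddCommGroup E] [NormedSpace ℝ E] {f : E → ℝ}
    {U : Set E} (hf : ContDiffOn ℝ ∞ f U) (h0 : ∀ w ∈ U, f w ≠ 0) (k : ℕ) :
    ContDiffOn ℝ ∞ (fun w => 1 / f w ^ k) U :=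
  contDiffOn_const.div (hf.pow k) fun w hw => pow_ne_zero _ (h0 w hw)

end Smoothness

/-! ### Duality with formal frames: equality of the two expressions, and the horizontal part. -/

section SingleChart

variable {n m : ℕ}

theorem contDiffOn_caratheodoryProduct {L : JetModel (n + 1) m 2 → ℝ}
    {U : Set (JetModel (n + 1) m 2)} (hU : IsOpen U) (hL : ContDiffOn ℝ ∞ L U)
    (h0 : ∀ w ∈ U, L w ≠ 0) :
    ContDiffOn ℝ ∞ (caratheodoryProduct L) (proj (by norm_num) ⁻¹' U) :=
  (contDiffOn_comp_proj _ (contDiffOn_one_div_pow hL h0 n)).smul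
    (contDiffOn_bigWedge _ _ fun j => contDiffOn_caratheodoryFactor hU hL j)

/-- The vectors `d k` lift the formal derivatives at the jet `z`. -/
def IsFormalFrame {r : ℕ} (z : JetModel n m (r + 1)) (d : Fin n → JetModel n m (r + 1)) : Prop :=
  ∀ k, proj (Nat.le_succ r) (d k) = formalVec k z

theorem isFormalFrame_formalVec {r : ℕ} (z : JetModel n m (r + 2)) :
    IsFormalFrame (proj (Nat.le_succ _) z) fun k => formalVec k z :=
  fun _ => rfl

theorem IsFormalFrame.fst {r : ℕ} {z : JetModel n m (r + 1)} {d : Fin n → JetModel n m (r + 1)}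
    (h : IsFormalFrame z d) (k : Fin n) : (d k).1 = Pi.single k 1 :=
  congrArg Prod.fst (h k)

theorem IsFormalFrame.contactForm {r : ℕ} {z : JetModel n m (r + 1)}
    {d : Fin n → JetModel n m (r + 1)} (h : IsFormalFrame z d) (k : Fin n) (J : MultiIdx n r)
    (σ : Fin m) : contactForm J σ z (d k) = 0 :=
  contactForm_of_formal J σ z _ k (h.fst k)
    (congrFun (congrFun (congrArg Prod.snd (h k)) J) σ)

/-- The contact terms die on the frame and only L dx^i survives. This duality drives all evaluations
of the product form. -/
theorem IsFormalFrame.caratheodoryFactor {z : JetModel n m 3} {d : Fin n → JetModel n m 3}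
    (h : IsFormalFrame z d) (L : JetModel n m 2 → ℝ) (i k : Fin n) :
    caratheodoryFactor L i z (d k) = if i = k then L (proj (by norm_num) z) else 0 := by
  simp [caratheodoryFactor_apply, h.contactForm, h.fst, Pi.single_apply]

theorem IsFormalFrame.vol_update {r : ℕ} {z : JetModel (n + 1) m (r + 1)}
    {d : Fin (n + 1) → JetModel (n + 1) m (r + 1)} (h : IsFormalFrame z d) (j : Fin (n + 1))
    (v : JetModel (n + 1) m (r + 1)) : vol (Function.update d j v) = v.1 j := by
  rw [vol, bigWedge_update 1 _ d (fun i k => by simp [h.fst, Pi.single_apply])]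
  simp

/-- Since α kills the frame, only the term in which α takes the slot of v survives; the sign of that
term and the sign of moving ∂/∂x^l into slot j cancel. -/
theorem IsFormalFrame.wedge_volContract {r : ℕ} {z : JetModel (n + 1) m (r + 1)}
    {d : Fin (n + 1) → JetModel (n + 1) m (r + 1)} (h : IsFormalFrame z d) (j l : Fin (n + 1))
    (v : JetModel (n + 1) m (r + 1)) (α : JetModel (n + 1) m (r + 1) →L[ℝ] ℝ)
    (hα : ∀ k, α (d k) = 0) :
    wedge α (volContract l) (Function.update d j v) = if j = l then α v else 0 := by
  rw [wedge_apply, Finset.sum_eq_single j (fun i _ hi => by simp [hi, hα]) (by simp)]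
  rw [Fin.removeNth_update, Function.update_self]
  have h1 : (volContract l : JetModel (n + 1) m (r + 1) [⋀^Fin n]→L[ℝ] ℝ) (j.removeNth d) =
      (-1 : ℝ) ^ (j : ℕ) * (if j = l then 1 else 0) := by
    change vol (Matrix.vecCons (ddx l) (j.removeNth d)) = _
    rw [map_cons_removeNth, h.vol_update]
    simp [ddx, Pi.single_apply]
  rw [h1, mul_left_comm, ← mul_assoc, ← mul_assoc, mul_assoc (α v), ← mul_pow]
  simp

theorem IsFormalFrame.principalLepage {z : JetModel (n + 1) m 3}
    {d : Fin (n + 1) → JetModel (n + 1) m 3} (h : IsFormalFrame z d)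
    (L : JetModel (n + 1) m 2 → ℝ) (j : Fin (n + 1)) (v : JetModel (n + 1) m 3) :
    principalLepage L z (Function.update d j v) = JetVar.caratheodoryFactor L j z v := by
  have hw := fun (l : Fin (n + 1)) (J : MultiIdx (n + 1) 2) (σ : Fin m) =>
    h.wedge_volContract j l v (JetVar.contactForm J σ z) (fun k => h.contactForm k J σ)
  simp [JetVar.principalLepage, caratheodoryFactor_apply, h.vol_update, hw]

/-- Formal derivatives at a 4-jet form a formal frame at the 3-jet below, and the contraction of Θ
with a formal frame does not depend on the lifts chosen. -/
theorem caratheodoryContraction_eq (L : JetModel (n + 1) m 2 → ℝ) (z : JetModel (n + 1) m 4) :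
    caratheodoryContraction L z = caratheodoryProduct L (proj (by norm_num) z) := by
  unfold caratheodoryContraction caratheodoryProduct
  congr 2
  funext j
  refine ContinuousLinearMap.ext fun v => ?_
  change (-1 : ℝ) ^ (n - (j : ℕ)) * contractToOne n _ _ v = _
  rw [contractToOne_apply, map_snoc_removeNth _ (fun i => formalVec i z) j v]
  exact (isFormalFrame_formalVec z).principalLepage L j v

theorem caratheodoryFactor_comp_horVec (L : JetModel n m 2 → ℝ) (j : Fin n) (z : JetModel n m 4) :
    (caratheodoryFactor L j (proj (by norm_num) z)).comp (horVec z) =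
      L (proj (by norm_num) z) • dx j := by
  refine ContinuousLinearMap.ext fun v => ?_
  change caratheodoryFactor L j (proj (Nat.le_succ 3) z) (horVec z v) = L (proj _ z) * v.1 j
  rw [horVec_apply]
  simp [(isFormalFrame_formalVec z).caratheodoryFactor, proj_proj, mul_comm]

/-- Each factor contributes L dx^j, so L^{n+1} is divided by L^n. -/
theorem hor_caratheodoryProduct {L : JetModel (n + 1) m 2 → ℝ} (z : JetModel (n + 1) m 4)
    (h0 : L (proj (by norm_num) z) ≠ 0) :
    hor (caratheodoryProduct L) z = L (proj (by norm_num) z) • vol := by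
  have h : hor (caratheodoryProduct L) z = (1 / L (proj (by norm_num) z) ^ n) •
      (bigWedge (n + 1) fun j => caratheodoryFactor L j
        (proj (Nat.le_succ 3) z)).compContinuousLinearMap (horVec z) := rfl
  rw [h, bigWedge_comp]
  simp only [caratheodoryFactor_comp_horVec]
  rw [bigWedge_smul, smul_smul, pow_succ, ← mul_assoc, one_div, inv_mul_cancel₀ (pow_ne_zero _ h0),
    one_mul]
  rfl

theorem vol_comp_proj {r s : ℕ} (h : s ≤ r) :
    (vol : JetModel n m s [⋀^Fin n]→L[ℝ] ℝ).compContinuousLinearMap (proj h) = vol := by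
  rw [vol, bigWedge_comp]
  rfl

/-- Such a form only sees the base components of its arguments, and top-degree alternating forms on
the base are multiples of the determinant. -/
theorem eq_smul_vol_of_horizontal {r : ℕ} (β : JetModel n m r [⋀^Fin n]→L[ℝ] ℝ)
    (hβ : ∀ v : Fin n → JetModel n m r, (∃ i, (v i).1 = 0) → β v = 0) :
    β = β (fun i => ddx i) • vol := by
  have h1 : ∀ v : Fin n → JetModel n m r, β v = β (fun i => ((v i).1, 0)) := by
    intro v
    have hv : v = (fun i => ((v i).1, 0)) + fun i => ((0, (v i).2) : JetModel n m r) := by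
      funext i; simp
    conv_lhs => rw [hv]
    have := β.toMultilinearMap.map_add_univ (fun i => ((v i).1, 0))
      (fun i => ((0, (v i).2) : JetModel n m r))
    refine this.trans ?_
    -- In the multilinear expansion over subsets, every proper subset puts a vertical vector into
    -- some slot.
    rw [Finset.sum_eq_single Finset.univ]
    · simp
    · intro s _ hs
      obtain ⟨i, hi⟩ : ∃ i, i ∉ s := by
        by_contra! hcon
        exact hs (Finset.eq_univ_of_forall hcon)
      exact hβ _ ⟨i, by simp [hi]⟩
    · simp
  ext v
  rw [h1 v]
  have h2 := (β.toAlternatingMap.compLinearMap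
    (LinearMap.inl ℝ (Fin n → ℝ) (MultiIdx n r → Fin m → ℝ))).eq_smul_basis_det (Pi.basisFun ℝ (Fin n))
  have h3 := congrArg (fun f => f fun i => (v i).1) h2
  rw [Pi.basisFun_det] at h3
  refine h3.trans ?_
  simp only [AlternatingMap.smul_apply, ContinuousAlternatingMap.smul_apply]
  congr 1
  · simp [ddx]
  · rw [vol, bigWedge_apply, ← Matrix.det_transpose]
    rfl

end SingleChart

end JetVar

namespace JetVar

/-! ### The Lepage condition through commuting extensions of the frame. -/

section Lepage

variable {n m : ℕ}

/-- The linear map `v ↦ (v_{Jk})_J`, with zero in top order. -/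
def shift {r : ℕ} (k : Fin n) : JetModel n m (r + 1) →L[ℝ] JetModel n m (r + 1) :=
  (0 : JetModel n m (r + 1) →L[ℝ] (Fin n → ℝ)).prod
    ((ContinuousLinearMap.pi fun J : MultiIdx n (r + 1) =>
      if h : J.1.card ≤ r then
        ContinuousLinearMap.proj (R := ℝ) (φ := fun _ : MultiIdx n (r + 1) => Fin m → ℝ)
          (MultiIdx.adjoin ⟨J.1, h⟩ k)
      else 0).comp (ContinuousLinearMap.snd ℝ _ _))

@[simp] theorem shift_fst {r : ℕ} (k : Fin n) (v : JetModel n m (r + 1)) : (shift k v).1 = 0 := rfl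

theorem shift_snd_incl {r : ℕ} (k : Fin n) (v : JetModel n m (r + 1)) (J : MultiIdx n r) :
    (shift k v).2 (J.incl (Nat.le_succ r)) = v.2 (J.adjoin k) := by
  have h : (J.incl (Nat.le_succ r)).1.card ≤ r := J.2
  simp only [shift, ContinuousLinearMap.prod_apply, ContinuousLinearMap.comp_apply,
    ContinuousLinearMap.pi_apply]
  rw [dif_pos h]
  rfl

theorem shift_snd_of_not {r : ℕ} (k : Fin n) (v : JetModel n m (r + 1)) (J : MultiIdx n (r + 1))
    (h : ¬ J.1.card ≤ r) : (shift k v).2 J = 0 := by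
  simp only [shift, ContinuousLinearMap.prod_apply, ContinuousLinearMap.comp_apply,
    ContinuousLinearMap.pi_apply]
  rw [dif_neg h]
  rfl

theorem MultiIdx.adjoin_comm {r : ℕ} (J : MultiIdx n r) (i j : Fin n) :
    (J.adjoin i).adjoin j = (J.adjoin j).adjoin i :=
  Subtype.ext (Multiset.cons_swap _ _ _)

/-- The symmetry y_{Jij} = y_{Jji}; it makes the extended formal derivatives commute. -/
theorem shift_formalVec_comm {r : ℕ} (i j : Fin n) (z : JetModel n m (r + 2)) :
    shift j (formalVec i z) = shift i (formalVec j z) := by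
  refine Prod.ext rfl (funext fun J => ?_)
  by_cases h : J.1.card ≤ r
  · change (shift j (formalVec i z)).2 (MultiIdx.incl (Nat.le_succ r) ⟨J.1, h⟩) =
      (shift i (formalVec j z)).2 (MultiIdx.incl (Nat.le_succ r) ⟨J.1, h⟩)
    rw [shift_snd_incl, shift_snd_incl, formalVec_snd, formalVec_snd, MultiIdx.adjoin_comm]
  · rw [shift_snd_of_not _ _ _ h, shift_snd_of_not _ _ _ h]

/-- An extension of the formal derivative `d_k` at the jet `z` to a vector field. -/
def frameField {r : ℕ} (z : JetModel n m (r + 2)) (k : Fin n) (w : JetModel n m (r + 1)) :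
    JetModel n m (r + 1) :=
  formalVec k z + shift k (w - proj (Nat.le_succ _) z)

/-- An extension of the vector `ξ` to a vector field that commutes with the fields `frameField`. -/
def variationField {r : ℕ} (z : JetModel n m (r + 2)) (ξ w : JetModel n m (r + 1)) :
    JetModel n m (r + 1) :=
  ξ + ∑ i : Fin n, (w.1 i - z.1 i) • shift i ξ

/-- The correction by `shift` makes the fields lift the formal derivatives at every w, not only
below z. The forms can therefore be evaluated by duality near the point before they are
differentiated. -/
theorem isFormalFrame_frameField {r : ℕ} (z : JetModel n m (r + 2)) (w : JetModel n m (r + 1)) :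
    IsFormalFrame w fun k => frameField z k w := by
  intro k
  refine Prod.ext (by simp [frameField]) (funext fun J => ?_)
  rw [proj_snd]
  change (formalVec k z + shift k (w - proj (Nat.le_succ _) z)).2 _ = _
  rw [Prod.snd_add, Pi.add_apply, shift_snd_incl, formalVec_snd,
    formalVec_snd, Prod.snd_sub, Pi.sub_apply]
  exact add_sub_cancel _ _

theorem hasFDerivAt_frameField {r : ℕ} (z : JetModel n m (r + 2)) (k : Fin n)
    (w : JetModel n m (r + 1)) : HasFDerivAt (frameField z k) (shift k) w :=
  ((shift k).hasFDerivAt.comp w ((hasFDerivAt_id w).sub_const _)).const_add _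

theorem hasFDerivAt_variationField {r : ℕ} (z : JetModel n m (r + 2)) (ξ w : JetModel n m (r + 1)) :
    HasFDerivAt (variationField z ξ) (∑ i : Fin n, (dx i).smulRight (shift i ξ)) w := by
  refine HasFDerivAt.const_add _ (HasFDerivAt.fun_sum fun i _ => ?_)
  exact ((dx (n := n) (m := m) i).hasFDerivAt.sub_const _).smul_const _

theorem frameField_proj {r : ℕ} (z : JetModel n m (r + 2)) (k : Fin n) :
    frameField z k (proj (Nat.le_succ _) z) = formalVec k z := by
  simp [frameField]

theorem variationField_proj {r : ℕ} (z : JetModel n m (r + 2)) (ξ : JetModel n m (r + 1)) :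
    variationField z ξ (proj (Nat.le_succ _) z) = ξ := by
  simp [variationField]

/-- The invariant formula for the exterior derivative: its bracket terms vanish because the extended
fields commute at the point of evaluation, which is all that is required. -/
theorem extDeriv_apply_frame {r : ℕ}
    {β : JetModel n m (r + 1) → JetModel n m (r + 1) [⋀^Fin n]→L[ℝ] ℝ} (z : JetModel n m (r + 2))
    (ξ : JetModel n m (r + 1)) (hβ : DifferentiableAt ℝ β (proj (Nat.le_succ _) z)) :
    extDeriv β (proj (Nat.le_succ _) z) (Matrix.vecCons ξ fun k => formalVec k z) =
      fderiv ℝ (fun w => β w fun k => frameField z k w) (proj (Nat.le_succ _) z) ξ +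
      ∑ i : Fin n, (-1 : ℝ) ^ ((i : ℕ) + 1) * fderiv ℝ (fun w => β w (i.succ.removeNth
        (Matrix.vecCons (variationField z ξ w) fun k => frameField z k w)))
          (proj (Nat.le_succ _) z) (formalVec i z) := by
  set w₀ : JetModel n m (r + 1) := proj (Nat.le_succ _) z with hw₀
  let V : Fin (n + 1) → JetModel n m (r + 1) → JetModel n m (r + 1) :=
    Fin.cons (variationField z ξ) (frameField z)
  have hV : ∀ w, (fun i => V i w) = Matrix.vecCons (variationField z ξ w) fun k => frameField z k w := by
    intro w
    funext i
    refine Fin.cases rfl (fun k => rfl) i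
  have h0 : ∀ k : Fin n, V k.succ = frameField z k := fun k => rfl
  have hd : ∀ i, DifferentiableAt ℝ (V i) w₀ := by
    intro i
    refine Fin.cases ?_ (fun k => ?_) i
    · exact (hasFDerivAt_variationField z ξ w₀).differentiableAt
    · exact (hasFDerivAt_frameField z k w₀).differentiableAt
  -- The derivative of the k-th frame field along ξ and that of the variation field along d_k are
  -- both `shift k ξ`.
  have hb : ∀ k : Fin n, VectorField.lieBracket ℝ (V 0) (V k.succ) w₀ = 0 := by
    intro k
    change fderiv ℝ (frameField z k) w₀ (variationField z ξ w₀) -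
      fderiv ℝ (variationField z ξ) w₀ (frameField z k w₀) = 0
    rw [(hasFDerivAt_variationField z ξ w₀).fderiv, (hasFDerivAt_frameField z k w₀).fderiv,
      hw₀, variationField_proj, frameField_proj, sub_eq_zero]
    simp [Pi.single_apply]
  have hcomm : Pairwise fun i j => VectorField.lieBracket ℝ (V i) (V j) w₀ = 0 := by
    intro i j _
    revert i j
    refine Fin.cases (fun j hij => ?_) (fun i j hij => ?_)
    · obtain ⟨k, rfl⟩ := Fin.exists_succ_eq_of_ne_zero hij.symm
      exact hb k
    · revert j
      refine Fin.cases (fun _ => ?_) (fun j _ => ?_)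
      · exact sub_eq_zero.2 (sub_eq_zero.1 (hb i)).symm
      · change fderiv ℝ (frameField z j) w₀ (frameField z i w₀) -
          fderiv ℝ (frameField z i) w₀ (frameField z j w₀) = 0
        rw [(hasFDerivAt_frameField z i w₀).fderiv, (hasFDerivAt_frameField z j w₀).fderiv,
          hw₀, frameField_proj, frameField_proj, sub_eq_zero, shift_formalVec_comm]
  have key := extDeriv_apply_vectorField_of_pairwise_commute hβ hd hcomm
  rw [Fin.sum_univ_succ] at key
  simp only [hV] at key
  rw [hw₀, variationField_proj] at key
  simp only [frameField_proj] at key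
  rw [key]
  congr 1
  · have : V 0 (proj (Nat.le_succ _) z) = ξ := variationField_proj z ξ
    rw [this]
    simp
    rfl
  · refine Finset.sum_congr rfl fun i _ => ?_
    rw [h0, frameField_proj]
    simp [zsmul_eq_mul]
    rfl

theorem differentiableAt_of_contDiffOn {E F : Type*} [NormedAddCommGroup E] [NormedSpace ℝ E]
    [NormedAddCommGroup F] [NormedSpace ℝ F] {f : E → F} {U : Set E} (hU : IsOpen U)
    (hf : ContDiffOn ℝ ∞ f U) {x : E} (hx : x ∈ U) : DifferentiableAt ℝ f x :=
  (hf.contDiffAt (hU.mem_nhds hx)).differentiableAt (by simp)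

theorem variationField_fst {r : ℕ} (z : JetModel n m (r + 2)) (ξ w : JetModel n m (r + 1))
    (hξ : ξ.1 = 0) : (variationField z ξ w).1 = 0 := by
  simp [variationField, hξ, Prod.fst_sum]

theorem variationField_snd {r : ℕ} (z : JetModel n m (r + 2)) (ξ w : JetModel n m (r + 1))
    (J : MultiIdx n r) (σ : Fin m) :
    (variationField z ξ w).2 (J.incl (Nat.le_succ r)) σ = ξ.2 (J.incl (Nat.le_succ r)) σ +
      ∑ i : Fin n, (w.1 i - z.1 i) * ξ.2 (J.adjoin i) σ := by
  simp [variationField, Prod.snd_sum, shift_snd_incl]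

theorem caratheodoryProduct_frame {L : JetModel (n + 1) m 2 → ℝ} {w : JetModel (n + 1) m 3}
    (h0 : L (proj (by norm_num) w) ≠ 0) {d : Fin (n + 1) → JetModel (n + 1) m 3}
    (hd : IsFormalFrame w d) :
    caratheodoryProduct L w d = L (proj (by norm_num) w) := by
  change (1 / L (proj _ w) ^ n) * bigWedge (n + 1) (fun j => caratheodoryFactor L j w) d = _
  rw [bigWedge_dual _ _ _ (fun i k => hd.caratheodoryFactor L i k), pow_succ, ← mul_assoc, one_div,
    inv_mul_cancel₀ (pow_ne_zero _ h0), one_mul]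

/-- With n of the n + 1 arguments dual to the factors, the determinant is L^n times one factor, and
L^n cancels. -/
theorem caratheodoryProduct_removeNth {L : JetModel (n + 1) m 2 → ℝ} {w : JetModel (n + 1) m 3}
    (h0 : L (proj (by norm_num) w) ≠ 0) {d : Fin (n + 1) → JetModel (n + 1) m 3}
    (hd : IsFormalFrame w d) (i : Fin (n + 1)) (v : JetModel (n + 1) m 3) :
    caratheodoryProduct L w (i.succ.removeNth (Matrix.vecCons v d)) =
      (-1 : ℝ) ^ (i : ℕ) * caratheodoryFactor L i w v := by
  have h : i.succ.removeNth (Matrix.vecCons v d) = Matrix.vecCons v (i.removeNth d) := by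
    funext k
    refine Fin.cases ?_ (fun k => ?_) k
    · simp [Fin.removeNth]
    · simp [Fin.removeNth]
  rw [h, map_cons_removeNth]
  change _ * ((1 / L (proj _ w) ^ n) * bigWedge (n + 1) (fun j => caratheodoryFactor L j w) _) = _
  rw [bigWedge_update _ _ _ (fun i k => hd.caratheodoryFactor L i k), ← mul_assoc (1 / _), one_div,
    inv_mul_cancel₀ (pow_ne_zero _ h0), one_mul]

theorem hasFDerivAt_comp_proj {r s : ℕ} (h : s ≤ r) {f : JetModel n m s → ℝ} {w : JetModel n m r}
    (hf : DifferentiableAt ℝ f (proj h w)) :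
    HasFDerivAt (fun w => f (proj h w)) ((fderiv ℝ f (proj h w)).comp (proj h)) w :=
  hf.hasFDerivAt.comp w (proj h).hasFDerivAt

theorem hasFDerivAt_affine {r : ℕ} (c : Fin n → ℝ) (a : ℝ) (b : Fin n → ℝ) (w : JetModel n m r)
    : HasFDerivAt (fun w : JetModel n m r => a + ∑ i : Fin n, (w.1 i - c i) * b i)
      (∑ i : Fin n, b i • (dx i : JetModel n m r →L[ℝ] ℝ)) w := by
  refine HasFDerivAt.const_add _ (HasFDerivAt.fun_sum fun i _ => ?_)
  exact ((dx (n := n) (m := m) i).hasFDerivAt.sub_const _).mul_const _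

/-- On the variation field the contact forms are affine functions of x. At the base point their
values are the components of ξ, and their derivatives along d_i are the components with i adjoined;
the y^σ-components vanish by assumption. -/
theorem fderiv_caratheodoryFactor_variation {L : JetModel n m 2 → ℝ} {U : Set (JetModel n m 2)}
    (hU : IsOpen U) (hL : ContDiffOn ℝ ∞ L U) (z : JetModel n m 4)
    (hz : proj (by norm_num) z ∈ U) (ξ : JetModel n m 3)
    (hξ : proj (Nat.zero_le 3) ξ = 0) (i : Fin n) :
    fderiv ℝ (fun w => caratheodoryFactor L i w (variationField z ξ w)) (proj (Nat.le_succ 3) z)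
      (formalVec i z) = ∑ σ : Fin m, (momentum L σ i (proj (Nat.le_succ 3) z) * ξ.2 (idx1 i) σ
        + ∑ k : Fin n, (formalDeriv i (partial2 L σ k i) (proj (Nat.le_succ 3) z) * ξ.2 (idx1 k) σ
          + partial2 L σ k i (proj (by norm_num) z) * ξ.2 (idx2 i k) σ)) := by
  have hξ1 : ξ.1 = 0 := congrArg Prod.fst hξ
  have hξ0 : ∀ σ, ξ.2 idx0 σ = 0 := fun σ =>
    congrFun (congrFun (congrArg Prod.snd hξ) idx0) σ
  have e : (fun w => caratheodoryFactor L i w (variationField z ξ w)) = fun w =>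
      ∑ σ : Fin m, (momentum L σ i w * (ξ.2 idx0 σ + ∑ l : Fin n, (w.1 l - z.1 l) * ξ.2 (idx1 l) σ)
        + ∑ k : Fin n, partial2 L σ k i (proj (by norm_num) w) *
          (ξ.2 (idx1 k) σ + ∑ l : Fin n, (w.1 l - z.1 l) * ξ.2 (idx2 l k) σ)) := by
    funext w
    rw [caratheodoryFactor_apply]
    simp only [contactForm_apply, variationField_fst _ _ _ hξ1, variationField_snd]
    simp [Finset.sum_add_distrib]
    rfl
  rw [e]
  set w₀ : JetModel n m 3 := proj (Nat.le_succ 3) z with hw₀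
  have hw : proj (by norm_num) w₀ ∈ U := hz
  have hm : ∀ σ, HasFDerivAt (momentum L σ i) (fderiv ℝ (momentum L σ i) w₀) w₀ := fun σ =>
    (differentiableAt_of_contDiffOn (hU.preimage (proj _).continuous)
      (contDiffOn_momentum hU hL σ i) hw).hasFDerivAt
  have hp : ∀ σ k, HasFDerivAt (fun w : JetModel n m 3 => partial2 L σ k i (proj (by norm_num) w))
      _ w₀ := fun σ k => hasFDerivAt_comp_proj (by norm_num)
        (differentiableAt_of_contDiffOn hU (contDiffOn_partial2 hU hL σ k i) hw)
  have hsum := HasFDerivAt.fun_sum (u := Finset.univ) fun σ _ =>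
    ((hm σ).mul (hasFDerivAt_affine z.1 (ξ.2 idx0 σ) (fun l => ξ.2 (idx1 l) σ) w₀)).add
      (HasFDerivAt.fun_sum (u := Finset.univ) fun k _ => (hp σ k).mul
        (hasFDerivAt_affine z.1 (ξ.2 (idx1 k) σ) (fun l => ξ.2 (idx2 l k) σ) w₀))
  refine (congrArg (fun A => A (formalVec i z)) hsum.fderiv).trans ?_
  have hz1 : w₀.1 = z.1 := rfl
  have hf : ∀ σ k, fderiv ℝ (partial2 L σ k i) (proj (by norm_num) w₀)
      (proj (by norm_num) (formalVec i z)) = formalDeriv i (partial2 L σ k i) w₀ :=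
    fun σ k => rfl
  simp [hξ0, hz1, Pi.single_apply, hf]
  refine Finset.sum_congr rfl fun σ _ => congrArg _ (Finset.sum_congr rfl fun k _ => ?_)
  rw [add_comm, mul_comm (ξ.2 _ _)]
  rfl

/-- What is left is ξ(L) - ∑ d_i(θ^i(V)). The second-order components of ξ cancel directly; the
first-order ones cancel by the definition of `momentum` and the symmetry of `partial2`. -/
theorem extDeriv_caratheodoryProduct {L : JetModel (n + 1) m 2 → ℝ}
    {U : Set (JetModel (n + 1) m 2)} (hU : IsOpen U) (hL : ContDiffOn ℝ ∞ L U)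
    (h0 : ∀ w ∈ U, L w ≠ 0) (z : JetModel (n + 1) m 4) (hz : proj (by norm_num) z ∈ U)
    (ξ : JetModel (n + 1) m 3) (hξ : proj (Nat.zero_le 3) ξ = 0) :
    extDeriv (caratheodoryProduct L) (proj (Nat.le_succ 3) z)
      (Matrix.vecCons ξ fun k => formalVec k z) = 0 := by
  have hU' : IsOpen (proj (n := n + 1) (m := m) (r := 3) (s := 2) (by norm_num) ⁻¹' U) :=
    hU.preimage (proj _).continuous
  have hz' : proj (Nat.le_succ 3) z ∈
      proj (n := n + 1) (m := m) (r := 3) (s := 2) (by norm_num) ⁻¹' U := hz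
  rw [extDeriv_apply_frame z ξ (differentiableAt_of_contDiffOn hU'
    (contDiffOn_caratheodoryProduct hU hL h0) hz')]
  have e1 : (fun w => caratheodoryProduct L w fun k => frameField z k w)
      =ᶠ[𝓝 (proj (Nat.le_succ 3) z)] fun w => L (proj (by norm_num) w) :=
    Filter.eventuallyEq_of_mem (hU'.mem_nhds hz') fun w hw =>
      caratheodoryProduct_frame (h0 _ hw) (isFormalFrame_frameField z w)
  have e2 : ∀ i : Fin (n + 1), (fun w => caratheodoryProduct L w (i.succ.removeNth
        (Matrix.vecCons (variationField z ξ w) fun k => frameField z k w)))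
      =ᶠ[𝓝 (proj (Nat.le_succ 3) z)] fun w => (-1 : ℝ) ^ (i : ℕ) *
        caratheodoryFactor L i w (variationField z ξ w) := fun i =>
    Filter.eventuallyEq_of_mem (hU'.mem_nhds hz') fun w hw =>
      caratheodoryProduct_removeNth (h0 _ hw) (isFormalFrame_frameField z w) i _
  have e3 : ∀ i : Fin (n + 1), (-1 : ℝ) ^ ((i : ℕ) + 1) * fderiv ℝ (fun w =>
      caratheodoryProduct L w (i.succ.removeNth
        (Matrix.vecCons (variationField z ξ w) fun k => frameField z k w)))
        (proj (Nat.le_succ 3) z) (formalVec i z) =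
      - fderiv ℝ (fun w => caratheodoryFactor L i w (variationField z ξ w))
        (proj (Nat.le_succ 3) z) (formalVec i z) := by
    intro i
    have e4 := congrFun (fderiv_const_smul_field (𝕜 := ℝ) ((-1 : ℝ) ^ (i : ℕ))
      (f := fun w => caratheodoryFactor L i w (variationField z ξ w))) (proj (Nat.le_succ 3) z)
    rw [(e2 i).fderiv_eq]
    refine (congrArg (fun A => _ * A (formalVec i z)) e4).trans ?_
    rw [Pi.smul_apply, _root_.smul_apply, smul_eq_mul, ← mul_assoc, ← pow_add, Odd.neg_one_pow ⟨i, by ring⟩]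
    simp
  have hξ1 : (proj (by norm_num) ξ : JetModel (n + 1) m 2).1 = 0 :=
    congrArg Prod.fst hξ
  have hξ0 : ∀ σ, (proj (by norm_num) ξ : JetModel (n + 1) m 2).2 idx0 σ = 0 := fun σ =>
    congrFun (congrFun (congrArg Prod.snd hξ) idx0) σ
  have hL' : DifferentiableAt ℝ L (proj (by norm_num) (proj (Nat.le_succ 3) z)) :=
    differentiableAt_of_contDiffOn hU hL hz
  simp only [e3]
  rw [e1.fderiv_eq, (hasFDerivAt_comp_proj (by norm_num) hL').fderiv, ContinuousLinearMap.comp_apply,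
    fderiv_vertical _ _ _ hξ1, Finset.sum_neg_distrib, ← sub_eq_add_neg, sub_eq_zero]
  simp only [fderiv_caratheodoryFactor_variation hU hL z hz ξ hξ, hξ0]
  rw [Finset.sum_comm]
  refine Finset.sum_congr rfl fun σ _ => ?_
  simp only [momentum, mul_zero, zero_add, Finset.sum_add_distrib, sub_mul, Finset.sum_sub_distrib]
  have hsw : ∑ i, (∑ k, formalDeriv k (partial2 L σ k i) (proj (Nat.le_succ 3) z)) * ξ.2 (idx1 i) σ
      = ∑ i, ∑ k, formalDeriv i (partial2 L σ k i) (proj (Nat.le_succ 3) z) * ξ.2 (idx1 k) σ := by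
    simp only [Finset.sum_mul]
    rw [Finset.sum_comm]
    refine Finset.sum_congr rfl fun i _ => Finset.sum_congr rfl fun k _ => ?_
    rw [funext (partial2_comm L σ i k)]
  rw [hsw, ← add_assoc, sub_add_cancel]
  congr 1
  refine Finset.sum_congr rfl fun i _ => Finset.sum_congr rfl fun k _ => ?_
  rw [partial2_comm L σ k i]
  rfl

/-- A horizontalized form of top degree is a multiple of ω₀, with its value on the formal
derivatives as coefficient. -/
theorem hor_eq_zero {r : ℕ} {β : JetModel n m r → JetModel n m r [⋀^Fin n]→L[ℝ] ℝ}
    (z : JetModel n m (r + 1)) (h : β (proj (Nat.le_succ r) z) (fun k => formalVec k z) = 0) :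
    hor β z = 0 := by
  rw [eq_smul_vol_of_horizontal (hor β z)]
  · have : hor β z (fun i => ddx i) = β (proj (Nat.le_succ r) z) (fun k => formalVec k z) := by
      change β _ (fun i => horVec z (ddx i)) = _
      congr 1
      funext i
      rw [horVec_apply]
      simp [ddx, Pi.single_apply]
    rw [this, h, zero_smul]
  · rintro v ⟨i, hi⟩
    refine (β (proj (Nat.le_succ r) z)).map_coord_zero i ?_
    change horVec z (v i) = 0
    simp [horVec_apply, hi]

end Lepage

end JetVar

namespace JetVar

/-! ### Jets of functions: symmetry of partial derivatives, prolongation, and Taylor polynomials. -/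

section FunctionJets

variable {n m : ℕ}

/-- The iterated partial derivative along a list of indices. -/
def listPartial (l : List (Fin n)) (f : (Fin n → ℝ) → (Fin m → ℝ)) : (Fin n → ℝ) → (Fin m → ℝ) :=
  l.foldr (fun j g u => fderiv ℝ g u (Pi.single j 1)) f

theorem listPartial_cons (i : Fin n) (l : List (Fin n)) (f : (Fin n → ℝ) → (Fin m → ℝ))
    (u : Fin n → ℝ) : listPartial (i :: l) f u = fderiv ℝ (listPartial l f) u (Pi.single i 1) := rfl

theorem contDiffOn_listPartial {U : Set (Fin n → ℝ)} (hU : IsOpen U)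
    {f : (Fin n → ℝ) → (Fin m → ℝ)} (hf : ContDiffOn ℝ ∞ f U) (l : List (Fin n)) :
    ContDiffOn ℝ ∞ (listPartial l f) U := by
  induction l with
  | nil => exact hf
  | cons i l ih => exact contDiffOn_fderiv_apply hU ih _

/-- A transposition of neighbouring indices is the symmetry of the second derivative. -/
theorem listPartial_perm {U : Set (Fin n → ℝ)} (hU : IsOpen U)
    {f : (Fin n → ℝ) → (Fin m → ℝ)} (hf : ContDiffOn ℝ ∞ f U) {l l' : List (Fin n)}
    (h : l.Perm l') : Set.EqOn (listPartial l f) (listPartial l' f) U := by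
  induction h with
  | nil => exact fun _ _ => rfl
  | cons i _ ih =>
    intro u hu
    rw [listPartial_cons, listPartial_cons,
      (Filter.eventuallyEq_of_mem (hU.mem_nhds hu) ih).fderiv_eq]
  | swap i j l =>
    intro u hu
    have hg := contDiffOn_listPartial hU hf l
    have hd : DifferentiableAt ℝ (fderiv ℝ (listPartial l f)) u :=
      differentiableAt_of_contDiffOn hU (hg.fderiv_of_isOpen hU (by simp)) hu
    have hs := (hg.contDiffAt (hU.mem_nhds hu)).isSymmSndFDerivAt (by
      simpa using (WithTop.coe_le_coe.2 le_top : ((2 : ℕ∞) : WithTop ℕ∞) ≤ ((⊤ : ℕ∞) : WithTop ℕ∞)))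
    have h1 : ∀ i j, listPartial (i :: j :: l) f u =
        fderiv ℝ (fderiv ℝ (listPartial l f)) u (Pi.single i 1) (Pi.single j 1) := by
      intro i j
      change fderiv ℝ (fun u => fderiv ℝ (listPartial l f) u (Pi.single j 1)) u (Pi.single i 1) = _
      rw [fderiv_clm_apply hd (differentiableAt_const _)]
      simp
    rw [h1, h1, hs]
  | trans _ _ ih ih' => exact fun u hu => (ih hu).trans (ih' hu)

theorem listPartial_congr {f g : (Fin n → ℝ) → (Fin m → ℝ)} {u : Fin n → ℝ} (h : f =ᶠ[𝓝 u] g)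
    (l : List (Fin n)) : listPartial l f =ᶠ[𝓝 u] listPartial l g := by
  induction l with
  | nil => exact h
  | cons i l ih => exact ih.fderiv.mono fun v hv => by rw [listPartial_cons, hv]; rfl

/-- `iterPartial` differentiates in sorted order; putting i in front destroys the order but is a
permutation of it. -/
theorem iterPartial_cons {U : Set (Fin n → ℝ)} (hU : IsOpen U)
    {f : (Fin n → ℝ) → (Fin m → ℝ)} (hf : ContDiffOn ℝ ∞ f U) (i : Fin n) (J : Multiset (Fin n))
    {u : Fin n → ℝ} (hu : u ∈ U) :
    iterPartial (i ::ₘ J) f u = fderiv ℝ (iterPartial J f) u (Pi.single i 1) := by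
  refine listPartial_perm hU hf (l' := i :: J.sort (· ≤ ·)) ?_ hu
  rw [← Multiset.coe_eq_coe, ← Multiset.cons_coe]
  simp

@[simp] theorem iterPartial_zero (f : (Fin n → ℝ) → (Fin m → ℝ)) : iterPartial 0 f = f := by
  simp [iterPartial]

/-- The coordinates of the `r`-jet at `u` of the section `u ↦ (u, g u)`. -/
def jetFun (r : ℕ) (g : (Fin n → ℝ) → (Fin m → ℝ)) (u : Fin n → ℝ) : JetModel n m r :=
  (u, fun J => iterPartial J.1 g u)

theorem contDiffOn_jetFun {U : Set (Fin n → ℝ)} (hU : IsOpen U)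
    {g : (Fin n → ℝ) → (Fin m → ℝ)} (hg : ContDiffOn ℝ ∞ g U) (r : ℕ) :
    ContDiffOn ℝ ∞ (jetFun r g) U :=
  contDiffOn_id.prodMk (contDiffOn_pi.2 fun _ => contDiffOn_listPartial hU hg _)

theorem jetFun_congr {f g : (Fin n → ℝ) → (Fin m → ℝ)} {u : Fin n → ℝ} (h : f =ᶠ[𝓝 u] g) (r : ℕ) :
    jetFun r f u = jetFun r g u :=
  Prod.ext rfl (funext fun _ => (listPartial_congr h _).self_of_nhds)

/-- Formal derivatives are the tangent vectors of prolonged sections. This is the only link between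
actual sections and the coordinate formulas. -/
theorem fderiv_jetFun {U : Set (Fin n → ℝ)} (hU : IsOpen U)
    {g : (Fin n → ℝ) → (Fin m → ℝ)} (hg : ContDiffOn ℝ ∞ g U) (r : ℕ) (i : Fin n)
    {u : Fin n → ℝ} (hu : u ∈ U) :
    fderiv ℝ (jetFun r g) u (Pi.single i 1) = formalVec i (jetFun (r + 1) g u) := by
  have hd : ∀ J : MultiIdx n r, DifferentiableAt ℝ (iterPartial J.1 g) u := fun J =>
    differentiableAt_of_contDiffOn hU (contDiffOn_listPartial hU hg _) hu
  have h := (hasFDerivAt_id (𝕜 := ℝ) u).prodMk (hasFDerivAt_pi.2 fun J => (hd J).hasFDerivAt)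
  refine (congrArg (fun A => A (Pi.single i 1)) h.fderiv).trans ?_
  refine Prod.ext rfl (funext fun J => ?_)
  exact (iterPartial_cons hU hg i J.1 hu).symm

/-! ### Functions with prescribed jets -/

/-- The normalized monomial `∏ (u_i - a_i)^{K_i} / K_i!`, times a constant vector. -/
def monomial (a : Fin n → ℝ) (K : Multiset (Fin n)) (c : Fin m → ℝ) (u : Fin n → ℝ) : Fin m → ℝ :=
  (∏ i, (u i - a i) ^ K.count i / (K.count i).factorial) • c

theorem contDiff_monomial (a : Fin n → ℝ) (K : Multiset (Fin n)) (c : Fin m → ℝ) :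
    ContDiff ℝ ∞ (monomial a K c) := by
  unfold monomial
  fun_prop

theorem hasDerivAt_pow_div_factorial (k : ℕ) (b t : ℝ) :
    HasDerivAt (fun t : ℝ => (t - b) ^ k / k.factorial)
      (if k = 0 then 0 else (t - b) ^ (k - 1) / (k - 1).factorial) t := by
  rcases k with _ | k
  · simpa using! hasDerivAt_const t (1 : ℝ)
  · have h := (((hasDerivAt_id t).sub_const b).pow (k + 1)).div_const ((k + 1).factorial : ℝ)
    refine h.congr_deriv ?_
    have h1 : (k.factorial : ℝ) ≠ 0 := by positivity
    have h2 : (k : ℝ) + 1 ≠ 0 := by positivity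
    rw [if_neg (Nat.succ_ne_zero k), Nat.factorial_succ, Nat.add_sub_cancel]
    push_cast
    simp only [id]
    field_simp

theorem fderiv_monomial (a : Fin n → ℝ) (K : Multiset (Fin n)) (c : Fin m → ℝ) (j : Fin n)
    (u : Fin n → ℝ) : fderiv ℝ (monomial a K c) u (Pi.single j 1) =
      if j ∈ K then monomial a (K.erase j) c u else 0 := by
  have h1 : ∀ i, HasFDerivAt (fun u : Fin n → ℝ => (u i - a i) ^ K.count i / (K.count i).factorial)
      ((if K.count i = 0 then (0 : ℝ) else (u i - a i) ^ (K.count i - 1) /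
        (K.count i - 1).factorial) • (ContinuousLinearMap.proj (R := ℝ) (φ := fun _ => ℝ) i)) u :=
    fun i => HasDerivAt.comp_hasFDerivAt (f := fun u : Fin n → ℝ => u i) u
      (hasDerivAt_pow_div_factorial (K.count i) (a i) (u i))
      (ContinuousLinearMap.proj (R := ℝ) (φ := fun _ => ℝ) i).hasFDerivAt
  have h2 := (HasFDerivAt.finsetProd (u := Finset.univ) fun i _ => h1 i).smul_const c
  refine (congrArg (fun A => A (Pi.single j 1)) h2.fderiv).trans ?_
  simp only [ContinuousLinearMap.smulRight_apply, _root_.sum_apply, _root_.smul_apply,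
    ContinuousLinearMap.proj_apply, Pi.single_apply, smul_eq_mul]
  rw [Finset.sum_eq_single j (fun i _ hi => by simp [hi]) (by simp)]
  rw [if_pos rfl, mul_one]
  by_cases hj : j ∈ K
  · rw [if_neg (Multiset.count_ne_zero.2 hj), if_pos hj, monomial]
    congr 1
    rw [← Finset.prod_erase_mul _ _ (Finset.mem_univ j), Multiset.count_erase_self]
    congr 1
    refine Finset.prod_congr rfl fun i hi => ?_
    rw [Multiset.count_erase_of_ne (Finset.ne_of_mem_erase hi)]
  · rw [if_pos (Multiset.count_eq_zero.2 hj), if_neg hj]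
    simp

/-- Multiset subtraction truncates, so the case where the list exceeds K must be separated: there
the derivative is zero. -/
theorem listPartial_monomial (a : Fin n → ℝ) (K : Multiset (Fin n)) (c : Fin m → ℝ)
    (l : List (Fin n)) : listPartial l (monomial a K c) =
      if (l : Multiset (Fin n)) ≤ K then monomial a (K - l) c else 0 := by
  induction l with
  | nil => simp [listPartial]
  | cons i l ih =>
    funext u
    rw [listPartial_cons, ih, ← Multiset.cons_coe]
    have hle : i ::ₘ (l : Multiset (Fin n)) ≤ K ↔ (l : Multiset (Fin n)) ≤ K ∧ i ∈ K - l := by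
      constructor
      · intro h
        refine ⟨(Multiset.le_cons_self _ _).trans h, ?_⟩
        rw [Multiset.mem_sub]
        have := Multiset.le_iff_count.1 h i
        rw [Multiset.count_cons_self] at this
        omega
      · rintro ⟨h, hi⟩
        rw [Multiset.mem_sub] at hi
        refine Multiset.le_iff_count.2 fun b => ?_
        have := Multiset.le_iff_count.1 h b
        rw [Multiset.count_cons]
        split_ifs with hb
        · subst hb; omega
        · omega
    by_cases h : (l : Multiset (Fin n)) ≤ K
    · rw [if_pos h, fderiv_monomial]
      by_cases hi : i ∈ K - l
      · rw [if_pos hi, if_pos (hle.2 ⟨h, hi⟩), Multiset.sub_cons, ← Multiset.sub_singleton,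
          ← Multiset.sub_singleton, tsub_right_comm]
      · rw [if_neg hi, if_neg (fun h' => hi (hle.1 h').2)]
        rfl
    · rw [if_neg h, if_neg (fun h' => h (hle.1 h').1)]
      simp

theorem monomial_self (a : Fin n → ℝ) (K : Multiset (Fin n)) (c : Fin m → ℝ) :
    monomial a K c a = if K = 0 then c else 0 := by
  unfold monomial
  split_ifs with h
  · simp [h]
  · obtain ⟨i, hi⟩ := Multiset.exists_mem_of_ne_zero h
    rw [Finset.prod_eq_zero (Finset.mem_univ i), zero_smul]
    simp [Multiset.count_eq_zero, hi]

theorem iterPartial_monomial (a : Fin n → ℝ) (J K : Multiset (Fin n)) (c : Fin m → ℝ) :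
    iterPartial J (monomial a K c) a = if J = K then c else 0 := by
  have h := congrFun (listPartial_monomial a K c (J.sort (· ≤ ·))) a
  refine h.trans ?_
  rw [Multiset.sort_eq]
  by_cases hJK : J ≤ K
  · rw [if_pos hJK, monomial_self]
    simp [tsub_eq_zero_iff_le, hJK.ge_iff_eq]
  · rw [if_neg hJK, if_neg (fun h => hJK h.le)]
    rfl

theorem listPartial_sum {ι : Type*} (s : Finset ι) {f : ι → (Fin n → ℝ) → (Fin m → ℝ)}
    (hf : ∀ i, ContDiff ℝ ∞ (f i)) (l : List (Fin n)) :
    listPartial l (fun u => ∑ i ∈ s, f i u) = fun u => ∑ i ∈ s, listPartial l (f i) u := by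
  induction l with
  | nil => rfl
  | cons j l ih =>
    funext u
    rw [listPartial_cons, ih, fderiv_fun_sum fun i _ => differentiableAt_of_contDiffOn isOpen_univ
      (contDiffOn_listPartial isOpen_univ (hf i).contDiffOn l) (Set.mem_univ u)]
    simp [listPartial_cons]

/-- The Taylor polynomial with the prescribed coefficients; the normalized monomials are dual to the
iterated derivatives at the base point. -/
theorem exists_jetFun_eq {r : ℕ} (z : JetModel n m r) :
    ∃ g : (Fin n → ℝ) → (Fin m → ℝ), ContDiff ℝ ∞ g ∧ jetFun r g z.1 = z := by
  refine ⟨fun u => ∑ K : MultiIdx n r, monomial z.1 K.1 (z.2 K) u,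
    ContDiff.sum fun K _ => contDiff_monomial _ _ _, Prod.ext rfl (funext fun J => ?_)⟩
  have h := congrFun (listPartial_sum Finset.univ
    (fun K : MultiIdx n r => contDiff_monomial z.1 K.1 (z.2 K)) (J.1.sort (· ≤ ·))) z.1
  refine h.trans ?_
  change ∑ K : MultiIdx n r, iterPartial J.1 (monomial z.1 K.1 (z.2 K)) z.1 = z.2 J
  simp [iterPartial_monomial, ← Subtype.ext_iff]

end FunctionJets

end JetVar

namespace JetVar

/-! ### Base points of jets, and the abstract form of a jet transition. -/

section Base

variable {n m : ℕ}

/-- The point of the total space below a jet, in coordinates. -/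
def base {r : ℕ} : JetModel n m r →L[ℝ] (Fin n → ℝ) × (Fin m → ℝ) :=
  (ContinuousLinearMap.fst ℝ _ _).prod
    ((ContinuousLinearMap.proj (R := ℝ) (φ := fun _ : MultiIdx n r => Fin m → ℝ) idx0).comp
      (ContinuousLinearMap.snd ℝ _ _))

theorem base_apply {r : ℕ} (z : JetModel n m r) : base z = (z.1, z.2 idx0) := rfl

theorem MultiIdx.cases_succ {r : ℕ} {p : MultiIdx n (r + 1) → Prop} (h0 : p idx0)
    (h1 : ∀ (J : MultiIdx n r) (i : Fin n), p (J.adjoin i)) (J : MultiIdx n (r + 1)) : p J := by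
  obtain ⟨J, hJ⟩ := J
  induction J using Multiset.induction with
  | empty => exact h0
  | cons i J _ => exact h1 ⟨J, by simpa using hJ⟩ i

theorem jet_ext_base {z w : JetModel n m 0} (h : base z = base w) : z = w := by
  refine Prod.ext (congrArg Prod.fst h :) (funext fun J => ?_)
  rw [MultiIdx.eq_idx0 J]
  exact congrArg Prod.snd h

/-- Every coordinate with nonempty multi-index is a component of some d_k. This reduces statements
in order r + 1 to formal vectors. -/
theorem jet_ext_formalVec {r : ℕ} {z w : JetModel n m (r + 1)} (h : base z = base w)
    (hf : ∀ k, formalVec k z = formalVec k w) : z = w := by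
  refine Prod.ext (congrArg Prod.fst h :) (funext fun J => ?_)
  induction J using MultiIdx.cases_succ with
  | h0 => exact congrArg Prod.snd h
  | h1 J i => exact congrFun (congrArg Prod.snd (hf i)) J

end Base

/-- The Jacobian matrix `J_{ki} = ∂G^k/∂x^i`. -/
def jacobian {n : ℕ} (G : (Fin n → ℝ) → (Fin n → ℝ)) (u : Fin n → ℝ) : Matrix (Fin n) (Fin n) ℝ :=
  Matrix.of fun k i => fderiv ℝ G u (Pi.single i 1) k

/-- A family of maps of the coordinate jet spaces with the properties of the transition maps
between the charts associated with two fibered charts. -/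
structure JetTransition (n m : ℕ) where
  dom : Set ((Fin n → ℝ) × (Fin m → ℝ))
  G : (Fin n → ℝ) → (Fin n → ℝ)
  K : (Fin n → ℝ) → Matrix (Fin n) (Fin n) ℝ
  T : ∀ r, JetModel n m r → JetModel n m r
  isOpen_dom : IsOpen dom
  contDiffAt_G : ∀ p ∈ dom, ContDiffAt ℝ ∞ G p.1
  contDiffAt_K : ∀ p ∈ dom, ∀ i k, ContDiffAt ℝ ∞ (fun u => K u i k) p.1
  jacobian_mul : ∀ p ∈ dom, jacobian G p.1 * K p.1 = 1
  smooth : ∀ r, ContDiffOn ℝ ∞ (T r) (base ⁻¹' dom)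
  fst_eq : ∀ r z, base z ∈ dom → (T r z).1 = G z.1
  proj_comm : ∀ r (z : JetModel n m (r + 1)), base z ∈ dom →
    proj (Nat.le_succ r) (T (r + 1) z) = T r (proj (Nat.le_succ r) z)
  formal : ∀ r i (z : JetModel n m (r + 1)), base z ∈ dom →
    fderiv ℝ (T r) (proj (Nat.le_succ r) z) (formalVec i z) =
      ∑ k, jacobian G z.1 k i • formalVec k (T (r + 1) z)

/-! ### Sections in fibered charts and the coordinate domains. -/

section Charts

variable {n m : ℕ} {X Y : Type*}
  [TopologicalSpace X] [ChartedSpace (Fin n → ℝ) X]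
  [TopologicalSpace Y] [ChartedSpace ((Fin n → ℝ) × (Fin m → ℝ)) Y] {π : Y → X}

namespace PointedSection

theorem proj_sec (p : PointedSection n m π) : π (p.sec p.pt) = p.pt := p.isSection.self_of_nhds.2

end PointedSection

namespace FiberedChart

variable (c c' : FiberedChart n m π)

theorem pt_mem {p : PointedSection n m π} (hp : p.sec p.pt ∈ c.ψ.source) :
    p.pt ∈ c.φ.source := by
  rw [c.source_eq]
  exact ⟨_, hp, p.proj_sec⟩

theorem symm_apply_eq {x : X} {y : Y} (hx : π y = x) (hy : y ∈ c.ψ.source) :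
    (c.ψ y).1 = c.φ x := by
  rw [c.fst_eq y hy, hx]

theorem base_sectionCoord {r : ℕ} {p : PointedSection n m π} (hp : p.sec p.pt ∈ c.ψ.source) :
    base (c.sectionCoord r p) = c.ψ (p.sec p.pt) := by
  refine Prod.ext (c.symm_apply_eq p.proj_sec hp).symm ?_
  change iterPartial 0 (c.components p.sec) (c.φ p.pt) = _
  rw [iterPartial_zero, components, c.φ.left_inv (c.pt_mem hp)]

/-- Around the point of a section there is a neighbourhood in the chart on which the section is
smooth and a section. -/
theorem exists_nhd {p : PointedSection n m π} (hp : p.sec p.pt ∈ c.ψ.source)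
    {V : Set Y} (hV : IsOpen V) (hpV : p.sec p.pt ∈ V) :
    ∃ U : Set (Fin n → ℝ), IsOpen U ∧ c.φ p.pt ∈ U ∧ U ⊆ c.φ.target ∧
      ContDiffOn ℝ ∞ (c.components p.sec) U ∧
      ∀ u ∈ U, ∃ q : PointedSection n m π, q.pt = c.φ.symm u ∧ q.sec = p.sec ∧
        q.sec q.pt ∈ c.ψ.source ∧ q.sec q.pt ∈ V := by
  have hs := p.isSection.self_of_nhds
  set O : Set X := interior {x | (ContMDiffAt 𝓘(ℝ, Fin n → ℝ) 𝓘(ℝ, (Fin n → ℝ) × (Fin m → ℝ)) ∞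
    p.sec x ∧ π (p.sec x) = x) ∧ p.sec x ∈ c.ψ.source ∩ V} with hO
  have hpO : p.pt ∈ O := by
    rw [hO, mem_interior_iff_mem_nhds]
    exact p.isSection.and (hs.1.continuousAt.preimage_mem_nhds
      ((c.ψ.open_source.inter hV).mem_nhds ⟨hp, hpV⟩))
  have hsub : ∀ x ∈ O, (ContMDiffAt 𝓘(ℝ, Fin n → ℝ) 𝓘(ℝ, (Fin n → ℝ) × (Fin m → ℝ)) ∞
    p.sec x ∧ π (p.sec x) = x) ∧ p.sec x ∈ c.ψ.source ∩ V := fun x hx => by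
    rw [hO] at hx
    have h := interior_subset hx
    exact h
  have hpt := c.pt_mem hp
  refine ⟨c.φ.target ∩ c.φ.symm ⁻¹' O, c.φ.symm.isOpen_inter_preimage isOpen_interior,
    ⟨c.φ.map_source hpt, by simpa [c.φ.left_inv hpt] using hpO⟩, Set.inter_subset_left, ?_, ?_⟩
  · rintro u ⟨hu, huO⟩
    obtain ⟨⟨h1, h2⟩, h3, h4⟩ := hsub _ huO
    have e1 := contMDiffAt_symm_of_mem_maximalAtlas c.φ_mem hu
    have e2 := contMDiffAt_of_mem_maximalAtlas c.ψ_mem h3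
    have e3 := (ContMDiffAt.comp u (ContMDiffAt.comp (c.φ.symm u) e2 h1) e1).contDiffAt
    exact (contDiff_snd.contDiffAt.comp u e3).contDiffWithinAt
  · rintro u ⟨hu, huO⟩
    refine ⟨⟨c.φ.symm u, p.sec, ?_⟩, rfl, rfl, (hsub _ huO).2.1, (hsub _ huO).2.2⟩
    exact Filter.eventually_of_mem (isOpen_interior.mem_nhds huO) fun x hx => (hsub x hx).1

/-- A Taylor polynomial with the given jet is transported to Y by the chart; it stays in the chart
near the point by continuity. -/
theorem exists_sectionCoord_eq {r : ℕ} {z : JetModel n m r} (hz : base z ∈ c.ψ.target) :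
    ∃ p : PointedSection n m π, p.sec p.pt ∈ c.ψ.source ∧ c.sectionCoord r p = z := by
  obtain ⟨g, hg, hgz⟩ := exists_jetFun_eq z
  have hg0 : (z.1, g z.1) = base z := by
    refine Prod.ext rfl ?_
    have := congrFun (congrArg Prod.snd hgz) idx0
    rw [base_apply, ← this]
    exact (congrFun (iterPartial_zero g) z.1).symm
  have hy := c.ψ.map_target hz
  set y := c.ψ.symm (base z) with hy'
  have hφ : c.φ (π y) = z.1 := by
    rw [← c.fst_eq y hy, hy', c.ψ.right_inv hz, base_apply]
  have hx : π y ∈ c.φ.source := by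
    rw [c.source_eq]; exact ⟨y, hy, rfl⟩
  have hgc : Continuous fun u => (u, g u) := continuous_id.prodMk hg.continuous
  have hU : IsOpen (c.φ.target ∩ (fun u => (u, g u)) ⁻¹' c.ψ.target) :=
    c.φ.open_target.inter (c.ψ.open_target.preimage hgc)
  have hzU : z.1 ∈ c.φ.target ∩ (fun u => (u, g u)) ⁻¹' c.ψ.target := by
    refine ⟨hφ ▸ c.φ.map_source hx, ?_⟩
    change (z.1, g z.1) ∈ c.ψ.target
    rwa [hg0]
  have hpt : c.ψ.symm (c.φ (π y), g (c.φ (π y))) = y := by rw [hφ, hg0]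
  have hev : ∀ᶠ x in 𝓝 (π y), x ∈ c.φ.source ∧ (c.φ x, g (c.φ x)) ∈ c.ψ.target := by
    have h1 : ∀ᶠ x in 𝓝 (π y), x ∈ c.φ.source := c.φ.open_source.mem_nhds hx
    have h2 : ∀ᶠ x in 𝓝 (π y), c.φ x ∈ c.φ.target ∩ (fun u => (u, g u)) ⁻¹' c.ψ.target :=
      (c.φ.continuousAt hx).preimage_mem_nhds (hU.mem_nhds (by rwa [hφ]))
    exact h1.and (h2.mono fun x hx => hx.2)
  refine ⟨⟨π y, fun x => c.ψ.symm (c.φ x, g (c.φ x)), hev.mono fun x hx => ⟨?_, ?_⟩⟩, ?_, ?_⟩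
  · have e1 := contMDiffAt_of_mem_maximalAtlas c.φ_mem hx.1
    have e2 := contMDiffAt_symm_of_mem_maximalAtlas c.ψ_mem hx.2
    have e3 : ContMDiffAt 𝓘(ℝ, Fin n → ℝ) 𝓘(ℝ, (Fin n → ℝ) × (Fin m → ℝ)) ∞
        (fun u => (u, g u)) (c.φ x) := (contDiff_id.prodMk hg).contMDiff.contMDiffAt
    exact ContMDiffAt.comp x e2 (ContMDiffAt.comp x e3 e1)
  · have h1 := c.ψ.map_target hx.2
    have h2 := c.fst_eq _ h1
    rw [c.ψ.right_inv hx.2] at h2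
    -- The section property is checked in the base chart, where the first component of ψ is φ ∘ π.
    refine c.φ.injOn ?_ hx.1 h2.symm
    rw [c.source_eq]
    exact ⟨_, h1, rfl⟩
  · change c.ψ.symm (c.φ (π y), g (c.φ (π y))) ∈ _
    rwa [hpt]
  · change jetFun r (c.components fun x => c.ψ.symm (c.φ x, g (c.φ x))) (c.φ (π y)) = z
    rw [hφ]
    conv_rhs => rw [← hgz]
    refine jetFun_congr (Filter.eventuallyEq_of_mem (hU.mem_nhds hzU) fun u hu => ?_) r
    change (c.ψ (c.ψ.symm (c.φ (c.φ.symm u), g (c.φ (c.φ.symm u))))).2 = g u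
    rw [c.φ.right_inv hu.1, c.ψ.right_inv hu.2]

open Classical in
theorem jetCoord_mk {r : ℕ} {p : PointedSection n m π} (hp : p.sec p.pt ∈ c.ψ.source) :
    c.jetCoord r (Quotient.mk (jetSetoid n m π r) p) = c.sectionCoord r p := by
  change (if p.sec p.pt ∈ c.ψ.source then c.sectionCoord r p else 0) = _
  rw [if_pos hp]

theorem jetRange_eq (r : ℕ) : c.jetRange r = base ⁻¹' c.ψ.target := by
  ext z
  constructor
  · rintro ⟨q, hq, rfl⟩
    induction q using Quotient.inductionOn with
    | h p =>
      have hp : p.sec p.pt ∈ c.ψ.source := hq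
      rw [Set.mem_preimage, c.jetCoord_mk hp, c.base_sectionCoord hp]
      exact c.ψ.map_source hp
  · intro hz
    obtain ⟨p, hp, rfl⟩ := c.exists_sectionCoord_eq hz
    exact ⟨Quotient.mk _ p, hp, c.jetCoord_mk hp⟩

/-- The domain of the coordinate change on the total space. -/
def overlap : Set ((Fin n → ℝ) × (Fin m → ℝ)) := c.ψ.target ∩ c.ψ.symm ⁻¹' c'.ψ.source

theorem isOpen_overlap : IsOpen (c.overlap c') :=
  c.ψ.symm.isOpen_inter_preimage c'.ψ.open_source

theorem image_jetCoord_inter (r : ℕ) :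
    c.jetCoord r '' (c.jetDomain r ∩ c'.jetDomain r) = base ⁻¹' c.overlap c' := by
  ext z
  constructor
  · rintro ⟨q, ⟨hq, hq'⟩, rfl⟩
    induction q using Quotient.inductionOn with
    | h p =>
      have hp : p.sec p.pt ∈ c.ψ.source := hq
      rw [Set.mem_preimage, c.jetCoord_mk hp, c.base_sectionCoord hp]
      refine ⟨c.ψ.map_source hp, ?_⟩
      rw [Set.mem_preimage, c.ψ.left_inv hp]
      exact hq'
  · intro hz
    obtain ⟨p, hp, rfl⟩ := c.exists_sectionCoord_eq hz.1
    refine ⟨Quotient.mk _ p, ⟨hp, ?_⟩, c.jetCoord_mk hp⟩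
    have h := hz.2
    rwa [Set.mem_preimage, c.base_sectionCoord hp, c.ψ.left_inv hp] at h

end FiberedChart

end Charts

end JetVar

namespace JetVar

/-! ### Transition maps between jet charts. -/

section Charts

variable {n m : ℕ} {X Y : Type*}
  [TopologicalSpace X] [ChartedSpace (Fin n → ℝ) X]
  [TopologicalSpace Y] [ChartedSpace ((Fin n → ℝ) × (Fin m → ℝ)) Y] {π : Y → X}

namespace FiberedChart

variable (c c' : FiberedChart n m π)

/-- The coordinate change on the base. -/
def baseTransition (u : Fin n → ℝ) : Fin n → ℝ := c'.φ (c.φ.symm u)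

/-- The coordinate change on the total space. -/
def totalTransition (p : (Fin n → ℝ) × (Fin m → ℝ)) : (Fin n → ℝ) × (Fin m → ℝ) :=
  c'.ψ (c.ψ.symm p)

variable {c c'}

theorem contDiffAt_baseTransition {u : Fin n → ℝ} (hu : u ∈ c.φ.target)
    (hu' : c.φ.symm u ∈ c'.φ.source) : ContDiffAt ℝ ∞ (c.baseTransition c') u :=
  (ContMDiffAt.comp u (contMDiffAt_of_mem_maximalAtlas c'.φ_mem hu')
    (contMDiffAt_symm_of_mem_maximalAtlas c.φ_mem hu)).contDiffAt

theorem contDiffAt_totalTransition {p : (Fin n → ℝ) × (Fin m → ℝ)} (hp : p ∈ c.overlap c') :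
    ContDiffAt ℝ ∞ (c.totalTransition c') p :=
  (ContMDiffAt.comp p (contMDiffAt_of_mem_maximalAtlas c'.ψ_mem hp.2)
    (contMDiffAt_symm_of_mem_maximalAtlas c.ψ_mem hp.1)).contDiffAt

theorem symm_fst {p : (Fin n → ℝ) × (Fin m → ℝ)} (hp : p ∈ c.ψ.target) :
    p.1 ∈ c.φ.target ∧ c.φ.symm p.1 = π (c.ψ.symm p) := by
  have h := c.ψ.map_target hp
  have h1 : π (c.ψ.symm p) ∈ c.φ.source := by
    rw [c.source_eq]; exact ⟨_, h, rfl⟩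
  have h2 : p.1 = c.φ (π (c.ψ.symm p)) := by
    rw [← c.fst_eq _ h, c.ψ.right_inv hp]
  rw [h2]
  exact ⟨c.φ.map_source h1, c.φ.left_inv h1⟩

theorem overlap_fst {p : (Fin n → ℝ) × (Fin m → ℝ)} (hp : p ∈ c.overlap c') :
    p.1 ∈ c.φ.target ∧ c.φ.symm p.1 ∈ c'.φ.source := by
  obtain ⟨h1, h2⟩ := symm_fst hp.1
  refine ⟨h1, ?_⟩
  rw [h2, c'.source_eq]
  exact ⟨_, hp.2, rfl⟩

theorem baseTransition_symm {u : Fin n → ℝ} (hu : u ∈ c.φ.target)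
    (hu' : c.φ.symm u ∈ c'.φ.source) :
    c.baseTransition c' u ∈ c'.φ.target ∧ c'.φ.symm (c.baseTransition c' u) ∈ c.φ.source ∧
      c'.baseTransition c (c.baseTransition c' u) = u := by
  unfold baseTransition
  rw [c'.φ.left_inv hu', c.φ.right_inv hu]
  exact ⟨c'.φ.map_source hu', c.φ.map_target hu, rfl⟩

theorem jacobian_mul_jacobian {u : Fin n → ℝ} (hu : u ∈ c.φ.target)
    (hu' : c.φ.symm u ∈ c'.φ.source) :
    jacobian (c.baseTransition c') u *
      jacobian (c'.baseTransition c) (c.baseTransition c' u) = 1 := by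
  -- The chain rule for the round trip starting at u gives the product in the opposite order.
  rw [mul_eq_one_comm]
  obtain ⟨h1, h2, h3⟩ := baseTransition_symm hu hu'
  have d1 := (contDiffAt_baseTransition hu hu').differentiableAt (by simp)
  have d2 := (contDiffAt_baseTransition h1 h2).differentiableAt (by simp)
  have hU : IsOpen (c.φ.target ∩ c.φ.symm ⁻¹' c'.φ.source) :=
    c.φ.symm.isOpen_inter_preimage c'.φ.open_source
  have he : (fun v => c'.baseTransition c (c.baseTransition c' v)) =ᶠ[𝓝 u] fun v => v :=
    Filter.eventuallyEq_of_mem (hU.mem_nhds ⟨hu, hu'⟩) fun v hv =>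
      (baseTransition_symm hv.1 hv.2).2.2
  have hc := (d2.hasFDerivAt.comp u d1.hasFDerivAt).fderiv
  have he' := he.fderiv_eq (𝕜 := ℝ)
  rw [fderiv_fun_id] at he'
  have hid := hc.symm.trans he'
  ext i k
  have hk := congrFun (congrArg (fun A => A (Pi.single k (1 : ℝ))) hid) i
  have hexp : fderiv ℝ (c.baseTransition c') u (Pi.single k 1) =
      ∑ j, jacobian (c.baseTransition c') u j k • (Pi.single j (1 : ℝ) : Fin n → ℝ) := by
    ext l
    simp [jacobian, Pi.single_apply]
  simp only [ContinuousLinearMap.comp_apply, hexp, map_sum, map_smul] at hk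
  rw [Matrix.mul_apply]
  simp only [Finset.sum_apply, Pi.smul_apply, smul_eq_mul] at hk
  rw [Matrix.one_apply]
  refine (Finset.sum_congr rfl fun j _ => mul_comm _ _).trans (hk.trans ?_)
  simp [Pi.single_apply]

section Sections

variable {p q : PointedSection n m π}

theorem baseTransition_pt (hp : p.sec p.pt ∈ c.ψ.source) :
    c.baseTransition c' (c.φ p.pt) = c'.φ p.pt := by
  rw [baseTransition, c.φ.left_inv (c.pt_mem hp)]

theorem sec_eq_of_sectionCoord_eq {r : ℕ} (hp : p.sec p.pt ∈ c.ψ.source)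
    (hq : q.sec q.pt ∈ c.ψ.source) (h : c.sectionCoord r p = c.sectionCoord r q) :
    p.sec p.pt = q.sec q.pt := by
  have := congrArg base h
  rw [c.base_sectionCoord hp, c.base_sectionCoord hq] at this
  exact c.ψ.injOn hp hq this

theorem mem_overlap {r : ℕ} (hp : p.sec p.pt ∈ c.ψ.source) (hp' : p.sec p.pt ∈ c'.ψ.source) :
    base (c.sectionCoord r p) ∈ c.overlap c' := by
  rw [c.base_sectionCoord hp]
  refine ⟨c.ψ.map_source hp, ?_⟩
  rwa [Set.mem_preimage, c.ψ.left_inv hp]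

theorem exists_sectionCoord_eq_of_overlap {r : ℕ} {z : JetModel n m r}
    (hz : base z ∈ c.overlap c') :
    ∃ p : PointedSection n m π, p.sec p.pt ∈ c.ψ.source ∧ p.sec p.pt ∈ c'.ψ.source ∧
      c.sectionCoord r p = z := by
  obtain ⟨p, hp, rfl⟩ := c.exists_sectionCoord_eq hz.1
  refine ⟨p, hp, ?_, rfl⟩
  have h := hz.2
  rwa [Set.mem_preimage, c.base_sectionCoord hp, c.ψ.left_inv hp] at h

variable (c c') in
/-- The coordinates of an `r`-jet in one chart determine those in another chart. -/
def JetsDetermined (r : ℕ) : Prop :=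
  ∀ p q : PointedSection n m π, p.sec p.pt ∈ c.ψ.source → p.sec p.pt ∈ c'.ψ.source →
    q.sec q.pt ∈ c.ψ.source → q.sec q.pt ∈ c'.ψ.source →
    c.sectionCoord r p = c.sectionCoord r q → c'.sectionCoord r p = c'.sectionCoord r q

/-- The transition map chooses a jet with the given coordinates; `JetsDetermined` makes its value
independent of the choice. -/
theorem jetTransition_sectionCoord {r : ℕ} (h : JetsDetermined c c' r)
    (hp : p.sec p.pt ∈ c.ψ.source) (hp' : p.sec p.pt ∈ c'.ψ.source) :
    c.jetTransition c' r (c.sectionCoord r p) = c'.sectionCoord r p := by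
  have hex : ∃ x ∈ c.jetDomain r, c.jetCoord r x = c.sectionCoord r p :=
    ⟨Quotient.mk _ p, hp, c.jetCoord_mk hp⟩
  rw [jetTransition, dif_pos hex]
  have hs := hex.choose_spec
  generalize hex.choose = x at hs
  induction x using Quotient.inductionOn with
  | h q =>
    have hq : q.sec q.pt ∈ c.ψ.source := hs.1
    have hcoord := hs.2
    rw [c.jetCoord_mk hq] at hcoord
    have hq' : q.sec q.pt ∈ c'.ψ.source := by
      rwa [sec_eq_of_sectionCoord_eq hq hp hcoord]
    rw [c'.jetCoord_mk hq']
    exact h q p hq hq' hp hp' hcoord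

theorem jetsDetermined_zero : JetsDetermined c c' 0 := by
  intro p q hp hp' hq hq' h
  refine jet_ext_base ?_
  rw [c'.base_sectionCoord hp', c'.base_sectionCoord hq', sec_eq_of_sectionCoord_eq hp hq h]

theorem base_jetTransition {r : ℕ} (h : JetsDetermined c c' r) {z : JetModel n m r}
    (hz : base z ∈ c.overlap c') :
    base (c.jetTransition c' r z) = c.totalTransition c' (base z) := by
  obtain ⟨p, hp, hp', rfl⟩ := exists_sectionCoord_eq_of_overlap hz
  rw [jetTransition_sectionCoord h hp hp', c'.base_sectionCoord hp', c.base_sectionCoord hp,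
    totalTransition, c.ψ.left_inv hp]

theorem jetTransition_fst {r : ℕ} (h : JetsDetermined c c' r) {z : JetModel n m r}
    (hz : base z ∈ c.overlap c') : (c.jetTransition c' r z).1 = c.baseTransition c' z.1 := by
  obtain ⟨p, hp, hp', rfl⟩ := exists_sectionCoord_eq_of_overlap hz
  rw [jetTransition_sectionCoord h hp hp']
  exact (baseTransition_pt hp).symm

theorem contDiffOn_jetTransition_zero :
    ContDiffOn ℝ ∞ (c.jetTransition c' 0) (base ⁻¹' c.overlap c') := by
  have h1 : ContDiffOn ℝ ∞ (fun z : JetModel n m 0 => c.totalTransition c' (base z))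
      (base ⁻¹' c.overlap c') := fun z hz =>
    ((contDiffAt_totalTransition hz).comp z base.contDiff.contDiffAt).contDiffWithinAt
  have h2 : ContDiffOn ℝ ∞ (fun z : JetModel n m 0 => (((c.totalTransition c' (base z)).1,
      fun _ => (c.totalTransition c' (base z)).2) : JetModel n m 0)) (base ⁻¹' c.overlap c') :=
    h1.fst.prodMk (contDiffOn_pi.2 fun _ => h1.snd)
  refine h2.congr fun z hz => ?_
  refine jet_ext_base ?_
  rw [base_jetTransition jetsDetermined_zero hz]
  rfl

/-- Along the prolongation of one section the transition map covers the base transition;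
differentiating this identity along x^i gives the transformation law of the formal derivatives. -/
theorem fderiv_jetTransition_sectionCoord {r : ℕ} (h : JetsDetermined c c' r)
    (hT : ContDiffOn ℝ ∞ (c.jetTransition c' r) (base ⁻¹' c.overlap c'))
    (hp : p.sec p.pt ∈ c.ψ.source) (hp' : p.sec p.pt ∈ c'.ψ.source) (i : Fin n) :
    fderiv ℝ (c.jetTransition c' r) (c.sectionCoord r p) (formalVec i (c.sectionCoord (r + 1) p)) =
      ∑ k, jacobian (c.baseTransition c') (c.φ p.pt) k i •
        formalVec k (c'.sectionCoord (r + 1) p) := by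
  obtain ⟨U, hU, hpU, hUt, hg, hUq⟩ := c.exists_nhd hp c'.ψ.open_source hp'
  obtain ⟨U', hU', hpU', hUt', hg', -⟩ := c'.exists_nhd hp' c.ψ.open_source hp
  have hpt := c.pt_mem hp
  have hφ : c.φ.symm (c.φ p.pt) ∈ c'.φ.source := by
    rw [c.φ.left_inv hpt]; exact c'.pt_mem hp'
  have e : (fun u => c.jetTransition c' r (jetFun r (c.components p.sec) u)) =ᶠ[𝓝 (c.φ p.pt)]
      fun u => jetFun r (c'.components p.sec) (c.baseTransition c' u) := by
    refine Filter.eventuallyEq_of_mem (hU.mem_nhds hpU) fun u hu => ?_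
    obtain ⟨q, hq1, hq2, hq3, hq4⟩ := hUq u hu
    have h1 := jetTransition_sectionCoord h hq3 hq4
    have h2 : c.sectionCoord r q = jetFun r (c.components p.sec) u := by
      rw [← hq2]
      change jetFun r (c.components q.sec) (c.φ q.pt) = _
      rw [hq1, c.φ.right_inv (hUt hu)]
    have h3 : c'.sectionCoord r q = jetFun r (c'.components p.sec) (c.baseTransition c' u) := by
      rw [← hq2, baseTransition, ← hq1]
      rfl
    rw [h2, h3] at h1
    exact h1
  have hG := contDiffAt_baseTransition (c.φ.map_source hpt) hφ
  have hGp : c.baseTransition c' (c.φ p.pt) = c'.φ p.pt := baseTransition_pt hp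
  have d1 := differentiableAt_of_contDiffOn hU (contDiffOn_jetFun hU hg r) hpU
  have d2 := differentiableAt_of_contDiffOn hU' (contDiffOn_jetFun hU' hg' r) hpU'
  have d3 : DifferentiableAt ℝ (c.jetTransition c' r)
      (jetFun r (c.components p.sec) (c.φ p.pt)) :=
    differentiableAt_of_contDiffOn ((c.isOpen_overlap c').preimage base.continuous) hT
      (mem_overlap (r := r) hp hp')
  have hGd := hG.differentiableAt (by simp)
  rw [← hGp] at d2
  have key := (d3.hasFDerivAt.comp _ d1.hasFDerivAt).fderiv.symm.trans
    (e.fderiv_eq.trans (d2.hasFDerivAt.comp _ hGd.hasFDerivAt).fderiv)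
  have k1 := congrArg (fun A => A (Pi.single i (1 : ℝ))) key
  have hexp : fderiv ℝ (c.baseTransition c') (c.φ p.pt) (Pi.single i 1) =
      ∑ k, jacobian (c.baseTransition c') (c.φ p.pt) k i • (Pi.single k (1 : ℝ) : Fin n → ℝ) := by
    ext l
    simp [jacobian, Pi.single_apply]
  simp only [ContinuousLinearMap.comp_apply, hexp, map_sum, map_smul] at k1
  rw [fderiv_jetFun hU hg r i hpU] at k1
  refine k1.trans (Finset.sum_congr rfl fun k _ => ?_)
  rw [hGp, fderiv_jetFun hU' hg' r k hpU']
  rfl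

/-- The previous law solved with the inverse Jacobian: the (r+1)-jet in the new chart is expressed
by the (r+1)-jet in the old one and the derivative of the transition of order r. -/
theorem formalVec_sectionCoord {r : ℕ} (h : JetsDetermined c c' r)
    (hT : ContDiffOn ℝ ∞ (c.jetTransition c' r) (base ⁻¹' c.overlap c'))
    (hp : p.sec p.pt ∈ c.ψ.source) (hp' : p.sec p.pt ∈ c'.ψ.source) (k : Fin n) :
    formalVec k (c'.sectionCoord (r + 1) p) =
      ∑ i, jacobian (c'.baseTransition c) (c.baseTransition c' (c.φ p.pt)) i k •
        fderiv ℝ (c.jetTransition c' r) (c.sectionCoord r p)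
          (formalVec i (c.sectionCoord (r + 1) p)) := by
  have hJ := jacobian_mul_jacobian (c := c) (c' := c') (c.φ.map_source (c.pt_mem hp))
    (by rw [c.φ.left_inv (c.pt_mem hp)]; exact c'.pt_mem hp')
  simp only [fderiv_jetTransition_sectionCoord h hT hp hp', Finset.smul_sum, smul_smul]
  rw [Finset.sum_comm]
  have h1 : ∀ l, ∑ i, jacobian (c'.baseTransition c) (c.baseTransition c' (c.φ p.pt)) i k *
      jacobian (c.baseTransition c') (c.φ p.pt) l i = if l = k then 1 else 0 := by
    intro l
    rw [← Matrix.one_apply, ← hJ, Matrix.mul_apply]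
    exact Finset.sum_congr rfl fun _ _ => mul_comm _ _
  simp only [← Finset.sum_smul, h1]
  simp

/-- The two claims need a joint induction: order r + 1 is expressed through the derivative of the
transition of order r, which must be well defined and smooth. -/
theorem jetsDetermined_and_contDiffOn (r : ℕ) : JetsDetermined c c' r ∧
    ContDiffOn ℝ ∞ (c.jetTransition c' r) (base ⁻¹' c.overlap c') := by
  induction r with
  | zero => exact ⟨jetsDetermined_zero, contDiffOn_jetTransition_zero⟩
  | succ r ih =>
    obtain ⟨h, hT⟩ := ih
    have hJD : JetsDetermined c c' (r + 1) := by
      intro p q hp hp' hq hq' hpq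
      have hpt : c.φ p.pt = c.φ q.pt := congrArg Prod.fst hpq
      have hpr : c.sectionCoord r p = c.sectionCoord r q := congrArg (proj (Nat.le_succ r)) hpq
      refine jet_ext_formalVec ?_ fun k => ?_
      · rw [c'.base_sectionCoord hp', c'.base_sectionCoord hq', sec_eq_of_sectionCoord_eq hp hq hpq]
      · rw [formalVec_sectionCoord h hT hp hp', formalVec_sectionCoord h hT hq hq', hpq, hpt, hpr]
    refine ⟨hJD, ?_⟩
    have hO := c.isOpen_overlap c'
    have hO' : IsOpen (base (n := n) (m := m) (r := r) ⁻¹' c.overlap c') := hO.preimage base.continuous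
    have hb : ContDiffOn ℝ ∞ (fun z : JetModel n m (r + 1) => c.totalTransition c' (base z))
        (base ⁻¹' c.overlap c') := fun z hz =>
      ((contDiffAt_totalTransition hz).comp z base.contDiff.contDiffAt).contDiffWithinAt
    have hbt := fun (z : JetModel n m (r + 1)) (hz : base z ∈ c.overlap c') =>
      base_jetTransition hJD hz
    have hf : ∀ k, ContDiffOn ℝ ∞ (fun z => formalVec k (c.jetTransition c' (r + 1) z))
        (base ⁻¹' c.overlap c') := by
      intro k
      have h1 : ContDiffOn ℝ ∞ (fun z : JetModel n m (r + 1) =>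
          ∑ i, jacobian (c'.baseTransition c) (c.baseTransition c' z.1) i k •
            fderiv ℝ (c.jetTransition c' r) (proj (Nat.le_succ r) z) (formalVec i z))
          (base ⁻¹' c.overlap c') := by
        refine ContDiffOn.sum fun i _ => ContDiffOn.fun_smul (fun z hz => ?_) ?_
        · obtain ⟨h1, h2⟩ := overlap_fst hz
          obtain ⟨h3, h4, -⟩ := baseTransition_symm h1 h2
          have d1 := contDiffAt_baseTransition h1 h2
          have d2 := ((contDiffAt_baseTransition h3 h4).fderiv_right (m := ∞) (by simp)).clm_apply
            (contDiffAt_const (c := (Pi.single k 1 : Fin n → ℝ)))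
          have d3 := (contDiffAt_pi.1 d2) i
          exact (d3.comp z (d1.comp z contDiffAt_fst)).contDiffWithinAt
        · exact (contDiffOn_comp_proj (Nat.le_succ r)
            (hT.fderiv_of_isOpen (m := ∞) hO' (by simp))).clm_apply (contDiff_formalVec i).contDiffOn
      refine h1.congr fun z hz => ?_
      obtain ⟨p, hp, hp', rfl⟩ := exists_sectionCoord_eq_of_overlap hz
      rw [jetTransition_sectionCoord hJD hp hp']
      exact formalVec_sectionCoord h hT hp hp' k
    refine ContDiffOn.prodMk (f := fun z => (c.jetTransition c' (r + 1) z).1)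
      (g := fun z => (c.jetTransition c' (r + 1) z).2) ?_ (contDiffOn_pi.2 fun J => ?_)
    · exact hb.fst.congr fun z hz => congrArg Prod.fst (hbt z hz)
    · induction J using MultiIdx.cases_succ with
      | h0 => exact hb.snd.congr fun z hz => congrArg Prod.snd (hbt z hz)
      | h1 J i => exact contDiffOn_pi.1 (hf i).snd J

end Sections

variable (c c') in
/-- The transition maps between the charts associated with two fibered charts. -/
def toJetTransition : JetTransition n m where
  dom := c.overlap c'
  G := c.baseTransition c'
  K := fun u => jacobian (c'.baseTransition c) (c.baseTransition c' u)
  T := c.jetTransition c'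
  isOpen_dom := c.isOpen_overlap c'
  contDiffAt_G := fun p hp => contDiffAt_baseTransition (overlap_fst hp).1 (overlap_fst hp).2
  contDiffAt_K := fun p hp i k => by
    obtain ⟨h1, h2⟩ := overlap_fst hp
    obtain ⟨h3, h4, -⟩ := baseTransition_symm h1 h2
    have d2 := ((contDiffAt_baseTransition h3 h4).fderiv_right (m := ∞) (by simp)).clm_apply
      (contDiffAt_const (c := (Pi.single k 1 : Fin n → ℝ)))
    exact ((contDiffAt_pi.1 d2) i).comp p.1 (contDiffAt_baseTransition h1 h2)
  jacobian_mul := fun p hp => jacobian_mul_jacobian (overlap_fst hp).1 (overlap_fst hp).2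
  smooth := fun r => (jetsDetermined_and_contDiffOn r).2
  fst_eq := fun r z hz => jetTransition_fst (jetsDetermined_and_contDiffOn r).1 hz
  proj_comm := fun r z hz => by
    obtain ⟨p, hp, hp', rfl⟩ := exists_sectionCoord_eq_of_overlap hz
    rw [jetTransition_sectionCoord (jetsDetermined_and_contDiffOn (r + 1)).1 hp hp']
    exact (jetTransition_sectionCoord (jetsDetermined_and_contDiffOn r).1 hp hp').symm
  formal := fun r i z hz => by
    obtain ⟨p, hp, hp', rfl⟩ := exists_sectionCoord_eq_of_overlap hz
    rw [jetTransition_sectionCoord (jetsDetermined_and_contDiffOn (r + 1)).1 hp hp']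
    exact fderiv_jetTransition_sectionCoord (jetsDetermined_and_contDiffOn r).1
      (jetsDetermined_and_contDiffOn r).2 hp hp' i

end FiberedChart

end Charts

end JetVar

namespace JetVar

/-! ### Derivatives of determinants and inverses; the Piola identity. -/

section DetCalculus

variable {n : ℕ} {E : Type*} [NormedAddCommGroup E] [NormedSpace ℝ E]

/-- Jacobi's formula for the derivative of a determinant. -/
theorem hasFDerivAt_det {M : E → Matrix (Fin n) (Fin n) ℝ} {M' : Fin n → Fin n → E →L[ℝ] ℝ} {x : E}
    (h : ∀ i j, HasFDerivAt (fun u => M u i j) (M' i j) x) :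
    HasFDerivAt (fun u => (M u).det) (∑ j, ∑ i, (M x).adjugate j i • M' i j) x := by
  have h1 : HasFDerivAt (fun u => (M u).det) (∑ σ : Equiv.Perm (Fin n),
      ((Equiv.Perm.sign σ : ℤ) : ℝ) • ∑ j, (∏ k ∈ Finset.univ.erase j, M x (σ k) k) • M' (σ j) j) x := by
    have := HasFDerivAt.fun_sum (u := Finset.univ) fun (σ : Equiv.Perm (Fin n)) _ =>
      (HasFDerivAt.finsetProd (u := Finset.univ) fun j _ => h (σ j) j).const_mul
        ((Equiv.Perm.sign σ : ℤ) : ℝ)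
    refine this.congr_of_eventuallyEq (Filter.Eventually.of_forall fun u => ?_)
    simp only [Matrix.det_apply']
  refine h1.congr_fderiv ?_
  refine ContinuousLinearMap.ext fun v => ?_
  -- By Cramer's rule each summand of Jacobi's formula is a determinant with one column
  -- differentiated, as in the Leibniz expansion.
  have h2 : ∀ j, ∑ i, (M x).adjugate j i * M' i j v =
      ((M x).updateCol j fun i => M' i j v).det := by
    intro j
    rw [← Matrix.cramer_apply, Matrix.cramer_eq_adjugate_mulVec]
    rfl
  simp only [_root_.sum_apply, _root_.smul_apply, smul_eq_mul, h2, Matrix.det_apply',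
    Finset.mul_sum]
  rw [Finset.sum_comm]
  refine Finset.sum_congr rfl fun j _ => Finset.sum_congr rfl fun σ _ => ?_
  congr 1
  rw [← Finset.prod_erase_mul _ _ (Finset.mem_univ j), Matrix.updateCol_self]
  congr 1
  exact Finset.prod_congr rfl fun k hk => by
    rw [Matrix.updateCol_ne (Finset.ne_of_mem_erase hk)]

theorem adjugate_eq_det_smul {A K : Matrix (Fin n) (Fin n) ℝ} (h : A * K = 1) :
    A.adjugate = A.det • K := by
  calc A.adjugate = A.adjugate * (A * K) := by rw [h, mul_one]
    _ = A.det • K := by rw [← mul_assoc, Matrix.adjugate_mul, Matrix.smul_mul, one_mul]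

/-- The derivative of an inverse matrix. -/
theorem hasFDerivAt_inverse {J K : E → Matrix (Fin n) (Fin n) ℝ}
    {J' K' : Fin n → Fin n → E →L[ℝ] ℝ} {x : E}
    (hJ : ∀ i j, HasFDerivAt (fun u => J u i j) (J' i j) x)
    (hK : ∀ i j, HasFDerivAt (fun u => K u i j) (K' i j) x)
    (h : ∀ᶠ u in 𝓝 x, J u * K u = 1) (v : E) (l k : Fin n) :
    K' l k v = - ∑ a, ∑ b, K x l a * J' a b v * K x b k := by
  have h1 : ∀ a, ∑ b, (J x a b * K' b k v + J' a b v * K x b k) = 0 := by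
    intro a
    have e : (fun u => ∑ b, J u a b * K u b k) =ᶠ[𝓝 x] fun _ => (1 : Matrix (Fin n) (Fin n) ℝ) a k :=
      h.mono fun u hu => by
        change (∑ b, J u a b * K u b k) = _
        rw [← hu, Matrix.mul_apply]
    have h2 := (HasFDerivAt.fun_sum (u := Finset.univ) fun b _ => (hJ a b).mul (hK b k)).fderiv
    have h3 := h2.symm.trans (e.fderiv_eq.trans (hasFDerivAt_const (𝕜 := ℝ) _ x).fderiv)
    have h4 := congrArg (fun A => A v) h3
    simp only [_root_.sum_apply, _root_.add_apply, _root_.smul_apply, smul_eq_mul,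
      _root_.zero_apply] at h4
    rw [← h4]
    exact Finset.sum_congr rfl fun b _ => by ring
  have h5 : K x * J x = 1 := mul_eq_one_comm.1 h.self_of_nhds
  have h6 : ∑ a, K x l a * ∑ b, J x a b * K' b k v = K' l k v := by
    have := congrFun (congrArg (fun A => A.mulVec fun b => K' b k v) h5) l
    rw [← Matrix.mulVec_mulVec, Matrix.one_mulVec] at this
    exact this
  rw [← h6, ← Finset.sum_neg_distrib]
  refine Finset.sum_congr rfl fun a _ => ?_
  have h7 := h1 a
  rw [Finset.sum_add_distrib] at h7
  rw [eq_neg_of_add_eq_zero_left h7, mul_neg, Finset.mul_sum]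
  simp only [mul_assoc]

end DetCalculus

/-- The Piola identity: the rows of the adjugate of a Jacobian matrix are divergence-free. -/
theorem piola {n : ℕ} {G : (Fin n → ℝ) → (Fin n → ℝ)} {K : (Fin n → ℝ) → Matrix (Fin n) (Fin n) ℝ}
    {x : Fin n → ℝ} (hG : ContDiffAt ℝ ∞ G x)
    (hK : ∀ i k, DifferentiableAt ℝ (fun u => K u i k) x)
    (h : ∀ᶠ u in 𝓝 x, jacobian G u * K u = 1) (k : Fin n) :
    ∑ i, fderiv ℝ (fun u => (jacobian G u).det * K u i k) x (Pi.single i 1) = 0 := by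
  have hd : DifferentiableAt ℝ (fderiv ℝ G) x :=
    (hG.fderiv_right (m := ∞) (by simp)).differentiableAt (by simp)
  have hs := hG.isSymmSndFDerivAt (by
    simpa using (WithTop.coe_le_coe.2 le_top : ((2 : ℕ∞) : WithTop ℕ∞) ≤ ((⊤ : ℕ∞) : WithTop ℕ∞)))
  have hJ : ∀ a b, HasFDerivAt (fun u => jacobian G u a b)
      (fderiv ℝ (fun u => jacobian G u a b) x) x := by
    intro a b
    have h1 : DifferentiableAt ℝ (fun u => fderiv ℝ G u (Pi.single b 1)) x :=
      hd.clm_apply (differentiableAt_const _)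
    exact (differentiableAt_pi.1 h1 a).hasFDerivAt
  have hJ' : ∀ a b i, fderiv ℝ (fun u => jacobian G u a b) x (Pi.single i 1) =
      fderiv ℝ (fderiv ℝ G) x (Pi.single i 1) (Pi.single b 1) a := by
    intro a b i
    have h1 : HasFDerivAt (fun u => fderiv ℝ G u (Pi.single b 1)) _ x :=
      hd.hasFDerivAt.clm_apply (hasFDerivAt_const (Pi.single b (1 : ℝ) : Fin n → ℝ) x)
    have h2 := (hasFDerivAt_pi'.1 h1 a).fderiv
    refine (congrArg (fun A => A (Pi.single i (1 : ℝ))) h2).trans ?_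
    simp
  have hsymm : ∀ a b i, fderiv ℝ (fun u => jacobian G u a b) x (Pi.single i 1) =
      fderiv ℝ (fun u => jacobian G u a i) x (Pi.single b 1) := by
    intro a b i
    rw [hJ', hJ', hs]
  have hdet := hasFDerivAt_det hJ
  rw [adjugate_eq_det_smul h.self_of_nhds] at hdet
  -- Jacobi's formula and the derivative of the inverse give two triple sums, which symmetry of
  -- second derivatives identifies after summation over i.
  have hp : ∀ i, fderiv ℝ (fun u => (jacobian G u).det * K u i k) x (Pi.single i 1) =
      (jacobian G x).det * (∑ b, ∑ a, K x b a *
          fderiv ℝ (fun u => jacobian G u a b) x (Pi.single i 1) * K x i k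
        - ∑ b, ∑ a, K x i a * fderiv ℝ (fun u => jacobian G u a b) x (Pi.single i 1) * K x b k) := by
    intro i
    have h1 := (hdet.mul (hK i k).hasFDerivAt).fderiv
    refine (congrArg (fun A => A (Pi.single i (1 : ℝ))) h1).trans ?_
    simp only [_root_.sum_apply, _root_.add_apply, _root_.smul_apply, smul_eq_mul,
      Matrix.smul_apply]
    rw [hasFDerivAt_inverse hJ (fun i j => (hK i j).hasFDerivAt) h (Pi.single i 1) i k,
      Finset.sum_comm (f := fun b a => K x i a * _ * K x b k), mul_neg, neg_add_eq_sub, mul_sub]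
    congr 1
    simp only [Finset.mul_sum]
    exact Finset.sum_congr rfl fun b _ => Finset.sum_congr rfl fun a _ => by ring
  simp only [hp]
  rw [← Finset.mul_sum, Finset.sum_sub_distrib]
  refine mul_eq_zero_of_right _ (sub_eq_zero.2 ?_)
  rw [Finset.sum_comm]
  refine Finset.sum_congr rfl fun b _ => Finset.sum_congr rfl fun i _ => Finset.sum_congr rfl
    fun a _ => ?_
  rw [hsymm]

/-! ### Prolongation of vertical vectors under a jet transition. -/

section Prolongation

variable {n m : ℕ}

/-- The linear part of the formal derivative `formalVec i`. -/
def dformal {r : ℕ} (i : Fin n) : JetModel n m (r + 1) →L[ℝ] JetModel n m r :=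
  (0 : JetModel n m (r + 1) →L[ℝ] (Fin n → ℝ)).prod
    ((ContinuousLinearMap.pi fun J : MultiIdx n r =>
      ContinuousLinearMap.proj (R := ℝ) (φ := fun _ : MultiIdx n (r + 1) => Fin m → ℝ)
        (J.adjoin i)).comp (ContinuousLinearMap.snd ℝ _ _))

@[simp] theorem dformal_fst {r : ℕ} (i : Fin n) (v : JetModel n m (r + 1)) : (dformal i v).1 = 0 :=
  rfl

@[simp] theorem dformal_snd {r : ℕ} (i : Fin n) (v : JetModel n m (r + 1)) (J : MultiIdx n r) :
    (dformal i v).2 J = v.2 (J.adjoin i) := rfl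

theorem hasFDerivAt_formalVec {r : ℕ} (i : Fin n) (z : JetModel n m (r + 1)) :
    HasFDerivAt (formalVec i) (dformal i : JetModel n m (r + 1) →L[ℝ] JetModel n m r) z := by
  have h : (formalVec i : JetModel n m (r + 1) → JetModel n m r) =
      fun z => (Pi.single i 1, 0) + dformal i z := by
    funext z
    refine Prod.ext (by simp) (funext fun J => by simp)
  rw [h]
  exact (dformal i).hasFDerivAt.const_add _

namespace JetTransition

variable (t : JetTransition n m)

theorem isOpen_base {r : ℕ} : IsOpen (base (n := n) (m := m) (r := r) ⁻¹' t.dom) :=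
  t.isOpen_dom.preimage base.continuous

variable {t}

theorem differentiableAt_T {r : ℕ} {w : JetModel n m r} (hw : base w ∈ t.dom) :
    DifferentiableAt ℝ (t.T r) w :=
  differentiableAt_of_contDiffOn t.isOpen_base (t.smooth r) hw

theorem contDiffAt_T {r : ℕ} {w : JetModel n m r} (hw : base w ∈ t.dom) :
    ContDiffAt ℝ ∞ (t.T r) w :=
  (t.smooth r).contDiffAt (t.isOpen_base.mem_nhds hw)

theorem differentiableAt_jacobian {p : (Fin n → ℝ) × (Fin m → ℝ)} (hp : p ∈ t.dom) (k i : Fin n) :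
    DifferentiableAt ℝ (fun u => jacobian t.G u k i) p.1 := by
  have h1 : DifferentiableAt ℝ (fun u => fderiv ℝ t.G u (Pi.single i 1)) p.1 :=
    (((t.contDiffAt_G p hp).fderiv_right (m := ∞) (by simp)).differentiableAt (by simp)).clm_apply
      (differentiableAt_const _)
  exact differentiableAt_pi.1 h1 k

theorem mul_jacobian {p : (Fin n → ℝ) × (Fin m → ℝ)} (hp : p ∈ t.dom) :
    t.K p.1 * jacobian t.G p.1 = 1 := mul_eq_one_comm.1 (t.jacobian_mul p hp)

theorem eventually_jacobian_mul {p : (Fin n → ℝ) × (Fin m → ℝ)} (hp : p ∈ t.dom) :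
    ∀ᶠ u in 𝓝 p.1, jacobian t.G u * t.K u = 1 := by
  have hc : Continuous fun u : Fin n → ℝ => (u, p.2) := by fun_prop
  exact Filter.eventually_of_mem ((t.isOpen_dom.preimage hc).mem_nhds hp) fun u hu =>
    t.jacobian_mul (u, p.2) hu

theorem fderiv_T_fst {r : ℕ} {w : JetModel n m r} (hw : base w ∈ t.dom) (v : JetModel n m r) :
    (fderiv ℝ (t.T r) w v).1 = fderiv ℝ t.G w.1 v.1 := by
  have h1 := (differentiableAt_T hw).hasFDerivAt.fst.fderiv
  have e : (fun w : JetModel n m r => (t.T r w).1) =ᶠ[𝓝 w] fun w => t.G w.1 :=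
    Filter.eventuallyEq_of_mem (t.isOpen_base.mem_nhds hw) fun z hz => t.fst_eq r z hz
  have hG := ((t.contDiffAt_G _ hw).differentiableAt (by simp)).hasFDerivAt
  have h2 := (HasFDerivAt.comp w hG (hasFDerivAt_fst (𝕜 := ℝ) (p := w))).fderiv
  exact congrArg (fun A => A v) (h1.symm.trans (e.fderiv_eq.trans h2))

theorem proj_fderiv_T {r : ℕ} {w : JetModel n m (r + 1)} (hw : base w ∈ t.dom)
    (v : JetModel n m (r + 1)) :
    proj (Nat.le_succ r) (fderiv ℝ (t.T (r + 1)) w v) =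
      fderiv ℝ (t.T r) (proj (Nat.le_succ r) w) (proj (Nat.le_succ r) v) := by
  have h1 := ((proj (n := n) (m := m) (Nat.le_succ r)).hasFDerivAt.comp w
    (differentiableAt_T hw).hasFDerivAt).fderiv
  have e : (fun w : JetModel n m (r + 1) => proj (Nat.le_succ r) (t.T (r + 1) w)) =ᶠ[𝓝 w]
      fun w => t.T r (proj (Nat.le_succ r) w) :=
    Filter.eventuallyEq_of_mem (t.isOpen_base.mem_nhds hw) fun z hz => t.proj_comm r z hz
  have h2 := ((differentiableAt_T (t := t) (w := proj (Nat.le_succ r) w) hw).hasFDerivAt.comp w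
    (proj (n := n) (m := m) (Nat.le_succ r)).hasFDerivAt).fderiv
  exact congrArg (fun A => A v) (h1.symm.trans (e.fderiv_eq.trans h2))

/-- The prolongation formula for vertical vectors. -/
theorem dformal_fderiv_T {r : ℕ} {w : JetModel n m (r + 1)} (hw : base w ∈ t.dom)
    {v : JetModel n m (r + 1)} (hv : v.1 = 0) (i : Fin n) :
    ∑ k, jacobian t.G w.1 k i • dformal k (fderiv ℝ (t.T (r + 1)) w v) =
      fderiv ℝ (fun x => fderiv ℝ (t.T r) x (proj (Nat.le_succ r) v)) (proj (Nat.le_succ r) w)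
        (formalVec i w) + fderiv ℝ (t.T r) (proj (Nat.le_succ r) w) (dformal i v) := by
  have hw' : base (proj (Nat.le_succ r) w) ∈ t.dom := hw
  have hd : DifferentiableAt ℝ (fderiv ℝ (t.T r)) (proj (Nat.le_succ r) w) :=
    ((contDiffAt_T hw').fderiv_right (m := ∞) (by simp)).differentiableAt (by simp)
  have hs := (contDiffAt_T hw').isSymmSndFDerivAt (by
    simpa using (WithTop.coe_le_coe.2 le_top : ((2 : ℕ∞) : WithTop ℕ∞) ≤ ((⊤ : ℕ∞) : WithTop ℕ∞)))
  have h1 := ((hd.hasFDerivAt.comp w (proj (n := n) (m := m) (Nat.le_succ r)).hasFDerivAt).clm_apply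
    (hasFDerivAt_formalVec i w)).fderiv
  have h2 := (HasFDerivAt.fun_sum (u := Finset.univ) fun k _ => HasFDerivAt.fun_smul
    (HasFDerivAt.comp w (differentiableAt_jacobian hw k i).hasFDerivAt
      (hasFDerivAt_fst (𝕜 := ℝ) (p := w)))
    ((hasFDerivAt_formalVec k (t.T (r + 1) w)).comp w (differentiableAt_T hw).hasFDerivAt)).fderiv
  -- The law for formal derivatives holds near w, so it may be differentiated in the direction v; a
  -- vertical v does not see the Jacobian.
  have e : (fun w : JetModel n m (r + 1) => fderiv ℝ (t.T r) (proj (Nat.le_succ r) w) (formalVec i w))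
      =ᶠ[𝓝 w] fun w => ∑ k, jacobian t.G w.1 k i • formalVec k (t.T (r + 1) w) :=
    Filter.eventuallyEq_of_mem (t.isOpen_base.mem_nhds hw) fun z hz => t.formal r i z hz
  have key := congrArg (fun A => A v) (h1.symm.trans (e.fderiv_eq.trans h2))
  have h3 : fderiv ℝ (fun x => fderiv ℝ (t.T r) x (proj (Nat.le_succ r) v)) (proj (Nat.le_succ r) w)
      (formalVec i w) = fderiv ℝ (fderiv ℝ (t.T r)) (proj (Nat.le_succ r) w)
        (proj (Nat.le_succ r) v) (formalVec i w) := by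
    rw [fderiv_clm_apply hd (differentiableAt_const _)]
    rw [hs (proj (Nat.le_succ r) v)]
    simp only [_root_.add_apply, ContinuousLinearMap.comp_apply, ContinuousLinearMap.flip_apply,
      fderiv_fun_const, Pi.zero_apply, _root_.zero_apply, map_zero, zero_add]
  rw [h3]
  simp [hv] at key
  rw [← key, add_comm]

theorem dformal_fderiv_T' {r : ℕ} {w : JetModel n m (r + 1)} (hw : base w ∈ t.dom)
    {v : JetModel n m (r + 1)} (hv : v.1 = 0) (k : Fin n) :
    dformal k (fderiv ℝ (t.T (r + 1)) w v) = ∑ i, t.K w.1 i k •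
      (fderiv ℝ (fun x => fderiv ℝ (t.T r) x (proj (Nat.le_succ r) v)) (proj (Nat.le_succ r) w)
        (formalVec i w) + fderiv ℝ (t.T r) (proj (Nat.le_succ r) w) (dformal i v)) := by
  simp only [← dformal_fderiv_T hw hv, Finset.smul_sum, smul_smul]
  rw [Finset.sum_comm]
  have h1 : ∀ l, ∑ i, t.K w.1 i k * jacobian t.G w.1 l i = if l = k then 1 else 0 := by
    intro l
    rw [← Matrix.one_apply, ← t.jacobian_mul _ hw, Matrix.mul_apply]
    exact Finset.sum_congr rfl fun _ _ => mul_comm _ _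
  simp only [← Finset.sum_smul, h1]
  simp

end JetTransition

end Prolongation

end JetVar

namespace JetVar

/-! ### The derivative of the transition maps of orders 0, 1, 2 on vertical vectors. -/

namespace JetTransition

variable {n m : ℕ} {t : JetTransition n m}

theorem fderiv_snd_apply {r s : ℕ} {f : JetModel n m r → JetModel n m s} {x : JetModel n m r}
    (hf : DifferentiableAt ℝ f x) (J : MultiIdx n s) (σ : Fin m) (u : JetModel n m r) :
    (fderiv ℝ f x u).2 J σ = fderiv ℝ (fun x => (f x).2 J σ) x u :=
  (congrArg (fun A => A u) ((dy J σ).hasFDerivAt.comp x hf.hasFDerivAt).fderiv).symm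

variable (t) in
/-- The derivative `∂ȳ^σ/∂y^ν` of the transition map. -/
def fiberJacobian (σ ν : Fin m) (x : JetModel n m 0) : ℝ :=
  (fderiv ℝ (t.T 0) x (ddy idx0 ν)).2 idx0 σ

variable (t) in
/-- The derivative `∂ȳ^σ_l/∂y^ν_p` of the transition map. -/
def velocityJacobian (p l : Fin n) (σ ν : Fin m) (x : JetModel n m 1) : ℝ :=
  t.K x.1 p l * t.fiberJacobian σ ν (proj (Nat.zero_le 1) x)

theorem contDiffOn_fiberJacobian (σ ν : Fin m) :
    ContDiffOn ℝ ∞ (t.fiberJacobian σ ν) (base ⁻¹' t.dom) :=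
  (dy idx0 σ).contDiff.comp_contDiffOn (contDiffOn_fderiv_apply t.isOpen_base (t.smooth 0) _)

theorem contDiffOn_velocityJacobian (p l : Fin n) (σ ν : Fin m) :
    ContDiffOn ℝ ∞ (t.velocityJacobian p l σ ν) (base ⁻¹' t.dom) := by
  refine ContDiffOn.mul (fun z hz => ?_)
    (contDiffOn_comp_proj (Nat.zero_le 1) (contDiffOn_fiberJacobian σ ν))
  exact ((t.contDiffAt_K _ hz p l).comp z contDiffAt_fst).contDiffWithinAt

theorem fderiv_T_zero {x : JetModel n m 0} {u : JetModel n m 0} (hu : u.1 = 0) (σ : Fin m) :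
    (fderiv ℝ (t.T 0) x u).2 idx0 σ = ∑ ν, t.fiberJacobian σ ν x * u.2 idx0 ν := by
  have h : u = ∑ ν, u.2 idx0 ν • ddy idx0 ν := by
    refine Prod.ext (by simp [Prod.fst_sum, hu]) (funext fun J => funext fun τ => ?_)
    rw [MultiIdx.eq_idx0 J]
    simp [Prod.snd_sum, ddy_snd]
  conv_lhs => rw [h]
  simp [Prod.snd_sum, fiberJacobian, mul_comm]

theorem fderiv_T_one_idx0 {w v : JetModel n m 1} (hw : base w ∈ t.dom) (hv : v.1 = 0) (σ : Fin m) :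
    (fderiv ℝ (t.T 1) w v).2 idx0 σ =
      ∑ ν, t.fiberJacobian σ ν (proj (Nat.zero_le 1) w) * v.2 idx0 ν := by
  have h := congrArg (fun y : JetModel n m 0 => y.2 idx0 σ) (proj_fderiv_T hw v)
  refine h.trans ?_
  rw [fderiv_T_zero (by exact hv)]
  rfl

theorem differentiableAt_fderiv_T {r : ℕ} {x : JetModel n m r} (hx : base x ∈ t.dom)
    (u : JetModel n m r) : DifferentiableAt ℝ (fun x => fderiv ℝ (t.T r) x u) x :=
  differentiableAt_of_contDiffOn t.isOpen_base
    (contDiffOn_fderiv_apply t.isOpen_base (t.smooth r) u) hx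

/-- The terms d_i(∂ȳ^σ/∂y^ν) are the inhomogeneous part that later reappears in the momenta. -/
theorem fderiv_T_one_idx1 {w v : JetModel n m 1} (hw : base w ∈ t.dom) (hv : v.1 = 0) (k : Fin n)
    (σ : Fin m) : (fderiv ℝ (t.T 1) w v).2 (idx1 k) σ =
      ∑ i, t.K w.1 i k * ∑ ν, (formalDeriv i (t.fiberJacobian σ ν) w * v.2 idx0 ν
        + t.fiberJacobian σ ν (proj (Nat.zero_le 1) w) * v.2 (idx1 i) ν) := by
  have h := congrArg (fun y : JetModel n m 0 => y.2 idx0 σ) (dformal_fderiv_T' hw hv k)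
  refine h.trans ?_
  simp only [Prod.snd_sum, Finset.sum_apply, Prod.smul_snd, Pi.smul_apply, Prod.snd_add,
    Pi.add_apply, smul_eq_mul]
  refine Finset.sum_congr rfl fun i _ => ?_
  rw [fderiv_T_zero (dformal_fst i v), Finset.sum_add_distrib]
  congr 2
  have hw' : base (proj (Nat.le_succ 0) w) ∈ t.dom := hw
  rw [fderiv_snd_apply (differentiableAt_fderiv_T hw' _)]
  have hv' : (proj (Nat.le_succ 0) v).1 = 0 := hv
  simp only [fderiv_T_zero hv']
  have hd : ∀ ν, HasFDerivAt (t.fiberJacobian σ ν)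
      (fderiv ℝ (t.fiberJacobian σ ν) (proj (Nat.le_succ 0) w)) (proj (Nat.le_succ 0) w) := fun ν =>
    (differentiableAt_of_contDiffOn t.isOpen_base (contDiffOn_fiberJacobian σ ν) hw').hasFDerivAt
  have hs := (HasFDerivAt.fun_sum (u := Finset.univ) fun ν _ =>
    (hd ν).mul_const ((proj (Nat.le_succ 0) v).2 idx0 ν)).fderiv
  refine (congrArg (fun A => A (formalVec i w)) hs).trans ?_
  simp only [_root_.sum_apply, _root_.smul_apply, smul_eq_mul]
  exact Finset.sum_congr rfl fun ν _ => mul_comm _ _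

theorem fderiv_T_two_idx1 {w v : JetModel n m 2} (hw : base w ∈ t.dom) (J : MultiIdx n 1)
    (σ : Fin m) : (fderiv ℝ (t.T 2) w v).2 (J.incl (by norm_num)) σ =
      (fderiv ℝ (t.T 1) (proj (by norm_num) w) (proj (by norm_num) v)).2 J σ :=
  congrArg (fun y : JetModel n m 1 => y.2 J σ) (proj_fderiv_T hw v)

/-- Prolonging once more. Vanishing y^σ-components of v keep second formal derivatives of ∂ȳ^σ/∂y^ν
out of the formula; the basis vectors needed later satisfy this. -/
theorem fderiv_T_two_idx2 {w v : JetModel n m 2} (hw : base w ∈ t.dom) (hv : v.1 = 0)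
    (hv0 : ∀ ν, v.2 idx0 ν = 0) (k l : Fin n) (σ : Fin m) :
    (fderiv ℝ (t.T 2) w v).2 (idx2 k l) σ =
      ∑ i, t.K w.1 i k * (∑ p, ∑ ν,
          formalDeriv i (t.velocityJacobian p l σ ν) w * v.2 (idx1 p) ν
        + ∑ p, t.K w.1 p l * ∑ ν,
          (formalDeriv p (t.fiberJacobian σ ν) (proj (by norm_num) w) * v.2 (idx1 i) ν
            + t.fiberJacobian σ ν (proj (by norm_num) w) * v.2 (idx2 i p) ν)) := by
  have h := congrArg (fun y : JetModel n m 1 => y.2 (idx1 l) σ) (dformal_fderiv_T' hw hv k)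
  refine h.trans ?_
  simp only [Prod.snd_sum, Finset.sum_apply, Prod.smul_snd, Pi.smul_apply, Prod.snd_add,
    Pi.add_apply, smul_eq_mul]
  have hw' : base (proj (Nat.le_succ 1) w) ∈ t.dom := hw
  refine Finset.sum_congr rfl fun i _ => ?_
  rw [fderiv_T_one_idx1 hw' (dformal_fst i v)]
  congr 2
  rw [fderiv_snd_apply (differentiableAt_fderiv_T hw' _)]
  have hv' : (proj (Nat.le_succ 1) v).1 = 0 := hv
  have e : (fun x => (fderiv ℝ (t.T 1) x (proj (Nat.le_succ 1) v)).2 (idx1 l) σ)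
      =ᶠ[𝓝 (proj (Nat.le_succ 1) w)] fun x => ∑ p, ∑ ν,
        t.velocityJacobian p l σ ν x * v.2 (idx1 p) ν := by
    refine Filter.eventuallyEq_of_mem (t.isOpen_base.mem_nhds hw') fun x hx => ?_
    rw [fderiv_T_one_idx1 hx hv']
    refine Finset.sum_congr rfl fun p _ => ?_
    rw [Finset.mul_sum]
    refine Finset.sum_congr rfl fun ν _ => ?_
    have h0 : (proj (Nat.le_succ 1) v).2 idx0 ν = 0 := hv0 ν
    rw [h0, mul_zero, zero_add, velocityJacobian, mul_assoc]
    rfl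
  rw [e.fderiv_eq]
  have hd : ∀ p ν, HasFDerivAt (t.velocityJacobian p l σ ν)
      (fderiv ℝ (t.velocityJacobian p l σ ν) (proj (Nat.le_succ 1) w)) (proj (Nat.le_succ 1) w) :=
    fun p ν => (differentiableAt_of_contDiffOn t.isOpen_base
      (contDiffOn_velocityJacobian p l σ ν) hw').hasFDerivAt
  have hs := (HasFDerivAt.fun_sum (u := Finset.univ) fun p _ =>
    HasFDerivAt.fun_sum (u := Finset.univ) fun ν _ => (hd p ν).mul_const (v.2 (idx1 p) ν)).fderiv
  refine (congrArg (fun A => A (formalVec i w)) hs).trans ?_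
  simp only [_root_.sum_apply, _root_.smul_apply, smul_eq_mul]
  exact Finset.sum_congr rfl fun p _ => Finset.sum_congr rfl fun ν _ => mul_comm _ _

/-! ### Transformation of the derivatives of the Lagrange function. -/

section Lagrangian

variable {L Lb : JetModel n m 2 → ℝ}

/-- The Jacobian determinant depends on x alone, so a vertical derivative does not touch it. -/
theorem fderiv_lagrangian
    (hL : ∀ w, base w ∈ t.dom → L w = (jacobian t.G w.1).det * Lb (t.T 2 w))
    (hLb : ∀ w, base w ∈ t.dom → ContDiffAt ℝ ∞ Lb (t.T 2 w))
    {w v : JetModel n m 2} (hw : base w ∈ t.dom) (hv : v.1 = 0) :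
    fderiv ℝ L w v = (jacobian t.G w.1).det * fderiv ℝ Lb (t.T 2 w) (fderiv ℝ (t.T 2) w v) := by
  have e : L =ᶠ[𝓝 w] fun w => (jacobian t.G w.1).det * Lb (t.T 2 w) :=
    Filter.eventuallyEq_of_mem (t.isOpen_base.mem_nhds hw) fun z hz => hL z hz
  have h1 := hasFDerivAt_det fun i j => (differentiableAt_jacobian hw i j).hasFDerivAt
  have h2 := ((h1.comp w (hasFDerivAt_fst (𝕜 := ℝ) (p := w))).mul
    (((hLb w hw).differentiableAt (by simp)).hasFDerivAt.comp w
      (differentiableAt_T hw).hasFDerivAt)).fderiv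
  rw [e.fderiv_eq]
  refine (congrArg (fun A => A v) h2).trans ?_
  simp [hv]

/-- The weighted coordinate vector has only second-order components, so the image has only
second-order components and the law is tensorial. -/
theorem partial2_transform
    (hL : ∀ w, base w ∈ t.dom → L w = (jacobian t.G w.1).det * Lb (t.T 2 w))
    (hLb : ∀ w, base w ∈ t.dom → ContDiffAt ℝ ∞ Lb (t.T 2 w))
    {w : JetModel n m 2} (hw : base w ∈ t.dom) (ν : Fin m) (p q : Fin n) :
    partial2 L ν p q w = ∑ σ, ∑ k, ∑ l, (jacobian t.G w.1).det * t.K w.1 p k *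
      partial2 Lb σ k l (t.T 2 w) * t.velocityJacobian q l σ ν (proj (by norm_num) w) := by
  set v : JetModel n m 2 := (if p = q then (1 : ℝ) else 1 / 2) • ddy (idx2 p q) ν with hv
  have hv1 : v.1 = 0 := by rw [hv, Prod.smul_fst, ddy_fst, smul_zero]
  have hv0 : ∀ μ, v.2 idx0 μ = 0 := fun μ => by
    simp only [hv, Prod.smul_snd, Pi.smul_apply, ddy_snd, if_neg (idx2_ne_idx0 _ _).symm, smul_zero]
  have hvi : ∀ i μ, v.2 (idx1 i) μ = 0 := fun i μ => by
    simp only [hv, Prod.smul_snd, Pi.smul_apply, ddy_snd, if_neg (idx2_ne_idx1 _ _ _).symm, smul_zero]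
  have hvij : ∀ i j μ, v.2 (idx2 i j) μ = (if μ = ν then 1 else 0) * (1 / 2 *
      ((if i = p then 1 else 0) * (if j = q then 1 else 0)
        + (if i = q then 1 else 0) * (if j = p then 1 else 0))) := fun i j μ => by
    rw [← weight_eq]
    simp only [hv, Prod.smul_snd, Pi.smul_apply, ddy_snd, smul_eq_mul]
    split_ifs <;> simp
  have h1 : partial2 L ν p q w = fderiv ℝ L w v := by
    rw [hv, map_smul]; rfl
  have hw' : base (proj (n := n) (m := m) (r := 2) (s := 1) (by norm_num) w) ∈ t.dom := hw
  have hT0 : (fderiv ℝ (t.T 2) w v).1 = 0 := by rw [fderiv_T_fst hw, hv1, map_zero]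
  have hTi0 : ∀ σ, (fderiv ℝ (t.T 2) w v).2 idx0 σ = 0 := fun σ => by
    refine (fderiv_T_two_idx1 hw idx0 σ).trans ?_
    rw [fderiv_T_one_idx0 hw' hv1]
    exact Finset.sum_eq_zero fun μ _ => mul_eq_zero_of_right _ (hv0 μ)
  have hTi1 : ∀ k σ, (fderiv ℝ (t.T 2) w v).2 (idx1 k) σ = 0 := fun k σ => by
    refine (fderiv_T_two_idx1 hw (idx1 k) σ).trans ?_
    rw [fderiv_T_one_idx1 hw' hv1]
    refine Finset.sum_eq_zero fun i _ => ?_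
    refine mul_eq_zero_of_right _ (Finset.sum_eq_zero fun μ _ => ?_)
    exact (congrArg₂ (· + ·) (mul_eq_zero_of_right _ (hv0 μ))
      (mul_eq_zero_of_right _ (hvi i μ))).trans (add_zero 0)
  have hTi2 : ∀ k l σ, (fderiv ℝ (t.T 2) w v).2 (idx2 k l) σ =
      1 / 2 * (t.K w.1 p k * t.velocityJacobian q l σ ν (proj (by norm_num) w)
        + t.K w.1 q k * t.velocityJacobian p l σ ν (proj (by norm_num) w)) := by
    intro k l σ
    rw [fderiv_T_two_idx2 hw hv1 hv0]
    simp only [hvi, hvij, mul_zero, Finset.sum_const_zero, zero_add, velocityJacobian, proj_fst]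
    simp only [ite_mul, one_mul, zero_mul, mul_ite, mul_zero, Finset.sum_ite_eq', Finset.mem_univ,
      if_true, mul_add, mul_one, Finset.sum_add_distrib, Finset.sum_ite_irrel,
      Finset.sum_const_zero, proj_proj]
    ring
  rw [h1, fderiv_lagrangian hL hLb hw hv1, fderiv_vertical _ _ _ hT0, Finset.mul_sum]
  refine Finset.sum_congr rfl fun σ _ => ?_
  simp only [hTi0, hTi1, hTi2, mul_zero, Finset.sum_const_zero, zero_add]
  -- The image vector is symmetrized in p and q; contraction with the symmetric array makes both
  -- halves equal.
  have hsplit : ∑ k, ∑ l, partial2 Lb σ k l (t.T 2 w) *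
        (1 / 2 * (t.K w.1 p k * t.velocityJacobian q l σ ν (proj (by norm_num) w)
        + t.K w.1 q k * t.velocityJacobian p l σ ν (proj (by norm_num) w))) =
      ∑ k, ∑ l, t.K w.1 p k * partial2 Lb σ k l (t.T 2 w) *
        t.velocityJacobian q l σ ν (proj (by norm_num) w) := by
    have hA : ∑ k, ∑ l, partial2 Lb σ k l (t.T 2 w) *
          (t.K w.1 q k * t.velocityJacobian p l σ ν (proj (by norm_num) w)) =
        ∑ k, ∑ l, partial2 Lb σ k l (t.T 2 w) *
          (t.K w.1 p k * t.velocityJacobian q l σ ν (proj (by norm_num) w)) := by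
      rw [Finset.sum_comm]
      refine Finset.sum_congr rfl fun k _ => Finset.sum_congr rfl fun l _ => ?_
      rw [partial2_comm]
      simp only [velocityJacobian, proj_fst]
      ring
    have hB : ∀ k l, partial2 Lb σ k l (t.T 2 w) *
        (1 / 2 * (t.K w.1 p k * t.velocityJacobian q l σ ν (proj (by norm_num) w)
        + t.K w.1 q k * t.velocityJacobian p l σ ν (proj (by norm_num) w))) =
        1 / 2 * (partial2 Lb σ k l (t.T 2 w) *
          (t.K w.1 p k * t.velocityJacobian q l σ ν (proj (by norm_num) w))) +
        1 / 2 * (partial2 Lb σ k l (t.T 2 w) *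
          (t.K w.1 q k * t.velocityJacobian p l σ ν (proj (by norm_num) w))) := fun k l => by ring
    simp only [hB, Finset.sum_add_distrib, ← Finset.mul_sum, hA]
    rw [← add_mul]
    norm_num
    exact Finset.sum_congr rfl fun k _ => Finset.sum_congr rfl fun l _ => by ring
  rw [hsplit, Finset.mul_sum]
  refine Finset.sum_congr rfl fun k _ => ?_
  rw [Finset.mul_sum]
  exact Finset.sum_congr rfl fun l _ => by ring

/-- The image of ∂/∂y^ν_q also has second-order components, which produce the two terms with formal
derivatives. -/
theorem partial1_transform
    (hL : ∀ w, base w ∈ t.dom → L w = (jacobian t.G w.1).det * Lb (t.T 2 w))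
    (hLb : ∀ w, base w ∈ t.dom → ContDiffAt ℝ ∞ Lb (t.T 2 w))
    {w : JetModel n m 2} (hw : base w ∈ t.dom) (ν : Fin m) (q : Fin n) :
    partial1 L ν q w = (jacobian t.G w.1).det * ∑ σ,
      (∑ k, partial1 Lb σ k (t.T 2 w) * t.velocityJacobian q k σ ν (proj (by norm_num) w)
        + ∑ k, ∑ l, partial2 Lb σ k l (t.T 2 w) *
          (∑ i, t.K w.1 i k * formalDeriv i (t.velocityJacobian q l σ ν) w
            + t.K w.1 q k * ∑ p, t.K w.1 p l *
              formalDeriv p (t.fiberJacobian σ ν) (proj (by norm_num) w))) := by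
  set v : JetModel n m 2 := ddy (idx1 q) ν with hv
  have hv1 : v.1 = 0 := rfl
  have hv0 : ∀ μ, v.2 idx0 μ = 0 := fun μ => by
    simp only [hv, ddy_snd, if_neg (idx1_ne_idx0 _).symm]
  have hvi : ∀ i μ, v.2 (idx1 i) μ = if i = q then (if μ = ν then 1 else 0) else 0 := fun i μ => by
    simp only [hv, ddy_snd, idx1_inj]
  have hvij : ∀ i j μ, v.2 (idx2 i j) μ = 0 := fun i j μ => by
    simp only [hv, ddy_snd, if_neg (idx2_ne_idx1 _ _ _)]
  have hw' : base (proj (n := n) (m := m) (r := 2) (s := 1) (by norm_num) w) ∈ t.dom := hw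
  have hT0 : (fderiv ℝ (t.T 2) w v).1 = 0 := by rw [fderiv_T_fst hw, hv1, map_zero]
  have hTi0 : ∀ σ, (fderiv ℝ (t.T 2) w v).2 idx0 σ = 0 := fun σ => by
    refine (fderiv_T_two_idx1 hw idx0 σ).trans ?_
    rw [fderiv_T_one_idx0 hw' hv1]
    exact Finset.sum_eq_zero fun μ _ => mul_eq_zero_of_right _ (hv0 μ)
  have hTi1 : ∀ k σ, (fderiv ℝ (t.T 2) w v).2 (idx1 k) σ =
      t.velocityJacobian q k σ ν (proj (by norm_num) w) := fun k σ => by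
    refine (fderiv_T_two_idx1 hw (idx1 k) σ).trans ?_
    rw [fderiv_T_one_idx1 hw' hv1]
    have h0 : ∀ μ, (proj (n := n) (m := m) (r := 2) (s := 1) (by norm_num) v).2 idx0 μ = 0 := hv0
    have h1 : ∀ i μ, (proj (n := n) (m := m) (r := 2) (s := 1) (by norm_num) v).2 (idx1 i) μ =
      if i = q then (if μ = ν then 1 else 0) else 0 := hvi
    simp only [h0, h1, mul_zero, zero_add, velocityJacobian]
    simp
  have hTi2 : ∀ k l σ, (fderiv ℝ (t.T 2) w v).2 (idx2 k l) σ =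
      ∑ i, t.K w.1 i k * formalDeriv i (t.velocityJacobian q l σ ν) w
        + t.K w.1 q k * ∑ p, t.K w.1 p l *
          formalDeriv p (t.fiberJacobian σ ν) (proj (by norm_num) w) := by
    intro k l σ
    rw [fderiv_T_two_idx2 hw hv1 hv0]
    simp only [hvi, hvij, mul_zero, add_zero, mul_add, Finset.sum_add_distrib]
    congr 1
    · simp
    · simp only [mul_ite, mul_one, mul_zero, Finset.sum_ite_irrel, Finset.sum_ite_eq',
        Finset.mem_univ, if_true, Finset.sum_const_zero]
  change fderiv ℝ L w v = _
  rw [fderiv_lagrangian hL hLb hw hv1, fderiv_vertical _ _ _ hT0]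
  simp only [hTi0, hTi1, hTi2, mul_zero, zero_add]

end Lagrangian

end JetTransition

end JetVar

namespace JetVar

/-! ### Transformation of the momenta and of the factors. -/

namespace JetTransition

variable {n m : ℕ} {t : JetTransition n m} {L Lb : JetModel n m 2 → ℝ}

theorem differentiableAt_partial2 {y : JetModel n m 2} (h : ContDiffAt ℝ ∞ Lb y) (σ : Fin m)
    (k l : Fin n) : DifferentiableAt ℝ (partial2 Lb σ k l) y :=
  (((h.fderiv_right (m := ∞) (by simp)).differentiableAt (by simp)).clm_apply
    (differentiableAt_const _)).const_mul _

theorem formalDeriv_partial2_transform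
    (hL : ∀ w, base w ∈ t.dom → L w = (jacobian t.G w.1).det * Lb (t.T 2 w))
    (hLb : ∀ w, base w ∈ t.dom → ContDiffAt ℝ ∞ Lb (t.T 2 w))
    {z : JetModel n m 3} (hz : base z ∈ t.dom) (ν : Fin m) (i q : Fin n) :
    formalDeriv i (partial2 L ν i q) z = ∑ σ, ∑ k, ∑ l,
      ((jacobian t.G z.1).det * t.K z.1 i k * partial2 Lb σ k l (proj (Nat.le_succ 2) (t.T 3 z)) *
          formalDeriv i (t.velocityJacobian q l σ ν) (proj (by norm_num) z)
        + t.velocityJacobian q l σ ν (proj (by norm_num) z) * ((jacobian t.G z.1).det * t.K z.1 i k *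
            ∑ r, jacobian t.G z.1 r i * formalDeriv r (partial2 Lb σ k l) (t.T 3 z)
          + partial2 Lb σ k l (proj (Nat.le_succ 2) (t.T 3 z)) *
            fderiv ℝ (fun u => (jacobian t.G u).det * t.K u i k) z.1 (Pi.single i 1))) := by
  have hw : base (proj (n := n) (m := m) (Nat.le_succ 2) z) ∈ t.dom := hz
  have e : partial2 L ν i q =ᶠ[𝓝 (proj (Nat.le_succ 2) z)] fun w => ∑ σ, ∑ k, ∑ l,
      (jacobian t.G w.1).det * t.K w.1 i k * partial2 Lb σ k l (t.T 2 w) *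
        t.velocityJacobian q l σ ν (proj (by norm_num) w) :=
    Filter.eventuallyEq_of_mem (t.isOpen_base.mem_nhds hw) fun w hw =>
      partial2_transform hL hLb hw ν i q
  have h1 : ∀ k, HasFDerivAt (fun w : JetModel n m 2 => (jacobian t.G w.1).det * t.K w.1 i k) _
      (proj (Nat.le_succ 2) z) := fun k =>
    HasFDerivAt.comp (proj (Nat.le_succ 2) z) (g := fun u => (jacobian t.G u).det * t.K u i k)
      (DifferentiableAt.hasFDerivAt ((hasFDerivAt_det fun i j =>
        (differentiableAt_jacobian hz i j).hasFDerivAt).differentiableAt.mul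
          ((t.contDiffAt_K _ hz i k).differentiableAt (by simp))))
      (hasFDerivAt_fst (𝕜 := ℝ))
  have h2 : ∀ σ k l, HasFDerivAt (fun w => partial2 Lb σ k l (t.T 2 w)) _
      (proj (Nat.le_succ 2) z) := fun σ k l =>
    (differentiableAt_partial2 (hLb _ hw) σ k l).hasFDerivAt.comp _
      (differentiableAt_T hw).hasFDerivAt
  have h3 : ∀ σ l, HasFDerivAt (fun w : JetModel n m 2 =>
      t.velocityJacobian q l σ ν (proj (by norm_num) w)) _ (proj (Nat.le_succ 2) z) := fun σ l =>
    hasFDerivAt_comp_proj (by norm_num) (differentiableAt_of_contDiffOn t.isOpen_base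
      (contDiffOn_velocityJacobian q l σ ν) hw)
  have hs := (HasFDerivAt.fun_sum (u := Finset.univ) fun σ _ =>
    HasFDerivAt.fun_sum (u := Finset.univ) fun k _ => HasFDerivAt.fun_sum (u := Finset.univ)
      fun l _ => ((h1 k).mul (h2 σ k l)).mul (h3 σ l)).fderiv
  change fderiv ℝ (partial2 L ν i q) (proj (Nat.le_succ 2) z) (formalVec i z) = _
  rw [e.fderiv_eq]
  refine (congrArg (fun A => A (formalVec i z)) hs).trans ?_
  simp only [_root_.sum_apply, _root_.smul_apply, _root_.add_apply, smul_eq_mul,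
    ContinuousLinearMap.comp_apply, t.formal 2 i z hz, map_sum, map_smul, Pi.mul_apply]
  simp only [← t.proj_comm 2 z hz]
  rfl

theorem sum_K_mul_jacobian {p : (Fin n → ℝ) × (Fin m → ℝ)} (hp : p ∈ t.dom) (k : Fin n)
    (d : Fin n → ℝ) : ∑ i, t.K p.1 i k * ∑ r, jacobian t.G p.1 r i * d r = d k := by
  have h1 : ∀ r, ∑ i, t.K p.1 i k * jacobian t.G p.1 r i = if r = k then 1 else 0 := by
    intro r
    rw [← Matrix.one_apply, ← t.jacobian_mul _ hp, Matrix.mul_apply]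
    exact Finset.sum_congr rfl fun _ _ => mul_comm _ _
  simp only [Finset.mul_sum, ← mul_assoc]
  rw [Finset.sum_comm]
  simp only [← Finset.sum_mul, h1]
  simp

/-- Summed over i, the derivatives of det J · K vanish by the Piola identity, and K J = 1 collapses
the transformed formal derivatives. -/
theorem sum_formalDeriv_partial2_transform
    (hL : ∀ w, base w ∈ t.dom → L w = (jacobian t.G w.1).det * Lb (t.T 2 w))
    (hLb : ∀ w, base w ∈ t.dom → ContDiffAt ℝ ∞ Lb (t.T 2 w))
    {z : JetModel n m 3} (hz : base z ∈ t.dom) (ν : Fin m) (q : Fin n) :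
    ∑ i, formalDeriv i (partial2 L ν i q) z = (jacobian t.G z.1).det * ∑ σ, ∑ k, ∑ l,
      (partial2 Lb σ k l (proj (Nat.le_succ 2) (t.T 3 z)) *
          ∑ i, t.K z.1 i k * formalDeriv i (t.velocityJacobian q l σ ν) (proj (by norm_num) z)
        + formalDeriv k (partial2 Lb σ k l) (t.T 3 z) *
          t.velocityJacobian q l σ ν (proj (by norm_num) z)) := by
  simp only [formalDeriv_partial2_transform hL hLb hz]
  rw [Finset.sum_comm, Finset.mul_sum]
  refine Finset.sum_congr rfl fun σ _ => ?_
  rw [Finset.sum_comm, Finset.mul_sum]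
  refine Finset.sum_congr rfl fun k _ => ?_
  rw [Finset.sum_comm, Finset.mul_sum]
  refine Finset.sum_congr rfl fun l _ => ?_
  have hp := piola (t.contDiffAt_G _ hz)
    (fun i k => (t.contDiffAt_K _ hz i k).differentiableAt (by simp))
    (eventually_jacobian_mul hz) k
  have hd := sum_K_mul_jacobian hz k fun r => formalDeriv r (partial2 Lb σ k l) (t.T 3 z)
  rw [base_apply] at hp hd
  rw [← hd]
  simp only [mul_add, Finset.sum_add_distrib]
  have h0 : ∑ i, t.velocityJacobian q l σ ν (proj (by norm_num) z) *
      (partial2 Lb σ k l (proj (Nat.le_succ 2) (t.T 3 z)) *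
        fderiv ℝ (fun u => (jacobian t.G u).det * t.K u i k) z.1 (Pi.single i 1)) = 0 := by
    rw [← Finset.mul_sum, ← Finset.mul_sum, hp, mul_zero, mul_zero]
  rw [h0, add_zero]
  congr 1
  · rw [Finset.mul_sum, Finset.mul_sum]
    exact Finset.sum_congr rfl fun i _ => by ring
  · rw [Finset.sum_mul, Finset.mul_sum]
    exact Finset.sum_congr rfl fun i _ => by ring

/-- The derivatives of `velocityJacobian` cancel between the two parts of the momentum; only the
term with d_p(∂ȳ^σ/∂y^ν) remains. -/
theorem momentum_transform
    (hL : ∀ w, base w ∈ t.dom → L w = (jacobian t.G w.1).det * Lb (t.T 2 w))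
    (hLb : ∀ w, base w ∈ t.dom → ContDiffAt ℝ ∞ Lb (t.T 2 w))
    {z : JetModel n m 3} (hz : base z ∈ t.dom) (ν : Fin m) (q : Fin n) :
    momentum L ν q z = (jacobian t.G z.1).det * ∑ σ,
      (∑ k, momentum Lb σ k (t.T 3 z) * t.velocityJacobian q k σ ν (proj (by norm_num) z)
        + ∑ k, ∑ l, partial2 Lb σ k l (proj (Nat.le_succ 2) (t.T 3 z)) *
            (t.K z.1 q k * ∑ p, t.K z.1 p l *
              formalDeriv p (t.fiberJacobian σ ν) (proj (by norm_num) z))) := by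
  have hw : base (proj (n := n) (m := m) (Nat.le_succ 2) z) ∈ t.dom := hz
  have h1 := partial1_transform hL hLb hw ν q
  rw [← t.proj_comm 2 z hz] at h1
  change partial1 L ν q (proj (Nat.le_succ 2) z) - _ = _
  rw [h1, sum_formalDeriv_partial2_transform hL hLb hz]
  rw [proj_fst, ← mul_sub, ← Finset.sum_sub_distrib]
  congr 1
  refine Finset.sum_congr rfl fun σ _ => ?_
  have h2 : ∑ k, momentum Lb σ k (t.T 3 z) * t.velocityJacobian q k σ ν (proj (by norm_num) z) =
      ∑ k, partial1 Lb σ k (proj (Nat.le_succ 2) (t.T 3 z)) *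
        t.velocityJacobian q k σ ν (proj (by norm_num) z) -
      ∑ k, ∑ l, formalDeriv k (partial2 Lb σ k l) (t.T 3 z) *
        t.velocityJacobian q l σ ν (proj (by norm_num) z) := by
    rw [Finset.sum_comm (f := fun k l => formalDeriv k (partial2 Lb σ k l) (t.T 3 z) *
      t.velocityJacobian q l σ ν (proj (by norm_num) z)), ← Finset.sum_sub_distrib]
    refine Finset.sum_congr rfl fun k _ => ?_
    rw [← Finset.sum_mul, ← sub_mul]
    rfl
  rw [h2]
  simp only [mul_add, Finset.sum_add_distrib, proj_proj]
  ring

/-- The vertical part of a vector is mapped to the vertical part. -/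
theorem vertical_fderiv_T {r : ℕ} {z : JetModel n m (r + 1)} (hz : base z ∈ t.dom)
    (v : JetModel n m (r + 1)) :
    proj (Nat.le_succ r) (fderiv ℝ (t.T (r + 1)) z v) -
        horVec (t.T (r + 1) z) (fderiv ℝ (t.T (r + 1)) z v) =
      fderiv ℝ (t.T r) (proj (Nat.le_succ r) z) (proj (Nat.le_succ r) v - horVec z v) := by
  rw [map_sub, proj_fderiv_T hz, horVec_apply z, map_sum]
  simp only [map_smul, t.formal r _ z hz]
  congr 1
  have hG : (fderiv ℝ (t.T (r + 1)) z v).1 = fun k => ∑ i, v.1 i * jacobian t.G z.1 k i := by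
    rw [fderiv_T_fst hz]
    funext k
    conv_lhs => rw [show v.1 = ∑ i, v.1 i • (Pi.single i (1 : ℝ) : Fin n → ℝ) by
      ext l; simp [Pi.single_apply]]
    simp [jacobian]
  rw [horVec_apply, hG]
  simp only [Finset.smul_sum, smul_smul, Finset.sum_smul]
  rw [Finset.sum_comm]

/-- The index bookkeeping of the transformation law. Symmetry of P matches the inhomogeneous term of
the momenta with that of the first-order contact forms. -/
theorem sum_transform {n m : ℕ} {K J : Fin n → Fin n → ℝ} {D Lb : ℝ} {B : Fin m → Fin m → ℝ}
    {dB : Fin n → Fin m → Fin m → ℝ} {M : Fin m → Fin n → ℝ} {P : Fin m → Fin n → Fin n → ℝ}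
    (hP : ∀ σ k l, P σ k l = P σ l k) (x : Fin n → ℝ) (a : Fin m → ℝ) (b : Fin n → Fin m → ℝ)
    (q : Fin n) (hx : ∑ j, K q j * ∑ i, J j i * x i = x q) :
    D * Lb * x q
      + ∑ ν, D * (∑ σ, (∑ k, M σ k * (K q k * B σ ν)
          + ∑ k, ∑ l, P σ k l * (K q k * ∑ p, K p l * dB p σ ν))) * a ν
      + ∑ ν, ∑ i, (∑ σ, ∑ k, ∑ l, D * K i k * P σ k l * (K q l * B σ ν)) * b i ν =
    ∑ j, D * K q j * (Lb * ∑ i, J j i * x i + ∑ σ, M σ j * ∑ ν, B σ ν * a ν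
      + ∑ σ, ∑ i, P σ i j * ∑ p, K p i * ∑ ν, (dB p σ ν * a ν + B σ ν * b p ν)) := by
  have h1 : D * Lb * x q = ∑ j, D * K q j * (Lb * ∑ i, J j i * x i) := by
    rw [← hx, Finset.mul_sum]
    exact Finset.sum_congr rfl fun _ _ => by ring
  have h2 : ∑ ν, D * (∑ σ, ∑ k, M σ k * (K q k * B σ ν)) * a ν =
      ∑ j, D * K q j * ∑ σ, M σ j * ∑ ν, B σ ν * a ν := by
    simp only [Finset.mul_sum, Finset.sum_mul]
    rw [Finset.sum_comm]
    conv_rhs => rw [Finset.sum_comm]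
    refine Finset.sum_congr rfl fun σ _ => ?_
    rw [Finset.sum_comm]
    exact Finset.sum_congr rfl fun _ _ => Finset.sum_congr rfl fun _ _ => by ring
  have h3 : ∑ ν, D * (∑ σ, ∑ k, ∑ l, P σ k l * (K q k * ∑ p, K p l * dB p σ ν)) * a ν =
      ∑ j, D * K q j * ∑ σ, ∑ i, P σ i j * ∑ p, K p i * ∑ ν, dB p σ ν * a ν := by
    simp only [Finset.mul_sum, Finset.sum_mul]
    rw [Finset.sum_comm]
    conv_rhs => rw [Finset.sum_comm]
    refine Finset.sum_congr rfl fun σ _ => ?_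
    rw [Finset.sum_comm]
    refine Finset.sum_congr rfl fun k _ => ?_
    rw [Finset.sum_comm]
    refine Finset.sum_congr rfl fun l _ => ?_
    rw [Finset.sum_comm]
    exact Finset.sum_congr rfl fun _ _ => Finset.sum_congr rfl fun _ _ => by rw [hP σ k l]; ring
  have h4 : ∑ ν, ∑ i, (∑ σ, ∑ k, ∑ l, D * K i k * P σ k l * (K q l * B σ ν)) * b i ν =
      ∑ j, D * K q j * ∑ σ, ∑ i, P σ i j * ∑ p, K p i * ∑ ν, B σ ν * b p ν := by
    simp only [Finset.mul_sum, Finset.sum_mul]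
    conv_rhs =>
      rw [Finset.sum_comm]
      enter [2, σ]; rw [Finset.sum_comm]
      enter [2, k, 2, l]; rw [Finset.sum_comm]
    conv_rhs =>
      enter [2, σ, 2, k]; rw [Finset.sum_comm]
      enter [2, ν]; rw [Finset.sum_comm]
    conv_rhs =>
      enter [2, σ]; rw [Finset.sum_comm]
      enter [2, ν]; rw [Finset.sum_comm]
    conv_rhs => rw [Finset.sum_comm]
    refine Finset.sum_congr rfl fun ν _ => ?_
    conv_rhs => rw [Finset.sum_comm]
    refine Finset.sum_congr rfl fun p _ => ?_
    exact Finset.sum_congr rfl fun _ _ => Finset.sum_congr rfl fun _ _ =>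
      Finset.sum_congr rfl fun _ _ => by ring
  simp only [mul_add, add_mul, Finset.sum_add_distrib] at h1 h2 h3 h4 ⊢
  linarith

/-- Contact forms depend only on the vertical part u of v, and the transition maps vertical parts to
vertical parts; so both sides become linear expressions in u and in the base components of v. -/
theorem caratheodoryFactor_transform
    (hL : ∀ w, base w ∈ t.dom → L w = (jacobian t.G w.1).det * Lb (t.T 2 w))
    (hLb : ∀ w, base w ∈ t.dom → ContDiffAt ℝ ∞ Lb (t.T 2 w))
    {z : JetModel n m 3} (hz : base z ∈ t.dom) (q : Fin n) :
    caratheodoryFactor L q z = ∑ j, ((jacobian t.G z.1).det * t.K z.1 q j) •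
      (caratheodoryFactor Lb j (t.T 3 z)).comp (fderiv ℝ (t.T 3) z) := by
  refine ContinuousLinearMap.ext fun v => ?_
  have hw : base (proj (n := n) (m := m) (Nat.le_succ 2) z) ∈ t.dom := hz
  have hw1 : base (proj (n := n) (m := m) (r := 3) (s := 1) (by norm_num) z) ∈ t.dom := hz
  set u : JetModel n m 2 := proj (Nat.le_succ 2) v - horVec z v with hu
  have hu1 : u.1 = 0 := by
    rw [hu, Prod.fst_sub, horVec_fst, proj_fst, sub_self]
  have hu1' : (proj (n := n) (m := m) (r := 2) (s := 1) (by norm_num) u).1 = 0 := hu1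
  have hc : ∀ J σ, contactForm J σ z v = u.2 J σ := fun J σ => contactForm_eq_vertical J σ z v
  have hc' : ∀ J σ, contactForm J σ (t.T 3 z) (fderiv ℝ (t.T 3) z v) =
      (fderiv ℝ (t.T 2) (proj (Nat.le_succ 2) z) u).2 J σ := fun J σ => by
    rw [contactForm_eq_vertical, vertical_fderiv_T hz]
  have hc0 : ∀ σ, contactForm idx0 σ (t.T 3 z) (fderiv ℝ (t.T 3) z v) =
      ∑ ν, t.fiberJacobian σ ν (proj (by norm_num) z) * u.2 idx0 ν := fun σ => by
    rw [hc']
    refine (fderiv_T_two_idx1 hw idx0 σ).trans ?_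
    exact fderiv_T_one_idx0 hw1 hu1' σ
  have hc1 : ∀ k σ, contactForm (idx1 k) σ (t.T 3 z) (fderiv ℝ (t.T 3) z v) =
      ∑ i, t.K z.1 i k * ∑ ν, (formalDeriv i (t.fiberJacobian σ ν) (proj (by norm_num) z) *
        u.2 idx0 ν + t.fiberJacobian σ ν (proj (by norm_num) z) * u.2 (idx1 i) ν) := fun k σ => by
    rw [hc']
    refine (fderiv_T_two_idx1 hw (idx1 k) σ).trans ?_
    exact fderiv_T_one_idx1 hw1 hu1' k σ
  have hG : ∀ k, (fderiv ℝ (t.T 3) z v).1 k = ∑ i, jacobian t.G z.1 k i * v.1 i := by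
    intro k
    rw [fderiv_T_fst hz]
    conv_lhs => rw [show v.1 = ∑ i, v.1 i • (Pi.single i (1 : ℝ) : Fin n → ℝ) by
      ext l; simp [Pi.single_apply]]
    simp [jacobian, mul_comm]
  have hKJ : ∑ j, t.K z.1 q j * ∑ i, jacobian t.G z.1 j i * v.1 i = v.1 q := by
    have := congrFun (congrArg (fun A => A.mulVec v.1) (mul_jacobian hz)) q
    rw [← Matrix.mulVec_mulVec, Matrix.one_mulVec] at this
    exact this
  simp only [_root_.sum_apply, _root_.smul_apply, ContinuousLinearMap.comp_apply, smul_eq_mul]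
  simp only [caratheodoryFactor_apply, hc, hc0, hc1, hG]
  have e1 := hL _ hw
  rw [← t.proj_comm 2 z hz] at e1
  have e2 : ∀ ν i, partial2 L ν i q (proj (Nat.le_succ 2) z) = _ := fun ν i =>
    partial2_transform hL hLb hw ν i q
  rw [← t.proj_comm 2 z hz] at e2
  rw [show (L (proj (by norm_num) z)) = _ from e1]
  simp only [momentum_transform hL hLb hz]
  rw [Finset.sum_congr rfl fun ν _ => Finset.sum_congr rfl fun i _ =>
    congrArg (· * u.2 (idx1 i) ν) (e2 ν i)]
  exact sum_transform (fun σ k l => partial2_comm Lb σ k l _) v.1 (fun ν => u.2 idx0 ν)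
    (fun i ν => u.2 (idx1 i) ν) q hKJ

end JetTransition

end JetVar

/-! ### Globalization: horizontality, compatibility of charts, and the resulting form. -/

namespace JetVar

/-- The factors involve only dx^i, ω^σ and ω^σ_i, all of which kill vectors without components of
order at most one; the determinant then has a zero column. -/
theorem caratheodoryProduct_eq_zero {n m : ℕ} (L : JetModel (n + 1) m 2 → ℝ)
    (z : JetModel (n + 1) m 3) (v : Fin (n + 1) → JetModel (n + 1) m 3) (i : Fin (n + 1))
    (hi : proj (s := 1) (by norm_num) (v i) = 0) : caratheodoryProduct L z v = 0 := by
  have h1 : (v i).1 = 0 := congrArg Prod.fst hi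
  have h2 : ∀ (J : MultiIdx (n + 1) 1) σ,
      contactForm (J.incl (Nat.le_succ 1)) σ z (v i) = 0 := fun J σ => by
    have h : (v i).2 ((J.incl (Nat.le_succ 1)).incl (Nat.le_succ 2)) σ = 0 :=
      congrFun (congrFun (congrArg Prod.snd hi) J) σ
    simp [contactForm_apply, h1, h]
  have h3 : ∀ j, caratheodoryFactor L j z (v i) = 0 := fun j => by
    rw [caratheodoryFactor_apply, h1]
    have h4 : ∀ σ, contactForm idx0 σ z (v i) = 0 := h2 idx0
    have h5 : ∀ k σ, contactForm (idx1 k) σ z (v i) = 0 := fun k σ => h2 (idx1 k) σ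
    simp [h4, h5]
  change _ * bigWedge (n + 1) (fun j => caratheodoryFactor L j z) v = 0
  rw [bigWedge_apply, Matrix.det_eq_zero_of_column_eq_zero i fun j => h3 j, mul_zero]

theorem caratheodoryProduct_eq_bigWedge {n m : ℕ} (L : JetModel (n + 1) m 2 → ℝ)
    (z : JetModel (n + 1) m 3) :
    caratheodoryProduct L z = bigWedge (n + 1) fun j =>
      if j = 0 then (1 / L (proj (by norm_num) z) ^ n) • caratheodoryFactor L j z
      else caratheodoryFactor L j z :=
  (bigWedge_smul_zero _ _).symm

namespace JetTransition

variable {n m : ℕ}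

theorem det_jacobian_mul {t : JetTransition n m} {p : (Fin n → ℝ) × (Fin m → ℝ)}
    (hp : p ∈ t.dom) : (jacobian t.G p.1).det * (t.K p.1).det = 1 := by
  rw [← Matrix.det_mul, t.jacobian_mul p hp, Matrix.det_one]

theorem caratheodoryProduct_transform {t : JetTransition (n + 1) m}
    {L Lb : JetModel (n + 1) m 2 → ℝ}
    (hL : ∀ w, base w ∈ t.dom → L w = (jacobian t.G w.1).det * Lb (t.T 2 w))
    (hLb : ∀ w, base w ∈ t.dom → ContDiffAt ℝ ∞ Lb (t.T 2 w))
    {z : JetModel (n + 1) m 3} (hz : base z ∈ t.dom) :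
    caratheodoryProduct L z =
      (caratheodoryProduct Lb (t.T 3 z)).compContinuousLinearMap (fderiv ℝ (t.T 3) z) := by
  have hw : base (proj (n := n + 1) (m := m) (Nat.le_succ 2) z) ∈ t.dom := hz
  have e1 := hL _ hw
  rw [← t.proj_comm 2 z hz, proj_fst] at e1
  have hD := det_jacobian_mul hz
  rw [base_apply] at hD
  have hD0 : (jacobian t.G z.1).det ≠ 0 := left_ne_zero_of_mul_eq_one hD
  have h : (caratheodoryProduct Lb (t.T 3 z)).compContinuousLinearMap (fderiv ℝ (t.T 3) z) =
      (1 / Lb (proj (by norm_num) (t.T 3 z)) ^ n) • (bigWedge (n + 1) fun j =>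
        caratheodoryFactor Lb j (t.T 3 z)).compContinuousLinearMap (fderiv ℝ (t.T 3) z) := rfl
  rw [h, bigWedge_comp, caratheodoryProduct]
  simp only [caratheodoryFactor_transform hL hLb hz]
  have hs := bigWedge_sum_smul ((jacobian t.G z.1).det • t.K z.1) fun j =>
    (caratheodoryFactor Lb j (t.T 3 z)).comp (fderiv ℝ (t.T 3) z)
  simp only [Matrix.smul_apply, smul_eq_mul] at hs
  -- With D = det J, the determinant of D • K is D^{n+1} · D⁻¹ = D^n, cancelled by the factor D^n in
  -- L^n.
  rw [hs, smul_smul, show (L (proj (by norm_num) z)) = _ from e1, Matrix.det_smul,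
    Fintype.card_fin, pow_succ, mul_assoc, hD, mul_one, mul_pow, one_div, mul_inv, mul_right_comm,
    inv_mul_cancel₀ (pow_ne_zero _ hD0), one_mul, one_div]

theorem vol_fderiv_T {t : JetTransition n m} {r : ℕ} {z : JetModel n m r} (hz : base z ∈ t.dom) :
    vol (fun i => fderiv ℝ (t.T r) z (ddx i)) = (jacobian t.G z.1).det := by
  rw [vol, bigWedge_apply]
  congr 1
  ext k i
  change (fderiv ℝ (t.T r) z (ddx i)).1 k = _
  rw [fderiv_T_fst hz]
  rfl

end JetTransition

section Lagrangian

variable {n m : ℕ} {X Y : Type*}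
  [TopologicalSpace X] [ChartedSpace (Fin n → ℝ) X]
  [TopologicalSpace Y] [ChartedSpace ((Fin n → ℝ) × (Fin m → ℝ)) Y] {π : Y → X}
  {W : TopologicalSpace.Opens Y}

theorem FiberedChart.isOpen_jetRange (c : FiberedChart n m π) (r : ℕ) : IsOpen (c.jetRange r) := by
  rw [c.jetRange_eq]
  exact c.ψ.open_target.preimage base.continuous

theorem FiberedChart.preimage_proj_jetRange (c : FiberedChart n m π) {r s : ℕ} (h : s ≤ r) :
    proj h ⁻¹' c.jetRange s = c.jetRange r := by
  rw [c.jetRange_eq, c.jetRange_eq]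
  rfl

theorem FiberedChart.jetTransition_mem_jetRange {c c' : FiberedChart n m π} {r : ℕ}
    {z : JetModel n m r} (hz : base z ∈ c.overlap c') :
    c.jetTransition c' r z ∈ c'.jetRange r := by
  rw [c'.jetRange_eq, Set.mem_preimage, base_jetTransition (jetsDetermined_and_contDiffOn r).1 hz]
  exact c'.ψ.map_source hz.2

namespace JetForm

variable {r : ℕ} {lam : JetForm n m π W r n} {c c' : FiberedChart n m π}

theorem IsBaseHorizontal.rep_eq (h : lam.IsBaseHorizontal) (hc : c.ψ.source ⊆ W)
    {z : JetModel n m r} (hz : z ∈ c.jetRange r) : lam.rep c z = lam.lagrange c z • vol :=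
  eq_smul_vol_of_horizontal _ (h c hc z hz)

theorem IsBaseHorizontal.lagrange_ne_zero (h : lam.IsBaseHorizontal) (h0 : lam.NowhereVanishing)
    (hc : c.ψ.source ⊆ W) {z : JetModel n m r} (hz : z ∈ c.jetRange r) :
    lam.lagrange c z ≠ 0 := fun h1 =>
  h0 c hc z hz (by rw [h.rep_eq hc hz, h1, zero_smul])

theorem contDiffOn_lagrange (hc : c.ψ.source ⊆ W) :
    ContDiffOn ℝ ∞ (lam.lagrange c) (c.jetRange r) :=
  (ContinuousAlternatingMap.apply ℝ (JetModel n m r) ℝ fun i => ddx i).contDiff.comp_contDiffOn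
    (lam.smooth c hc)

/-- The Lagrange function is a density: the pull-back of ω₀ contributes the Jacobian determinant of
the base transition. -/
theorem IsBaseHorizontal.lagrange_eq (h : lam.IsBaseHorizontal) (hc : c.ψ.source ⊆ W)
    (hc' : c'.ψ.source ⊆ W) {z : JetModel n m r} (hz : base z ∈ c.overlap c') :
    lam.lagrange c z = (jacobian (c.baseTransition c') z.1).det *
      lam.lagrange c' (c.jetTransition c' r z) := by
  have hz' : z ∈ c.jetCoord r '' (c.jetDomain r ∩ c'.jetDomain r) := by
    rwa [FiberedChart.image_jetCoord_inter]
  rw [lagrange, lam.compatible c c' hc hc' z hz',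
    h.rep_eq hc' (FiberedChart.jetTransition_mem_jetRange hz)]
  have hv := JetTransition.vol_fderiv_T (t := c.toJetTransition c') hz
  change _ * vol (fun i => fderiv ℝ (c.jetTransition c' r) z (ddx i)) = _
  rw [mul_comm]
  exact congrArg (· * _) hv

end JetForm

end Lagrangian

/-! ### The global form and its properties. -/

section Caratheodory

variable {n m : ℕ} {X Y : Type*}
  [TopologicalSpace X] [ChartedSpace (Fin (n + 1) → ℝ) X]
  [TopologicalSpace Y] [ChartedSpace ((Fin (n + 1) → ℝ) × (Fin m → ℝ)) Y] {π : Y → X}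
  {W : TopologicalSpace.Opens Y}

namespace JetForm

/-- The Carathéodory form of a nowhere vanishing Lagrangian of second order. -/
def caratheodory (lam : JetForm (n + 1) m π W 2 (n + 1)) (hlam : lam.IsBaseHorizontal)
    (h0 : lam.NowhereVanishing) : JetForm (n + 1) m π W 3 (n + 1) where
  rep c := caratheodoryProduct (lam.lagrange c)
  smooth c hc := by
    rw [← c.preimage_proj_jetRange (Nat.le_succ 2)]
    exact contDiffOn_caratheodoryProduct (c.isOpen_jetRange 2) (lam.contDiffOn_lagrange hc)
      fun w hw => hlam.lagrange_ne_zero h0 hc hw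
  compatible c c' hc hc' z hz := by
    rw [FiberedChart.image_jetCoord_inter] at hz
    refine JetTransition.caratheodoryProduct_transform (t := c.toJetTransition c')
      (fun w hw => hlam.lagrange_eq hc hc' hw) (fun w hw => ?_) hz
    exact (lam.contDiffOn_lagrange hc').contDiffAt
      ((c'.isOpen_jetRange 2).mem_nhds (FiberedChart.jetTransition_mem_jetRange hw))

variable {lam : JetForm (n + 1) m π W 2 (n + 1)}

theorem isLepageEquivalent_caratheodory (hlam : lam.IsBaseHorizontal) (h0 : lam.NowhereVanishing) :
    (lam.caratheodory hlam h0).IsLepageEquivalent lam where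
  equivalent c hc q hs hr z hz := by
    have hz2 : proj hr z ∈ c.jetRange 2 := by
      rwa [← Set.mem_preimage, c.preimage_proj_jetRange]
    have h1 := hor_caratheodoryProduct (L := lam.lagrange c) (proj hs z)
      (hlam.lagrange_ne_zero h0 hc hz2)
    change (hor (caratheodoryProduct (lam.lagrange c)) (proj hs z)).compContinuousLinearMap _ = _
    rw [h1, hlam.rep_eq hc hz2]
    ext v
    have e1 := congrArg (fun β => β v) (vol_comp_proj (n := n + 1) (m := m) hs)
    have e2 := congrArg (fun β => β v) (vol_comp_proj (n := n + 1) (m := m) hr)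
    exact congrArg (lam.lagrange c (proj hr z) * ·) (e1.trans e2.symm)
  lepage c hc ξ _ hξ z hz := by
    refine hor_eq_zero z ?_
    have hz3 : proj (Nat.le_succ 3) z ∈ c.jetRange 3 := by
      rwa [← Set.mem_preimage, c.preimage_proj_jetRange]
    exact extDeriv_caratheodoryProduct (c.isOpen_jetRange 2) (lam.contDiffOn_lagrange hc)
      (fun w hw => hlam.lagrange_ne_zero h0 hc hw) z
      (by rwa [← Set.mem_preimage, c.preimage_proj_jetRange]) _ (hξ _ hz3)

theorem isDecomposable_caratheodory (hlam : lam.IsBaseHorizontal) (h0 : lam.NowhereVanishing) :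
    (lam.caratheodory hlam h0).IsDecomposable := by
  intro c hc
  have hf : ∀ j, ContDiffOn ℝ ∞ (caratheodoryFactor (lam.lagrange c) j) (c.jetRange 3) :=
    fun j => by
      rw [← c.preimage_proj_jetRange (Nat.le_succ 2)]
      exact contDiffOn_caratheodoryFactor (c.isOpen_jetRange 2) (lam.contDiffOn_lagrange hc) j
  have hg : ContDiffOn ℝ ∞ (fun z : JetModel (n + 1) m 3 =>
      1 / lam.lagrange c (proj (by norm_num) z) ^ n) (c.jetRange 3) := by
    rw [← c.preimage_proj_jetRange (Nat.le_succ 2)]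
    exact contDiffOn_comp_proj _ (contDiffOn_one_div_pow (lam.contDiffOn_lagrange hc)
      (fun w hw => hlam.lagrange_ne_zero h0 hc hw) n)
  refine ⟨fun j z => if j = 0 then (1 / lam.lagrange c (proj (by norm_num) z) ^ n) •
    caratheodoryFactor (lam.lagrange c) j z else caratheodoryFactor (lam.lagrange c) j z,
    fun j => ?_, fun z _ => caratheodoryProduct_eq_bigWedge _ z⟩
  by_cases h : j = 0
  · simp only [h, if_true]
    exact hg.smul (hf 0)
  · simp only [h, if_false]
    exact hf j

end JetForm

end Caratheodory

end JetVar

end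

theorem mainTheorem1 (n m : ℕ) {X Y : Type*}
    [TopologicalSpace X] [ChartedSpace (Fin (n + 1) → ℝ) X]
    [IsManifold 𝓘(ℝ, Fin (n + 1) → ℝ) ∞ X]
    [TopologicalSpace Y] [ChartedSpace ((Fin (n + 1) → ℝ) × (Fin m → ℝ)) Y]
    [IsManifold 𝓘(ℝ, (Fin (n + 1) → ℝ) × (Fin m → ℝ)) ∞ Y]
    (π : Y → X) (_hπ : IsFiberedManifold (n + 1) m π)
    (W : TopologicalSpace.Opens Y)
    (lam : JetForm (n + 1) m π W 2 (n + 1))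
    (_hhor : lam.IsBaseHorizontal) (_hne : lam.NowhereVanishing) :
    ∃ Lam : JetForm (n + 1) m π W 3 (n + 1),
      (∀ c : FiberedChart (n + 1) m π, c.ψ.source ⊆ W → ∀ z ∈ c.jetRange 4,
        Lam.rep c (proj (by norm_num) z) = caratheodoryContraction (lam.lagrange c) z) ∧
      (∀ c : FiberedChart (n + 1) m π, c.ψ.source ⊆ W → ∀ z ∈ c.jetRange 3,
        Lam.rep c z = caratheodoryProduct (lam.lagrange c) z) ∧
      Lam.IsLepageEquivalent lam ∧
      Lam.IsDecomposable ∧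
      Lam.IsHorizontal 1 (by norm_num) :=
  ⟨lam.caratheodory _hhor _hne, fun c _ z _ => (caratheodoryContraction_eq (lam.lagrange c) z).symm,
    fun _ _ _ _ => rfl, lam.isLepageEquivalent_caratheodory _hhor _hne,
    lam.isDecomposable_caratheodory _hhor _hne,
    fun c _ z _ v ⟨i, hi⟩ => caratheodoryProduct_eq_zero (lam.lagrange c) z v i hi⟩
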